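/- Throughout, $(\Omega,\mu)$ is a $\sigma$-finite measure space and functions are complex-valued and identified if equal almost everywhere. A Banach lattice of measurable functions on $\Omega$ is a Banach space $X$ of measurable functions for which there is a constant $C$ such that $f\in X$, $g$ measurable and $|g|\le |f|$ a.e. imply $g\in X$ and $\|g\|_X\le C\|f\|_X$. Its norm is order continuous if $\|f_n\|_X\to0$ for every nonincreasing sequence of functions $f_n\in X$ converging to $0$ a.e. The space $X(\ell^\infty)$ consists of the measurable functions $f=\{f_j\}_{j\in\mathbb Z}$ on $\Omega\times\mathbb Z$ with $\|f\|_{X(\ell^\infty)}=\|\sup_j|f_j|\|_X<\infty$. For $0<\theta<1$ the Calderón product $X_0^{1-\theta}X_1^{\theta}$ consists of the measurable $f$ with $$\|f\|_{X_0^{1-\theta}X_1^\theta}=\inf\Big\{\big\||f_0|^{\frac1{1-\theta}}\big\|_{X_0}^{1-\theta}\,\big\||f_1|^{\frac1\theta}\big\|_{X_1}^{\theta}\ :\ f=f_0f_1\Big\}<\infty ,$$ and $X_0^{1-\theta}X_1^\theta(\ell^\infty)$ is defined from it in the same way as $X(\ell^\infty)$ is from $X$. For two spaces $A_0,A_1$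 contained in a common vector space, let $\mathcal F_{A_0,A_1}$ be the space of all bounded continuous functions $f:z\mapsto f_z$ from the strip $\{0\le\operatorname{Re}z\le1\}$ to $A_0+A_1$ that are analytic in its interior and such that, for $j=0,1$, $t\mapsto f_{j+it}$ is a continuous function from $\mathbb R$ to $A_j$ tending to $0$ in $A_j$ as $|t|\to\infty$; put $\|f\|_{\mathcal F}=\sup_{t\in\mathbb R,\,j\in\{0,1\}}\|f_{j+it}\|_{A_j}$. Then $(A_0,A_1)_\theta=\{f_\theta: f\in\mathcal F_{A_0,A_1}\}$ with the norm $\|a\|_{(A_0,A_1)_\theta}=\inf\{\|f\|_{\mathcal F}: f\in\mathcal F_{A_0,A_1},\ f_\theta=a\}$. **Proposition.** Let $X_0$ and $X_1$ be Banach lattices of measurable functions on $\Omega$, and suppose that $X_0$ has order continuous norm. Then for every $0<\theta<1$ $$\big(X_0(\ell^\infty),X_1(\ell^\infty)\big)_\theta = X_0^{1-\theta}X_1^\theta(\ell^\infty)$$ as sets and with equivalent norms: if $C_0,C_1$ are constants as in the definition of a lattice for $X_0,X_1$, each of the two norms is at most $C_0^{1-\theta}C_1^{\theta}$ times the other; in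 particular the norms are equal if $C_0=C_1=1$. Moreover, for $j=0,1$, if $X_j\ne\{0\}$ then the norm of $X_j(\ell^\infty)$ is not order continuous (so the equality holds although these lattices never have order continuous norm). -/

import Mathlib

open MeasureTheory Filter Topology Set
open scoped ENNReal NNReal

noncomputable section

/-! Norms of spaces contained in an ambient complex vector space `V` are written as extended
functionals `N : V → ℝ≥0∞`; the space is `{a | N a < ∞}` and `N` is its norm there. -/

namespace ComplexInterp

variable {V : Type*} [AddCommGroup V] [Module ℂ V]

/-- The norm of `X₀ + X₁`: the infimum of `‖b‖_{X₀} + ‖a - b‖_{X₁}`. -/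
def sumNorm (N₀ N₁ : V → ℝ≥0∞) (a : V) : ℝ≥0∞ :=
  ⨅ b : V, N₀ b + N₁ (a - b)

/-- The closed strip `0 ≤ Re z ≤ 1`. -/
def strip : Set ℂ := {z | 0 ≤ z.re ∧ z.re ≤ 1}

/-- The function `t ↦ f (x + i t)` is a continuous function from the real line to the space with
norm `N`, and it tends to zero in that space as `|t| → ∞`. -/
structure IsC0OnLine (N : V → ℝ≥0∞) (f : ℂ → V) (x : ℝ) : Prop where
  mem : ∀ t : ℝ, N (f (x + t * Complex.I)) < ∞
  continuous : ∀ t : ℝ,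
    Tendsto (fun s : ℝ => N (f (x + s * Complex.I) - f (x + t * Complex.I))) (𝓝 t) (𝓝 0)
  decay : Tendsto (fun t : ℝ => N (f (x + t * Complex.I))) (cocompact ℝ) (𝓝 0)

/-- The space `𝓕_{X₀, X₁}`: bounded continuous functions from the strip to `X₀ + X₁`, analytic
(complex differentiable) in its interior, whose restriction to the line `Re z = j` is a continuous
`X_j`-valued function vanishing at infinity, `j = 0, 1`. Values outside the strip are ignored. -/
structure MemF (N₀ N₁ : V → ℝ≥0∞) (f : ℂ → V) : Prop where
  bounded : ∃ M : ℝ≥0, ∀ z ∈ strip, sumNorm N₀ N₁ (f z) ≤ M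
  continuous : ∀ z ∈ strip, Tendsto (fun w => sumNorm N₀ N₁ (f w - f z)) (𝓝[strip] z) (𝓝 0)
  analytic : ∀ z ∈ interior strip, ∃ d : V,
    Tendsto (fun w => sumNorm N₀ N₁ ((w - z)⁻¹ • (f w - f z) - d)) (𝓝[≠] z) (𝓝 0)
  line_zero : IsC0OnLine N₀ f 0
  line_one : IsC0OnLine N₁ f 1

/-- The norm of `𝓕_{X₀, X₁}`. -/
def normF (N₀ N₁ : V → ℝ≥0∞) (f : ℂ → V) : ℝ≥0∞ :=
  ⨆ t : ℝ, max (N₀ (f ((0 : ℝ) + t * Complex.I))) (N₁ (f ((1 : ℝ) + t * Complex.I)))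

/-- The complex interpolation space `(X₀, X₁)_θ`, as a set. -/
def interpSpace (N₀ N₁ : V → ℝ≥0∞) (θ : ℝ) : Set V :=
  {a | ∃ f : ℂ → V, MemF N₀ N₁ f ∧ f θ = a}

/-- The norm of the complex interpolation space `(X₀, X₁)_θ` (it is `∞` off that space). -/
def interpNorm (N₀ N₁ : V → ℝ≥0∞) (θ : ℝ) (a : V) : ℝ≥0∞ :=
  ⨅ (f : ℂ → V) (_ : MemF N₀ N₁ f) (_ : f θ = a), normF N₀ N₁ f

end ComplexInterp

section Lattices

variable {Ω : Type*} [MeasurableSpace Ω] {μ : Measure Ω}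

/-- `|g| ≤ |f|` almost everywhere implies `‖g‖ ≤ C ‖f‖` (and `g` lies in the space if `f` does). -/
def SolidWith (N : (Ω →ₘ[μ] ℂ) → ℝ≥0∞) (C : ℝ≥0) : Prop :=
  ∀ f g : Ω →ₘ[μ] ℂ, (∀ᵐ x ∂μ, ‖g x‖ ≤ ‖f x‖) → N g ≤ C * N f

/-- The norm is order continuous: `‖u n‖ → 0` for each nonincreasing sequence of (real) functions
`u n` of the space that converges to `0` almost everywhere. -/
def OrderContinuousNorm (N : (Ω →ₘ[μ] ℂ) → ℝ≥0∞) : Prop :=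
  ∀ u : ℕ → (Ω →ₘ[μ] ℂ), (∀ n, N (u n) < ∞) →
    (∀ᵐ x ∂μ, (∀ n, (u n x).im = 0) ∧ Antitone (fun n => (u n x).re) ∧
      Tendsto (fun n => u n x) atTop (𝓝 0)) →
    Tendsto (fun n => N (u n)) atTop (𝓝 0)

/-- A (complex) Banach lattice of measurable functions: a Banach space of classes of measurable
functions modulo equality almost everywhere, which is solid. The space is `{f | nrm f < ∞}`. -/
structure BanachFunctionLattice (μ : Measure Ω) where
  /-- the norm, extended by `∞` off the space -/
  nrm : (Ω →ₘ[μ] ℂ) → ℝ≥0∞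
  nrm_eq_zero : ∀ f, nrm f = 0 ↔ f = 0
  nrm_add_le : ∀ f g, nrm (f + g) ≤ nrm f + nrm g
  nrm_smul : ∀ (c : ℂ) f, nrm (c • f) = ‖c‖ₑ * nrm f
  complete : ∀ u : ℕ → (Ω →ₘ[μ] ℂ), (∀ n, nrm (u n) < ∞) →
    (∀ ε : ℝ≥0∞, 0 < ε → ∃ n₀, ∀ m ≥ n₀, ∀ n ≥ n₀, nrm (u m - u n) ≤ ε) →
    ∃ f, nrm f < ∞ ∧ Tendsto (fun n => nrm (u n - f)) atTop (𝓝 0)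
  solid : ∃ C : ℝ≥0, SolidWith nrm C

/-- The function `|f|^p`. -/
def absPow (p : ℝ) (f : Ω →ₘ[μ] ℂ) : Ω →ₘ[μ] ℂ :=
  f.compMeasurable (fun z : ℂ => ((‖z‖ ^ p : ℝ) : ℂ)) (by fun_prop)

/-- The norm of the Calderon product `X₀^{1-θ} X₁^θ`. -/
def calderonNorm (N₀ N₁ : (Ω →ₘ[μ] ℂ) → ℝ≥0∞) (θ : ℝ) (f : Ω →ₘ[μ] ℂ) : ℝ≥0∞ :=
  ⨅ (f₀ : Ω →ₘ[μ] ℂ) (f₁ : Ω →ₘ[μ] ℂ) (_ : f = f₀ * f₁),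
    N₀ (absPow (1 / (1 - θ)) f₀) ^ (1 - θ) * N₁ (absPow (1 / θ) f₁) ^ θ

/-- `F = sup_j |f_j|` almost everywhere (in particular this supremum is finite). -/
def IsSupAbs (f : (Ω × ℤ) →ₘ[μ.prod Measure.count] ℂ) (F : Ω →ₘ[μ] ℂ) : Prop :=
  ∀ᵐ x ∂μ, ∃ r : ℝ, IsLUB (range fun j : ℤ => ‖f (x, j)‖) r ∧ F x = (r : ℂ)

/-- The norm `‖sup_j |f_j|‖_X` of `X(ℓ^∞)`, a space of functions on `Ω × ℤ`. There is at most one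
`F` as in the infimum, and none (so that the value is `∞`) if `sup_j |f_j|` is not finite a.e. -/
def linftyNorm (N : (Ω →ₘ[μ] ℂ) → ℝ≥0∞) (f : (Ω × ℤ) →ₘ[μ.prod Measure.count] ℂ) : ℝ≥0∞ :=
  ⨅ (F : Ω →ₘ[μ] ℂ) (_ : IsSupAbs f F), N F

end Lattices

end

/-! The lattice constants are removed by renorming. `solidHull` replaces the norm of X_j by the
supremum of the norms of all dominated functions; it lies between the old norm and C_j times it, and
is monotone with constant one. Completeness of X_j makes it countably subadditive, with constant one
again (`isLatticeNorm_solidHull`). This single property, `IsLatticeNorm`, passes to X(ℓ^∞), yields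
completeness, and makes the norm of a sum of two lattices separate points. The isometric statement
is proved for such norms, and the constants enter only in the final comparison.

From the interpolation space into the Calderón product: for F in 𝓕 and s > 0, the Poisson formula of
the strip at θ (`integral_kernel_smul_add`) is applied to s^{θ-z} F(z). The masses of the kernel on
the lines Re z = 0, 1 are in the ratio (1-θ) : θ, so almost everywhere |F(θ)| ≤ (1-θ) s^θ h_0 + θ
s^{θ-1} h_1, where h_j is the normalized Poisson average of |F(j+it)|. Since h_0, h_1 do not depend
on s, minimizing over s gives |F(θ)| ≤ h_0^{1-θ} h_1^θ (`MemF.exists_norm_le`). Suprema over the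
index in ℤ then give functions on Ω, and the resulting bound is turned into a factorization.

From the Calderón product into the interpolation space: if |f_j| ≤ g_0^{1-θ} g_1^θ for all j, the
natural candidate is f (g_1/g_0)^{z-θ} times a Gaussian. It lies in 𝓕 as soon as the parts of g_0
and g_1 on {|log(g_1/g_0)| > n} tend to zero in norm. Order continuity gives this for g_0 only. The
remedy (`exists_expFamily_of_orderContinuous`) is to multiply g_0 by a weight W ≥ 1 which tends to
infinity with |log(g_1/g_0)|, but so slowly that the norm of g_0 grows by at most ε, and to multiply
g_1 by W^{1-1/θ}. The geometric mean is unchanged, and the new g_1 has vanishing tails because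
W^{1-1/θ} tends to zero. All this happens on Ω; the functions on Ω × ℤ are merely dominated, so
order continuity of the ℓ^∞-valued spaces is never needed. That it fails is seen on the sequences
|f| 1_{j ≥ n}, which decrease to zero with constant norm. -/

noncomputable section

/-! ### Complete norms and lattice norms -/

/-- The extended functional `N` is a complete norm on the space `{a | N a < ∞}`. -/
structure IsBanachNorm {V : Type*} [AddCommGroup V] [Module ℂ V] (N : V → ℝ≥0∞) : Prop where
  eq_zero : ∀ a, N a = 0 → a = 0
  add_le : ∀ a b, N (a + b) ≤ N a + N b
  smul : ∀ (c : ℂ) a, N (c • a) = ‖c‖ₑ * N a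
  exists_tendsto_sum : ∀ u : ℕ → V, ∑' k, N (u k) < ∞ →
    ∃ a, Tendsto (fun n => N (∑ k ∈ Finset.range n, u k - a)) atTop (𝓝 0)

namespace IsBanachNorm

variable {V : Type*} [AddCommGroup V] [Module ℂ V] {N : V → ℝ≥0∞} (hN : IsBanachNorm N)
include hN

lemma map_zero : N 0 = 0 := by
  have := hN.smul 0 0
  simpa using this

lemma map_neg (a : V) : N (-a) = N a := by
  have := hN.smul (-1) a
  simpa using this

lemma sub_le (a b : V) : N (a - b) ≤ N a + N b := by
  rw [sub_eq_add_neg, ← hN.map_neg b]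
  exact hN.add_le _ _

end IsBanachNorm

section

variable {Ω : Type*} [MeasurableSpace Ω] {μ : Measure Ω}

/-- The extended functional `N` is a monotone complete norm on a space of classes of measurable
functions; completeness is expressed by countable subadditivity. -/
structure IsLatticeNorm (N : (Ω →ₘ[μ] ℂ) → ℝ≥0∞) : Prop where
  eq_zero : ∀ f, N f = 0 → f = 0
  smul : ∀ (c : ℂ) f, N (c • f) = ‖c‖ₑ * N f
  le_tsum : ∀ (u : ℕ → Ω →ₘ[μ] ℂ) (g : Ω →ₘ[μ] ℂ), (∀ᵐ x ∂μ, ‖g x‖ₑ ≤ ∑' k, ‖u k x‖ₑ) →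
    N g ≤ ∑' k, N (u k)

/-- The class of a measurable function. -/
def classOf (μ : Measure Ω) (φ : Ω → ℂ) (hφ : Measurable φ) : Ω →ₘ[μ] ℂ :=
  AEEqFun.mk φ hφ.aestronglyMeasurable

lemma coeFn_classOf (φ : Ω → ℂ) (hφ : Measurable φ) : classOf μ φ hφ =ᵐ[μ] φ :=
  AEEqFun.coeFn_mk _ _

lemma enorm_le_enorm_iff_norm {a b : ℂ} : ‖a‖ₑ ≤ ‖b‖ₑ ↔ ‖a‖ ≤ ‖b‖ := by
  rw [enorm_le_iff_norm_le]

namespace IsLatticeNorm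

variable {N : (Ω →ₘ[μ] ℂ) → ℝ≥0∞} (hN : IsLatticeNorm N)
include hN

lemma map_zero : N 0 = 0 := by
  have := hN.smul 0 0
  rwa [show (0 : ℂ) • (0 : Ω →ₘ[μ] ℂ) = 0 from zero_smul ℂ (0 : Ω →ₘ[μ] ℂ), enorm_zero, zero_mul] at this

lemma le_add {f g h : Ω →ₘ[μ] ℂ} (hle : ∀ᵐ x ∂μ, ‖g x‖ ≤ ‖f x‖ + ‖h x‖) : N g ≤ N f + N h := by
  let u : ℕ → Ω →ₘ[μ] ℂ := fun k => if k = 0 then f else if k = 1 then h else 0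
  have key : ∀ φ : (Ω →ₘ[μ] ℂ) → ℝ≥0∞, φ 0 = 0 → ∑' k, φ (u k) = φ f + φ h := by
    intro φ h0
    rw [tsum_eq_sum (s := Finset.range 2)]
    · simp [Finset.sum_range_succ, u]
    · intro k hk
      have : 1 < k := by simpa using hk
      have h1 : k ≠ 0 := by omega
      have h2 : k ≠ 1 := by omega
      simp [u, h1, h2, h0]
  rw [← key N hN.map_zero]
  refine hN.le_tsum _ _ ?_
  filter_upwards [hle, AEEqFun.coeFn_zero (μ := μ) (β := ℂ)] with x hx h0
  rw [key (fun k => ‖k x‖ₑ) (by rw [h0]; simp)]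
  rw [← ofReal_norm, ← ofReal_norm, ← ofReal_norm, ← ENNReal.ofReal_add (norm_nonneg _)
    (norm_nonneg _)]
  exact ENNReal.ofReal_le_ofReal hx

lemma mono {f g : Ω →ₘ[μ] ℂ} (hle : ∀ᵐ x ∂μ, ‖g x‖ ≤ ‖f x‖) : N g ≤ N f := by
  have := hN.le_add (f := f) (g := g) (h := 0) (by
    filter_upwards [hle] with x hx
    linarith [norm_nonneg ((0 : Ω →ₘ[μ] ℂ) x)])
  simpa [hN.map_zero] using this

lemma congr_norm {f g : Ω →ₘ[μ] ℂ} (hle : ∀ᵐ x ∂μ, ‖g x‖ = ‖f x‖) : N g = N f :=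
  le_antisymm (hN.mono (hle.mono fun _ h => h.le)) (hN.mono (hle.mono fun _ h => h.ge))

lemma add_le (f g : Ω →ₘ[μ] ℂ) : N (f + g) ≤ N f + N g :=
  hN.le_add (by
    filter_upwards [AEEqFun.coeFn_add f g] with x hx
    rw [hx]; exact norm_add_le _ _)

/-- Let A be the set where the sum is infinite. Every multiple n 1_A is dominated by the sum, so n
N(1_A) stays below a finite bound for all n; hence N(1_A) = 0 and A is null. -/
lemma ae_tsum_lt_top {u : ℕ → Ω →ₘ[μ] ℂ} (hu : ∑' k, N (u k) < ∞) :
    ∀ᵐ x ∂μ, ∑' k, ‖u k x‖ₑ < ∞ := by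
  have hA : MeasurableSet {x | ∑' k, ‖u k x‖ₑ = ∞} :=
    (Measurable.tsum fun k => (u k).measurable.enorm) (measurableSet_singleton _)
  set χ := classOf μ _ ((measurable_const (a := (1 : ℂ))).indicator hA) with hχ
  have h1 : ∀ n : ℕ, (n : ℝ≥0∞) * N χ ≤ ∑' k, N (u k) := fun n => by
    have : (n : ℝ≥0∞) = ‖(n : ℂ)‖ₑ := by
      rw [← ofReal_norm, Complex.norm_natCast, ENNReal.ofReal_natCast]
    rw [this, ← hN.smul]
    refine hN.le_tsum _ _ ?_
    filter_upwards [AEEqFun.coeFn_smul (n : ℂ) χ,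
      coeFn_classOf (μ := μ) _ ((measurable_const (a := (1 : ℂ))).indicator hA)] with x hx hx'
    rw [hx, Pi.smul_apply, hχ, hx']
    by_cases hm : ∑' k, ‖u k x‖ₑ = ∞
    · rw [hm]; exact le_top
    · rw [indicator_of_notMem (by simpa using hm)]; simp
  have h2 : N χ = 0 := by
    by_contra h0
    have := ENNReal.exists_nat_mul_gt h0 hu.ne
    obtain ⟨n, hn⟩ := this
    exact absurd (h1 n) (not_le.2 hn)
  have h3 := hN.eq_zero _ h2
  filter_upwards [coeFn_classOf (μ := μ) _ ((measurable_const (a := (1 : ℂ))).indicator hA),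
    AEEqFun.coeFn_zero (μ := μ) (β := ℂ)] with x hx h0
  rw [← hχ, h3, h0] at hx
  by_contra hm
  rw [indicator_of_mem (by simpa using hm)] at hx
  simp at hx

/-- A series with summable norms converges absolutely almost everywhere, and the remainder of its
pointwise sum is dominated by the tail of the series of moduli; countable subadditivity turns this
into norm convergence. -/
lemma isBanachNorm : IsBanachNorm N where
  eq_zero := hN.eq_zero
  add_le := hN.add_le
  smul := hN.smul
  exists_tendsto_sum u hu := by
    have hfin := hN.ae_tsum_lt_top hu
    have hs : ∀ᵐ x ∂μ, Summable fun k => ‖u k x‖ := by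
      filter_upwards [hfin] with x hx
      simpa [← enorm_eq_nnnorm, NNReal.summable_coe] using
        ENNReal.tsum_coe_ne_top_iff_summable_coe.1 hx.ne
    have hm : AEStronglyMeasurable (fun x => ∑' k, u k x) μ := by
      refine aestronglyMeasurable_of_tendsto_ae atTop
        (f := fun n x => ∑ k ∈ Finset.range n, u k x) (fun n => ?_) ?_
      · exact Finset.aestronglyMeasurable_fun_sum _ fun k _ => (u k).aestronglyMeasurable
      · filter_upwards [hs] with x hx using hx.of_norm.hasSum.tendsto_sum_nat
    refine ⟨AEEqFun.mk _ hm, ?_⟩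
    refine tendsto_of_tendsto_of_tendsto_of_le_of_le tendsto_const_nhds
      (ENNReal.tendsto_sum_nat_add _ hu.ne) (fun n => zero_le) fun n => ?_
    refine hN.le_tsum _ _ ?_
    filter_upwards [hs, AEEqFun.coeFn_mk _ hm, AEEqFun.coeFn_sub (∑ k ∈ Finset.range n, u k)
      (AEEqFun.mk _ hm), AEEqFun.coeFn_fun_finsetSum (Finset.range n) u] with x h1 h2 h3 h4
    rw [h3, Pi.sub_apply, h2, h4, ← h1.of_norm.sum_add_tsum_nat_add n, sub_add_cancel_left,
      enorm_neg]
    exact enorm_tsum_le_tsum_enorm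

end IsLatticeNorm

/-! ### Renorming by the solid hull -/

/-- The largest value of `N` on the functions dominated by `f`. -/
def solidHull (N : (Ω →ₘ[μ] ℂ) → ℝ≥0∞) (f : Ω →ₘ[μ] ℂ) : ℝ≥0∞ :=
  ⨆ (g : Ω →ₘ[μ] ℂ) (_ : ∀ᵐ x ∂μ, ‖g x‖ ≤ ‖f x‖), N g

lemma le_solidHull {N : (Ω →ₘ[μ] ℂ) → ℝ≥0∞} {f g : Ω →ₘ[μ] ℂ} (h : ∀ᵐ x ∂μ, ‖g x‖ ≤ ‖f x‖) :
    N g ≤ solidHull N f :=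
  le_iSup₂ (f := fun (g : Ω →ₘ[μ] ℂ) (_ : ∀ᵐ x ∂μ, ‖g x‖ ≤ ‖f x‖) => N g) g h

lemma self_le_solidHull (N : (Ω →ₘ[μ] ℂ) → ℝ≥0∞) (f : Ω →ₘ[μ] ℂ) : N f ≤ solidHull N f :=
  le_solidHull (ae_of_all _ fun _ => le_rfl)

lemma SolidWith.solidHull_le {N : (Ω →ₘ[μ] ℂ) → ℝ≥0∞} {C : ℝ≥0} (h : SolidWith N C)
    (f : Ω →ₘ[μ] ℂ) : solidHull N f ≤ C * N f :=
  iSup₂_le fun g hg => h f g hg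

namespace BanachFunctionLattice

variable (X : BanachFunctionLattice μ)

lemma nrm_zero : X.nrm 0 = 0 := (X.nrm_eq_zero 0).2 rfl

lemma nrm_sub_rev (f g : Ω →ₘ[μ] ℂ) : X.nrm (f - g) = X.nrm (g - f) := by
  have := X.nrm_smul (-1) (g - f)
  rwa [show (-1 : ℂ) • (g - f) = f - g from (neg_one_smul ℂ _).trans (neg_sub _ _), enorm_neg,
    enorm_one, one_mul] at this

lemma nrm_sum_le {ι : Type*} (s : Finset ι) (u : ι → Ω →ₘ[μ] ℂ) :
    X.nrm (∑ k ∈ s, u k) ≤ ∑ k ∈ s, X.nrm (u k) :=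
  Finset.le_sum_of_subadditive _ X.nrm_zero.le X.nrm_add_le _ _

/-- If `∑ N(u k)` is finite, where `N` is the solid hull of the norm, then the partial sums of
`|u k|` converge in norm and are dominated by their limit. -/
lemma exists_tendsto_sum_norm {u a : ℕ → Ω →ₘ[μ] ℂ}
    (ha : ∀ k, ∀ᵐ x ∂μ, a k x = (‖u k x‖ : ℂ)) (hu : ∑' k, solidHull X.nrm (u k) < ∞) :
    ∃ G : Ω →ₘ[μ] ℂ, Tendsto (fun n => X.nrm (∑ k ∈ Finset.range n, a k - G)) atTop (𝓝 0) ∧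
      ∀ᵐ x ∂μ, ∀ n, ∑ k ∈ Finset.range n, ‖u k x‖ ≤ (G x).re := by
  obtain ⟨C, hC⟩ := X.solid
  have hau : ∀ k, X.nrm (a k) ≤ solidHull X.nrm (u k) := fun k =>
    le_solidHull (by filter_upwards [ha k] with x hx; rw [hx]; simp)
  have hdiff : ∀ n m, n ≤ m → X.nrm (∑ k ∈ Finset.range m, a k - ∑ k ∈ Finset.range n, a k) ≤
      ∑' k, solidHull X.nrm (u (k + n)) := by
    intro n m hnm
    rw [← Finset.sum_Ico_eq_sub _ hnm, Finset.sum_Ico_eq_sum_range]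
    refine (X.nrm_sum_le _ _).trans ?_
    refine le_trans (Finset.sum_le_sum fun k _ => hau _) ?_
    simp_rw [add_comm n]
    exact ENNReal.sum_le_tsum _
  have htail := ENNReal.tendsto_sum_nat_add _ hu.ne
  obtain ⟨G, -, hG⟩ := X.complete (fun n => ∑ k ∈ Finset.range n, a k) (fun n => by
      refine (X.nrm_sum_le _ _).trans_lt (lt_of_le_of_lt ?_ hu)
      exact (Finset.sum_le_sum fun k _ => hau k).trans (ENNReal.sum_le_tsum _)) (fun ε hε => by
      obtain ⟨n₀, hn₀⟩ := (htail.eventually (gt_mem_nhds hε)).exists_forall_of_atTop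
      refine ⟨n₀, fun m hm n hn => ?_⟩
      rcases le_total n m with h | h
      · exact (hdiff n m h).trans (hn₀ n hn).le
      · rw [X.nrm_sub_rev]
        exact (hdiff m n h).trans (hn₀ m hm).le)
  refine ⟨G, hG, ae_all_iff.2 fun n => ?_⟩
  have hsum : ∀ m, ∀ᵐ x ∂μ, (∑ k ∈ Finset.range m, a k - G : Ω →ₘ[μ] ℂ) x =
      ((∑ k ∈ Finset.range m, ‖u k x‖ : ℝ) : ℂ) - G x := fun m => by
    filter_upwards [AEEqFun.coeFn_sub (∑ k ∈ Finset.range m, a k) G,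
      AEEqFun.coeFn_fun_finsetSum (Finset.range m) a, ae_all_iff.2 ha] with x h1 h2 h3
    rw [h1, Pi.sub_apply, h2, Complex.ofReal_sum]
    simp_rw [h3]
  have hdm : Measurable fun x => ((max (∑ k ∈ Finset.range n, ‖u k x‖ - (G x).re) 0 : ℝ) : ℂ) := by
    refine Complex.measurable_ofReal.comp (Measurable.max (Measurable.sub ?_ ?_) measurable_const)
    · exact Finset.measurable_fun_sum _ fun k _ => (u k).measurable.norm
    · exact Complex.measurable_re.comp G.measurable
  have hd : classOf μ _ hdm = 0 := by
    rw [← X.nrm_eq_zero]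
    refine le_antisymm (ge_of_tendsto (ENNReal.Tendsto.const_mul hG
      (Or.inr (ENNReal.coe_ne_top (r := C)))) ?_ |>.trans_eq (mul_zero _)) zero_le
    filter_upwards [eventually_ge_atTop n] with m hm
    refine hC _ _ ?_
    filter_upwards [coeFn_classOf _ hdm, hsum m] with x h1 h2
    rw [h1, h2, Complex.norm_real, Real.norm_of_nonneg (le_max_right _ _)]
    refine max_le ?_ (norm_nonneg _)
    refine le_trans ?_ (Complex.re_le_norm _)
    rw [Complex.sub_re, Complex.ofReal_re]
    gcongr
  filter_upwards [coeFn_classOf _ hdm, AEEqFun.coeFn_zero (μ := μ) (β := ℂ)] with x h1 h2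
  rw [hd, h2, Pi.zero_apply, eq_comm, Complex.ofReal_eq_zero] at h1
  have := le_max_left (∑ k ∈ Finset.range n, ‖u k x‖ - (G x).re) 0
  linarith

/-- The heart is countable subadditivity with constant one. With T = ∑|u_k| and |h| ≤ T, the pieces
v_k = h|u_k|/T are dominated by u_k, and the remainder h - ∑_{k<n} v_k has modulus at most T - S_n ≤
|G - S_n|, where S_n is the partial sum of the moduli and G its limit in norm. The lattice constant
C multiplies only this remainder and disappears as n → ∞. -/
lemma isLatticeNorm_solidHull : IsLatticeNorm (solidHull X.nrm) where
  eq_zero f hf := (X.nrm_eq_zero f).1 (le_antisymm (hf ▸ self_le_solidHull _ f) zero_le)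
  smul c f := by
    have key : ∀ (c : ℂ) f, solidHull X.nrm (c • f) ≤ ‖c‖ₑ * solidHull X.nrm f := by
      intro c f
      refine iSup₂_le fun g hg => ?_
      by_cases hc : c = 0
      · subst hc
        have : g = 0 := AEEqFun.ext (by
          filter_upwards [hg, AEEqFun.coeFn_zero (μ := μ) (β := ℂ)] with x hx h0
          rw [show (0 : ℂ) • f = 0 from zero_smul ℂ f, h0] at hx
          rw [h0]
          simpa using hx)
        rw [this, X.nrm_zero]
        exact zero_le
      · have : g = c • (c⁻¹ • g) := by rw [smul_smul, mul_inv_cancel₀ hc, one_smul]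
        rw [this, X.nrm_smul]
        gcongr
        refine le_solidHull ?_
        filter_upwards [hg, AEEqFun.coeFn_smul c f, AEEqFun.coeFn_smul c⁻¹ g] with x h1 h2 h3
        rw [h2, Pi.smul_apply, norm_smul] at h1
        rw [h3, Pi.smul_apply, norm_smul, norm_inv, inv_mul_le_iff₀ (norm_pos_iff.2 hc)]
        exact h1
    refine le_antisymm (key c f) ?_
    by_cases hc : c = 0
    · simp [hc]
    · have h1 := key c⁻¹ (c • f)
      rw [smul_smul, inv_mul_cancel₀ hc, one_smul] at h1
      calc ‖c‖ₑ * solidHull X.nrm f ≤ ‖c‖ₑ * (‖c⁻¹‖ₑ * solidHull X.nrm (c • f)) := by gcongr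
        _ = solidHull X.nrm (c • f) := by
          rw [← mul_assoc, ← enorm_mul, mul_inv_cancel₀ hc]; simp
  le_tsum u g hg := by
    by_cases hu : ∑' k, solidHull X.nrm (u k) < ∞
    swap
    · rw [not_lt_top_iff.1 hu]; exact le_top
    refine iSup₂_le fun h hh => ?_
    have ham : ∀ k, Measurable fun x => ((‖u k x‖ : ℝ) : ℂ) := fun k =>
      Complex.measurable_ofReal.comp (u k).measurable.norm
    obtain ⟨G, hG, hGle⟩ := X.exists_tendsto_sum_norm (fun k => coeFn_classOf _ (ham k)) hu
    obtain ⟨C, hC⟩ := X.solid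
    let T : Ω → ℝ := fun x => (∑' k, ‖u k x‖ₑ).toReal
    have hTm : Measurable T := (Measurable.tsum fun k => (u k).measurable.enorm).ennreal_toReal
    have hT : ∀ᵐ x ∂μ, (∀ n, ∑ k ∈ Finset.range n, ‖u k x‖ ≤ T x) ∧ T x ≤ (G x).re ∧
        ‖h x‖ ≤ T x := by
      filter_upwards [hGle, hg, hh] with x h1 h2 h3
      have hs : Summable fun k => ‖u k x‖ :=
        summable_of_sum_range_le (fun _ => norm_nonneg _) h1
      have e1 : ∑' k, ‖u k x‖ₑ = ENNReal.ofReal (∑' k, ‖u k x‖) := by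
        rw [ENNReal.ofReal_tsum_of_nonneg (fun _ => norm_nonneg _) hs]
        simp_rw [ofReal_norm]
      have e : T x = ∑' k, ‖u k x‖ := by
        simp only [T]
        rw [e1, ENNReal.toReal_ofReal (tsum_nonneg fun _ => norm_nonneg _)]
      rw [e]
      refine ⟨fun n => hs.sum_le_tsum _ fun _ _ => norm_nonneg _,
        hs.tsum_le_of_sum_range_le h1, h3.trans ?_⟩
      rw [e1, ← ofReal_norm] at h2
      exact (ENNReal.ofReal_le_ofReal_iff (tsum_nonneg fun _ => norm_nonneg _)).1 h2
    have hvm : ∀ k, Measurable fun x => h x * ((‖u k x‖ / T x : ℝ) : ℂ) := fun k =>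
      h.measurable.mul (Complex.measurable_ofReal.comp ((u k).measurable.norm.div hTm))
    let v : ℕ → Ω →ₘ[μ] ℂ := fun k => classOf μ _ (hvm k)
    have hv : ∀ k, X.nrm (v k) ≤ solidHull X.nrm (u k) := fun k => by
      refine le_solidHull ?_
      filter_upwards [coeFn_classOf _ (hvm k), hT] with x h1 h2
      have hT0 : 0 ≤ T x := (norm_nonneg _).trans h2.2.2
      rw [h1, norm_mul, Complex.norm_real, Real.norm_of_nonneg (by positivity)]
      calc ‖h x‖ * (‖u k x‖ / T x) ≤ T x * (‖u k x‖ / T x) := by gcongr; exact h2.2.2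
        _ = ‖u k x‖ * (T x / T x) := by ring
        _ ≤ ‖u k x‖ * 1 := by gcongr; exact div_self_le_one _
        _ = _ := mul_one _
    have hbound : ∀ n, X.nrm h ≤ C * X.nrm (∑ k ∈ Finset.range n, classOf μ _ (ham k) - G) +
        ∑' k, solidHull X.nrm (u k) := fun n => by
      have hsplit : h = (h - ∑ k ∈ Finset.range n, v k) + ∑ k ∈ Finset.range n, v k := by abel
      conv_lhs => rw [hsplit]
      refine (X.nrm_add_le _ _).trans (add_le_add (hC _ _ ?_) ?_)
      · filter_upwards [AEEqFun.coeFn_sub h (∑ k ∈ Finset.range n, v k),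
          AEEqFun.coeFn_fun_finsetSum (Finset.range n) v,
          ae_all_iff.2 fun k => coeFn_classOf (μ := μ) _ (hvm k),
          AEEqFun.coeFn_sub (∑ k ∈ Finset.range n, classOf μ _ (ham k)) G,
          AEEqFun.coeFn_fun_finsetSum (Finset.range n) (fun k => classOf μ _ (ham k)),
          ae_all_iff.2 fun k => coeFn_classOf (μ := μ) _ (ham k), hT]
          with x h1 h2 h3 h4 h5 h6 h7
        rw [h1, h4, Pi.sub_apply, Pi.sub_apply, h2, h5]
        simp_rw [h6, v, h3]
        obtain ⟨b1, b2, b3⟩ := h7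
        set S : ℝ := ∑ k ∈ Finset.range n, ‖u k x‖ with hS
        have hS0 : 0 ≤ S := Finset.sum_nonneg fun _ _ => norm_nonneg _
        have e1 : ∑ k ∈ Finset.range n, h x * ((‖u k x‖ / T x : ℝ) : ℂ) =
            h x * ((S / T x : ℝ) : ℂ) := by
          rw [← Finset.mul_sum, ← Complex.ofReal_sum, ← Finset.sum_div]
        have e2 : ∑ k ∈ Finset.range n, ((‖u k x‖ : ℝ) : ℂ) = (S : ℂ) := by
          rw [hS, Complex.ofReal_sum]
        rw [e1, e2]
        have hT0 : 0 ≤ T x := (norm_nonneg _).trans b3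
        have e3 : h x - h x * ((S / T x : ℝ) : ℂ) = h x * ((1 - S / T x : ℝ) : ℂ) := by
          push_cast; ring
        have hST : S ≤ T x := b1 n
        have e4 : 0 ≤ 1 - S / T x := sub_nonneg.2 (div_le_one_of_le₀ hST hT0)
        rw [e3, norm_mul, Complex.norm_real, Real.norm_of_nonneg e4, norm_sub_rev]
        calc ‖h x‖ * (1 - S / T x) ≤ T x * (1 - S / T x) := by gcongr
          _ ≤ T x - S := by
            rcases hT0.eq_or_lt with h0 | h0
            · rw [← h0]; simp; linarith
            · rw [mul_sub, mul_div_cancel₀ _ h0.ne', mul_one]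
          _ ≤ (G x - S).re := by rw [Complex.sub_re, Complex.ofReal_re]; linarith
          _ ≤ _ := Complex.re_le_norm _
      · refine (X.nrm_sum_le _ _).trans ?_
        exact (Finset.sum_le_sum fun k _ => hv k).trans (ENNReal.sum_le_tsum _)
    have hlim := (ENNReal.Tendsto.const_mul hG (Or.inr (ENNReal.coe_ne_top (r := C)))).add_const
      (∑' k, solidHull X.nrm (u k))
    rw [mul_zero, zero_add] at hlim
    exact ge_of_tendsto' hlim hbound

end BanachFunctionLattice

end

/-! ### The Poisson formula for the strip -/

namespace ComplexInterp

/-- Half the denominator of the Poisson kernels of the strip: its zeros there are `z = θ`. -/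
def stripDenom (θ : ℝ) (z : ℂ) : ℂ := Complex.cos (Real.pi * θ) - Complex.cos (Real.pi * z)

/-- A multiple of the Poisson kernel of the strip at `θ`, on the line `Re z = 0`. -/
def kernelZero (θ t : ℝ) : ℝ := (Real.cosh (Real.pi * t) - Real.cos (Real.pi * θ))⁻¹

/-- A multiple of the Poisson kernel of the strip at `θ`, on the line `Re z = 1`. -/
def kernelOne (θ t : ℝ) : ℝ := (Real.cosh (Real.pi * t) + Real.cos (Real.pi * θ))⁻¹

lemma interior_strip : interior strip = {z : ℂ | 0 < z.re ∧ z.re < 1} := by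
  have : strip = Complex.re ⁻¹' Icc 0 1 := rfl
  rw [this, ← Complex.isOpenMap_re.preimage_interior_eq_interior_preimage Complex.continuous_re,
    interior_Icc]
  rfl

lemma stripDenom_zero_add (θ t : ℝ) : stripDenom θ (t * Complex.I) = -((kernelZero θ t)⁻¹ : ℝ) := by
  have : (Real.pi * (t * Complex.I) : ℂ) = ((Real.pi * t : ℝ) : ℂ) * Complex.I := by
    push_cast; ring
  rw [stripDenom, kernelZero, inv_inv, this, Complex.cos_mul_I]
  push_cast; ring

lemma stripDenom_one_add (θ t : ℝ) :
    stripDenom θ (1 + t * Complex.I) = ((kernelOne θ t)⁻¹ : ℝ) := by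
  have : (Real.pi * (1 + t * Complex.I) : ℂ) = ((Real.pi * t : ℝ) : ℂ) * Complex.I + Real.pi := by
    push_cast; ring
  rw [stripDenom, kernelOne, inv_inv, this, Complex.cos_add_pi, Complex.cos_mul_I]
  push_cast; ring

section kernels

variable {θ : ℝ} (hθ₀ : 0 < θ) (hθ₁ : θ < 1)
include hθ₀ hθ₁

lemma abs_cos_pi_mul_lt_one : |Real.cos (Real.pi * θ)| < 1 := by
  have hs : 0 < Real.sin (Real.pi * θ) :=
    Real.sin_pos_of_pos_of_lt_pi (by positivity) (by nlinarith [Real.pi_pos])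
  have := Real.sin_sq_add_cos_sq (Real.pi * θ)
  exact (sq_lt_one_iff_abs_lt_one _).1 (by nlinarith)

lemma kernelZero_pos (t : ℝ) : 0 < kernelZero θ t := by
  have := (abs_lt.1 (abs_cos_pi_mul_lt_one hθ₀ hθ₁)).2
  exact inv_pos.2 (by linarith [Real.one_le_cosh (Real.pi * t)])

lemma kernelOne_pos (t : ℝ) : 0 < kernelOne θ t := by
  have := (abs_lt.1 (abs_cos_pi_mul_lt_one hθ₀ hθ₁)).1
  exact inv_pos.2 (by linarith [Real.one_le_cosh (Real.pi * t)])

lemma continuous_kernelZero : Continuous (kernelZero θ) :=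
  (by fun_prop : Continuous fun t => Real.cosh (Real.pi * t) - Real.cos (Real.pi * θ)).inv₀
    fun t => (inv_pos.1 (kernelZero_pos hθ₀ hθ₁ t)).ne'

lemma continuous_kernelOne : Continuous (kernelOne θ) :=
  (by fun_prop : Continuous fun t => Real.cosh (Real.pi * t) + Real.cos (Real.pi * θ)).inv₀
    fun t => (inv_pos.1 (kernelOne_pos hθ₀ hθ₁ t)).ne'

/-- Since 3 < π, e^{|t|}(1+t²) ≤ e^{3|t|} ≤ e^{π|t|} ≤ 2 cosh πt. The factor e^{|t|} leaves room for
unbounded functions in the Poisson formula, in particular f(z) = z, which determines the masses of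
the kernels. -/
lemma integrable_inv_cosh_add_mul_exp {c : ℝ} (hc : |c| < 1) :
    Integrable fun t => (Real.cosh (Real.pi * t) + c)⁻¹ * Real.exp |t| := by
  have hpos : ∀ t, 0 < Real.cosh (Real.pi * t) + c := fun t => by
    linarith [Real.one_le_cosh (Real.pi * t), (abs_lt.1 hc).1]
  have hi : Integrable fun t : ℝ => (2 * (1 - |c|)⁻¹) * (1 + t ^ 2)⁻¹ :=
    integrable_inv_one_add_sq.const_mul _
  refine hi.mono' (Continuous.aestronglyMeasurable ?_) (ae_of_all _ fun t => ?_)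
  · exact ((by fun_prop : Continuous fun t => Real.cosh (Real.pi * t) + c).inv₀
      fun t => (hpos t).ne').mul (by fun_prop)
  rw [Real.norm_of_nonneg (by have := hpos t; positivity)]
  have h1 : (1 - |c|) * Real.cosh (Real.pi * t) ≤ Real.cosh (Real.pi * t) + c := by
    nlinarith [Real.one_le_cosh (Real.pi * t), neg_abs_le c, abs_nonneg c]
  have h2 : Real.exp |t| * (1 + t ^ 2) ≤ 2 * Real.cosh (Real.pi * t) := by
    have h3 : Real.exp (Real.pi * |t|) ≤ 2 * Real.cosh (Real.pi * t) := by
      rw [← Real.cosh_abs, abs_mul, abs_of_pos Real.pi_pos, Real.cosh_eq]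
      linarith [Real.exp_pos (-(Real.pi * |t|))]
    refine le_trans ?_ h3
    have h4 : 1 + t ^ 2 ≤ Real.exp (2 * |t|) := by
      have := Real.quadratic_le_exp_of_nonneg (x := 2 * |t|) (by positivity)
      nlinarith [abs_nonneg t, sq_abs t]
    calc Real.exp |t| * (1 + t ^ 2) ≤ Real.exp |t| * Real.exp (2 * |t|) := by gcongr
      _ = Real.exp (3 * |t|) := by rw [← Real.exp_add]; ring_nf
      _ ≤ _ := Real.exp_le_exp.2 (by gcongr; exact Real.pi_gt_three.le)
  have hc' : 0 < 1 - |c| := by linarith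
  rw [inv_mul_le_iff₀ (hpos t), ← mul_assoc, ← div_eq_mul_inv _ (1 + t ^ 2),
    le_div_iff₀ (by positivity)]
  calc _ ≤ 2 * Real.cosh (Real.pi * t) := h2
    _ = (2 * (1 - |c|)⁻¹) * ((1 - |c|) * Real.cosh (Real.pi * t)) := by field_simp
    _ ≤ (2 * (1 - |c|)⁻¹) * (Real.cosh (Real.pi * t) + c) := by gcongr
    _ = _ := mul_comm _ _

lemma integrable_kernelZero_mul_exp : Integrable fun t => kernelZero θ t * Real.exp |t| := by
  have := integrable_inv_cosh_add_mul_exp hθ₀ hθ₁ (c := -Real.cos (Real.pi * θ))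
    (by rw [abs_neg]; exact abs_cos_pi_mul_lt_one hθ₀ hθ₁)
  simpa [kernelZero, sub_eq_add_neg] using this

lemma integrable_kernelOne_mul_exp : Integrable fun t => kernelOne θ t * Real.exp |t| :=
  integrable_inv_cosh_add_mul_exp hθ₀ hθ₁ (abs_cos_pi_mul_lt_one hθ₀ hθ₁)

/-- The zeros of the denominator are the points 2k ± θ with k an integer, and θ is the only one of
them in the closed strip. -/
lemma stripDenom_ne_zero {z : ℂ} (hz : z ∈ strip) (hne : z ≠ θ) : stripDenom θ z ≠ 0 := by
  intro h
  rw [stripDenom, sub_eq_zero, Complex.cos_eq_cos_iff] at h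
  obtain ⟨k, hk⟩ := h
  have hpi : (Real.pi : ℂ) ≠ 0 := by exact_mod_cast Real.pi_ne_zero
  have hk' : z = 2 * k + θ ∨ z = 2 * k - θ := by
    rcases hk with hk | hk
    · left; apply mul_left_cancel₀ hpi; rw [hk]; ring
    · right; apply mul_left_cancel₀ hpi; rw [hk]; ring
  obtain ⟨h0, h1⟩ := hz
  rcases hk' with rfl | rfl
  · have e : (2 * (k : ℂ) + θ).re = 2 * (k : ℝ) + θ := by simp
    rw [e] at h0 h1
    have a1 : -1 < k := by
      by_contra hh
      have : (k : ℝ) ≤ -1 := by exact_mod_cast not_lt.1 hh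
      linarith
    have a2 : k < 1 := by
      by_contra hh
      have : (1 : ℝ) ≤ k := by exact_mod_cast not_lt.1 hh
      linarith
    obtain rfl : k = 0 := by omega
    simp at hne
  · have e : (2 * (k : ℂ) - θ).re = 2 * (k : ℝ) - θ := by simp
    rw [e] at h0 h1
    have a1 : 0 < k := by
      by_contra hh
      have : (k : ℝ) ≤ 0 := by exact_mod_cast not_lt.1 hh
      linarith
    have a2 : k < 1 := by
      by_contra hh
      have : (1 : ℝ) ≤ k := by exact_mod_cast not_lt.1 hh
      linarith
    omega

end kernels

/-- The two exponentials in cos w have moduli e^{Im w} and e^{-Im w}, so |cos w| ≥ sinh |Im w|; the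
constant term of the denominator costs at most 1. -/
lemma sinh_sub_one_le_norm_stripDenom (θ : ℝ) (z : ℂ) :
    Real.sinh (Real.pi * |z.im|) - 1 ≤ ‖stripDenom θ z‖ := by
  have h1 : Real.sinh (Real.pi * |z.im|) ≤ ‖Complex.cos (Real.pi * z)‖ := by
    have hE : ∀ y : ℝ, 0 ≤ y → ∀ w : ℂ, |w.im| = y → Real.sinh y ≤ ‖Complex.cos w‖ := by
      intro y hy w hw
      have n1 : ‖Complex.exp (w * Complex.I)‖ = Real.exp (-w.im) := by
        rw [Complex.norm_exp]; simp
      have n2 : ‖Complex.exp (-w * Complex.I)‖ = Real.exp w.im := by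
        rw [Complex.norm_exp]; simp
      rw [Complex.cos, norm_div, Complex.norm_two, Real.sinh_eq]
      gcongr
      rcases abs_choice w.im with h | h <;> rw [h] at hw
      · have := norm_sub_norm_le (Complex.exp (-w * Complex.I)) (-Complex.exp (w * Complex.I))
        rw [norm_neg, n1, n2, sub_neg_eq_add, add_comm (Complex.exp _), hw] at this
        exact this
      · have := norm_sub_norm_le (Complex.exp (w * Complex.I)) (-Complex.exp (-w * Complex.I))
        rw [norm_neg, n1, n2, sub_neg_eq_add, hw] at this
        rwa [show w.im = -y by linarith] at this
    refine hE _ (by positivity) _ ?_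
    rw [Complex.im_ofReal_mul, abs_mul, abs_of_pos Real.pi_pos]
  have h2 : ‖Complex.cos (Real.pi * θ)‖ ≤ 1 := by
    rw [← Complex.ofReal_mul, ← Complex.ofReal_cos, Complex.norm_real]
    exact Real.abs_cos_le_one _
  have := norm_sub_norm_le (Complex.cos (Real.pi * z)) (Complex.cos (Real.pi * θ))
  rw [stripDenom, norm_sub_rev]
  linarith

lemma zero_add_mul_I_mem_strip (t : ℝ) : ((0 : ℝ) + t * Complex.I : ℂ) ∈ strip := by
  simp [strip]

lemma one_add_mul_I_mem_strip (t : ℝ) : ((1 : ℝ) + t * Complex.I : ℂ) ∈ strip := by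
  simp [strip]

lemma ofReal_mem_interior_strip {θ : ℝ} (hθ₀ : 0 < θ) (hθ₁ : θ < 1) :
    (θ : ℂ) ∈ interior strip := by
  rw [interior_strip]; exact ⟨by simpa, by simpa⟩

variable {E : Type*} [NormedAddCommGroup E] [NormedSpace ℂ E]

/-- The Cauchy kernel of the strip with pole at `θ`, applied to `f - f θ`. -/
def stripQuotient (θ : ℝ) (f : ℂ → E) (z : ℂ) : E :=
  (dslope (stripDenom θ) θ z)⁻¹ • dslope f θ z

lemma stripQuotient_of_ne {θ : ℝ} {f : ℂ → E} {z : ℂ} (hne : z ≠ θ) :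
    stripQuotient θ f z = (stripDenom θ z)⁻¹ • (f z - f θ) := by
  have h0 : stripDenom θ θ = 0 := by simp [stripDenom]
  have h1 : z - θ ≠ 0 := sub_ne_zero.2 hne
  rw [stripQuotient, dslope_of_ne _ hne, dslope_of_ne _ hne, slope_def_module, slope_def_module,
    h0, sub_zero, smul_smul, smul_eq_mul, mul_inv, inv_inv, mul_right_comm, mul_inv_cancel₀ h1,
    one_mul]

lemma differentiable_stripDenom (θ : ℝ) : Differentiable ℂ (stripDenom θ) := by
  unfold stripDenom; fun_prop

section

variable {θ : ℝ} (hθ₀ : 0 < θ) (hθ₁ : θ < 1) {f : ℂ → E}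
include hθ₀ hθ₁

/-- The derivative of the denominator at θ is π sin πθ > 0, so the zero is simple and the
singularity of the Cauchy quotient at θ is removable. -/
lemma dslope_stripDenom_ne_zero {z : ℂ} (hz : z ∈ strip) : dslope (stripDenom θ) θ z ≠ 0 := by
  by_cases hne : z = θ
  · subst hne
    have hd : HasDerivAt (stripDenom θ) (Complex.sin (Real.pi * θ) * Real.pi) θ := by
      have h1 : HasDerivAt (fun z : ℂ => (Real.pi : ℂ) * z) Real.pi θ := by
        simpa using (hasDerivAt_id (θ : ℂ)).const_mul (Real.pi : ℂ)
      have := (h1.ccos).const_sub (Complex.cos (Real.pi * θ))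
      rw [neg_mul, neg_neg] at this
      exact this
    rw [dslope_same, hd.deriv]
    have hs : 0 < Real.sin (Real.pi * θ) :=
      Real.sin_pos_of_pos_of_lt_pi (by positivity) (by nlinarith [Real.pi_pos])
    rw [← Complex.ofReal_mul, ← Complex.ofReal_sin, ← Complex.ofReal_mul]
    exact_mod_cast (by positivity : Real.sin (Real.pi * θ) * Real.pi ≠ 0)
  · have h0 : stripDenom θ θ = 0 := by simp [stripDenom]
    rw [dslope_of_ne _ hne, slope_def_module, h0, sub_zero]
    exact smul_ne_zero (inv_ne_zero (sub_ne_zero.2 hne)) (stripDenom_ne_zero hθ₀ hθ₁ hz hne)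

lemma continuousOn_stripQuotient (hc : ContinuousOn f strip)
    (hd : DifferentiableOn ℂ f (interior strip)) : ContinuousOn (stripQuotient θ f) strip := by
  have hθ := ofReal_mem_interior_strip hθ₀ hθ₁
  have hs : strip ∈ 𝓝 (θ : ℂ) := mem_interior_iff_mem_nhds.1 hθ
  refine ContinuousOn.smul (ContinuousOn.inv₀ ?_ fun z hz =>
    dslope_stripDenom_ne_zero hθ₀ hθ₁ hz) ?_
  · exact (continuousOn_dslope hs).2 ⟨(differentiable_stripDenom θ).continuous.continuousOn,
      differentiable_stripDenom θ _⟩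
  · exact (continuousOn_dslope hs).2 ⟨hc, hd.differentiableAt (isOpen_interior.mem_nhds hθ)⟩

lemma differentiableOn_stripQuotient [CompleteSpace E] (hd : DifferentiableOn ℂ f (interior strip)) :
    DifferentiableOn ℂ (stripQuotient θ f) (interior strip) := by
  have hθ := isOpen_interior.mem_nhds (ofReal_mem_interior_strip hθ₀ hθ₁)
  refine DifferentiableOn.smul (DifferentiableOn.inv ?_ fun z hz =>
    dslope_stripDenom_ne_zero hθ₀ hθ₁ (interior_subset hz)) ?_
  · exact (Complex.differentiableOn_dslope hθ).2
      (differentiable_stripDenom θ).differentiableOn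
  · exact (Complex.differentiableOn_dslope hθ).2 hd

lemma integrable_kernelZero_smul (hc : ContinuousOn f strip) {M : ℝ}
    (hM : ∀ z ∈ strip, ‖f z‖ ≤ M * Real.exp |z.im|) :
    Integrable fun t : ℝ => kernelZero θ t • f ((0 : ℝ) + t * Complex.I) := by
  refine ((integrable_kernelZero_mul_exp hθ₀ hθ₁).const_mul M).mono'
    (Continuous.aestronglyMeasurable ?_) (ae_of_all _ fun t => ?_)
  · exact (continuous_kernelZero hθ₀ hθ₁).smul
      (hc.comp_continuous (by fun_prop) zero_add_mul_I_mem_strip)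
  · rw [norm_smul, Real.norm_of_nonneg (kernelZero_pos hθ₀ hθ₁ t).le, mul_left_comm]
    have := hM _ (zero_add_mul_I_mem_strip t)
    have e : ((0 : ℝ) + t * Complex.I : ℂ).im = t := by simp
    rw [e] at this
    exact mul_le_mul_of_nonneg_left this (kernelZero_pos hθ₀ hθ₁ t).le

lemma integrable_kernelOne_smul (hc : ContinuousOn f strip) {M : ℝ}
    (hM : ∀ z ∈ strip, ‖f z‖ ≤ M * Real.exp |z.im|) :
    Integrable fun t : ℝ => kernelOne θ t • f ((1 : ℝ) + t * Complex.I) := by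
  refine ((integrable_kernelOne_mul_exp hθ₀ hθ₁).const_mul M).mono'
    (Continuous.aestronglyMeasurable ?_) (ae_of_all _ fun t => ?_)
  · exact (continuous_kernelOne hθ₀ hθ₁).smul
      (hc.comp_continuous (by fun_prop) one_add_mul_I_mem_strip)
  · rw [norm_smul, Real.norm_of_nonneg (kernelOne_pos hθ₀ hθ₁ t).le, mul_left_comm]
    have := hM _ (one_add_mul_I_mem_strip t)
    have e : ((1 : ℝ) + t * Complex.I : ℂ).im = t := by simp
    rw [e] at this
    exact mul_le_mul_of_nonneg_left this (kernelOne_pos hθ₀ hθ₁ t).le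

/-- At height R the numerator is O(e^R) while the denominator is at least sinh πR - 1, of order at
least e^{2R}. The function `φ` lets one statement serve for the upper and the lower side. -/
lemma tendsto_integral_horizontal {F : ℂ → E} {M : ℝ} {φ : ℝ → ℝ}
    (hφ : ∀ R, |φ R| = |R|)
    (hF : ∀ z ∈ strip, z ≠ θ → F z = (stripDenom θ z)⁻¹ • (f z - f θ))
    (hM : ∀ z ∈ strip, ‖f z - f θ‖ ≤ M * Real.exp |z.im|) :
    Tendsto (fun R : ℝ => ∫ x : ℝ in (0 : ℝ)..1, F (x + φ R * Complex.I)) atTop (𝓝 0) := by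
  have hlim : Tendsto (fun R : ℝ => M * (Real.exp R / (Real.sinh (Real.pi * R) - 1))) atTop
      (𝓝 0) := by
    have key : Tendsto (fun R : ℝ => Real.exp R / (Real.sinh (Real.pi * R) - 1)) atTop (𝓝 0) := by
      have h2 : Tendsto (fun R : ℝ => 4 * (Real.exp R)⁻¹) atTop (𝓝 0) := by
        simpa using (tendsto_inv_atTop_zero.comp Real.tendsto_exp_atTop).const_mul 4
      refine tendsto_of_tendsto_of_tendsto_of_le_of_le' tendsto_const_nhds h2 ?_ ?_ <;>
        filter_upwards [eventually_ge_atTop 3] with R hR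
      all_goals
        have a0 := Real.add_one_le_exp R
        have a1 : Real.exp R ^ 3 ≤ Real.exp (Real.pi * R) := by
          rw [← Real.exp_nat_mul]
          exact Real.exp_le_exp.2 (by gcongr; exact_mod_cast Real.pi_gt_three.le)
        have a2 : Real.exp (-(Real.pi * R)) ≤ 1 := Real.exp_le_one_iff.2 (by
          have := Real.pi_pos; nlinarith)
        have a3 : Real.exp R ^ 2 / 4 ≤ Real.sinh (Real.pi * R) - 1 := by
          rw [Real.sinh_eq]; nlinarith [sq_nonneg (Real.exp R)]
        have a4 : 0 < Real.exp R ^ 2 / 4 := by positivity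
      · exact div_nonneg (Real.exp_pos _).le (a4.le.trans a3)
      · rw [div_le_iff₀ (a4.trans_le a3)]
        calc Real.exp R = 4 * (Real.exp R)⁻¹ * (Real.exp R ^ 2 / 4) := by field_simp
          _ ≤ _ := by gcongr
    simpa using key.const_mul M
  refine squeeze_zero_norm' ?_ hlim
  filter_upwards [eventually_ge_atTop 3] with R hR
  have hs : 1 < Real.sinh (Real.pi * R) := by
    have : Real.pi * R ≤ Real.sinh (Real.pi * R) :=
      Real.self_le_sinh_iff.2 (by have := Real.pi_pos; nlinarith)
    nlinarith [Real.pi_gt_three]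
  have := intervalIntegral.norm_integral_le_of_norm_le_const (a := (0 : ℝ)) (b := 1)
    (f := fun x : ℝ => F (x + φ R * Complex.I))
    (C := M * (Real.exp R / (Real.sinh (Real.pi * R) - 1))) ?_
  · simpa using this
  intro x hx
  rw [uIoc_of_le zero_le_one] at hx
  set z : ℂ := x + φ R * Complex.I with hz
  have hre : z.re = x := by simp [hz]
  have him : |z.im| = R := by
    have : z.im = φ R := by simp [hz]
    rw [this, hφ, abs_of_nonneg (by linarith)]
  have hzs : z ∈ strip := by constructor <;> rw [hre] <;> [exact hx.1.le; exact hx.2]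
  have hzθ : z ≠ θ := by
    intro h
    rw [h, Complex.ofReal_im, abs_zero] at him
    linarith
  have h1 := sinh_sub_one_le_norm_stripDenom θ z
  have h2 := hM z hzs
  rw [him] at h1 h2
  rw [hF z hzs hzθ, norm_smul, norm_inv, inv_mul_eq_div, ← mul_div_assoc]
  gcongr
  exact (norm_nonneg _).trans h2

/-- The Poisson formula for the strip, at a real point, up to normalization. -/
theorem integral_kernel_smul_add [CompleteSpace E] (hc : ContinuousOn f strip)
    (hd : DifferentiableOn ℂ f (interior strip)) {M : ℝ}
    (hM : ∀ z ∈ strip, ‖f z‖ ≤ M * Real.exp |z.im|) :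
    (∫ t : ℝ, kernelZero θ t • f ((0 : ℝ) + t * Complex.I)) +
      (∫ t : ℝ, kernelOne θ t • f ((1 : ℝ) + t * Complex.I)) =
    ((∫ t, kernelZero θ t) + ∫ t, kernelOne θ t) • f θ := by
  have hθs : (θ : ℂ) ∈ strip := interior_subset (ofReal_mem_interior_strip hθ₀ hθ₁)
  have hfθ : ‖f θ‖ ≤ M := by simpa using hM _ hθs
  have hM0 : 0 ≤ M := (norm_nonneg _).trans hfθ
  have hMc : ∀ z ∈ strip, ‖(fun _ : ℂ => f θ) z‖ ≤ M * Real.exp |z.im| := fun z _ =>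
    hfθ.trans (le_mul_of_one_le_right hM0 (Real.one_le_exp (abs_nonneg _)))
  have hMs : ∀ z ∈ strip, ‖f z - f θ‖ ≤ (2 * M) * Real.exp |z.im| := fun z hz => by
    have := hMc z hz
    calc _ ≤ ‖f z‖ + ‖f θ‖ := norm_sub_le _ _
      _ ≤ M * Real.exp |z.im| + M * Real.exp |z.im| := add_le_add (hM z hz) this
      _ = _ := by ring
  have hI0 := integrable_kernelZero_smul hθ₀ hθ₁ hc hM
  have hI1 := integrable_kernelOne_smul hθ₀ hθ₁ hc hM
  have hJ0 := integrable_kernelZero_smul hθ₀ hθ₁ (f := fun _ => f θ) continuousOn_const hMc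
  have hJ1 := integrable_kernelOne_smul hθ₀ hθ₁ (f := fun _ => f θ) continuousOn_const hMc
  have hS0 : ∀ t : ℝ, stripQuotient θ f ((0 : ℝ) + t * Complex.I) =
      -(kernelZero θ t • (f ((0 : ℝ) + t * Complex.I) - f θ)) := fun t => by
    rw [stripQuotient_of_ne, Complex.ofReal_zero, zero_add, stripDenom_zero_add]
    · rw [inv_neg, neg_smul, ← Complex.ofReal_inv, inv_inv, Complex.coe_smul]
    · intro h
      have := congrArg Complex.re h
      simp at this; linarith
  have hS1 : ∀ t : ℝ, stripQuotient θ f ((1 : ℝ) + t * Complex.I) =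
      kernelOne θ t • (f ((1 : ℝ) + t * Complex.I) - f θ) := fun t => by
    rw [stripQuotient_of_ne, Complex.ofReal_one, stripDenom_one_add]
    · rw [← Complex.ofReal_inv, inv_inv, Complex.coe_smul]
    · intro h
      have := congrArg Complex.re h
      simp at this; linarith
  -- Cauchy's theorem on the rectangle [0,1] × [-R,R]: after subtraction of f(θ) the quotient has no
  -- pole, so no residue appears.
  have hrect : ∀ R : ℝ, 0 < R →
      (∫ x : ℝ in (0 : ℝ)..1, stripQuotient θ f (x + (-R : ℝ) * Complex.I)) -
      (∫ x : ℝ in (0 : ℝ)..1, stripQuotient θ f (x + (R : ℝ) * Complex.I)) +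
      Complex.I • (∫ y : ℝ in (-R)..R, stripQuotient θ f ((1 : ℝ) + y * Complex.I)) -
      Complex.I • (∫ y : ℝ in (-R)..R, stripQuotient θ f ((0 : ℝ) + y * Complex.I)) = 0 := by
    intro R hR
    refine Complex.integral_boundary_rect_eq_zero_of_continuousOn_of_differentiableOn
      (stripQuotient θ f) ⟨0, -R⟩ ⟨1, R⟩ ?_ ?_
    · refine (continuousOn_stripQuotient hθ₀ hθ₁ hc hd).mono fun z hz => ?_
      have := hz.1
      simpa [uIcc_of_le, strip] using this
    · refine (differentiableOn_stripQuotient hθ₀ hθ₁ hd).mono fun z hz => ?_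
      have := hz.1
      rw [interior_strip]
      simpa using this
  have hne : ∀ z ∈ strip, z ≠ θ → stripQuotient θ f z = (stripDenom θ z)⁻¹ • (f z - f θ) :=
    fun z _ h => stripQuotient_of_ne h
  have t1 := tendsto_integral_horizontal hθ₀ hθ₁ (φ := fun R => -R) (fun R => abs_neg R) hne hMs
  have t2 := tendsto_integral_horizontal hθ₀ hθ₁ (φ := fun R => R) (fun R => rfl) hne hMs
  have hK0 : Integrable fun t : ℝ => stripQuotient θ f ((0 : ℝ) + t * Complex.I) := by
    simp_rw [hS0, smul_sub]
    exact (hI0.sub hJ0).neg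
  have hK1 : Integrable fun t : ℝ => stripQuotient θ f ((1 : ℝ) + t * Complex.I) := by
    simp_rw [hS1, smul_sub]
    exact hI1.sub hJ1
  have t3 := intervalIntegral_tendsto_integral hK1 tendsto_neg_atTop_atBot tendsto_id
  have t4 := intervalIntegral_tendsto_integral hK0 tendsto_neg_atTop_atBot tendsto_id
  have tt := ((t1.sub t2).add (t3.const_smul Complex.I)).sub (t4.const_smul Complex.I)
  have h0 := tendsto_nhds_unique (tt.congr' (by
    filter_upwards [eventually_gt_atTop 0] with R hR using hrect R hR)) tendsto_const_nhds
  rw [sub_zero, zero_add, ← smul_sub] at h0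
  have h1 := (smul_eq_zero.1 h0).resolve_left Complex.I_ne_zero
  -- On the vertical lines the denominator is real, equal to minus the reciprocal of one kernel and
  -- to the reciprocal of the other; what is left is that the two kernel integrals of f - f(θ) add
  -- up to zero.
  simp_rw [hS0, hS1, smul_sub] at h1
  rw [integral_neg, sub_neg_eq_add, integral_sub hI1 hJ1, integral_sub hI0 hJ0,
    integral_smul_const, integral_smul_const] at h1
  rw [add_smul]
  rw [← sub_eq_zero, ← h1]
  abel

/-- The total mass of the kernel on the line `Re z = 1`. -/
theorem integral_kernelOne :
    ∫ t, kernelOne θ t = θ * ((∫ t, kernelZero θ t) + ∫ t, kernelOne θ t) := by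
  have hb : ∀ z ∈ strip, ‖z‖ ≤ 1 * Real.exp |z.im| := fun z hz => by
    rw [one_mul]
    refine (Complex.norm_le_abs_re_add_abs_im z).trans ?_
    rw [abs_of_nonneg hz.1]
    linarith [hz.2, Real.add_one_le_exp |z.im|]
  -- For f(z) = z the real part is 0 on the left line, 1 on the right line and θ at the point θ, so
  -- the real part of the formula is the claim.
  have h := integral_kernel_smul_add hθ₀ hθ₁ (f := fun z : ℂ => z) continuousOn_id
    differentiableOn_id hb
  have i0 := integrable_kernelZero_smul hθ₀ hθ₁ (f := fun z : ℂ => z) continuousOn_id hb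
  have i1 := integrable_kernelOne_smul hθ₀ hθ₁ (f := fun z : ℂ => z) continuousOn_id hb
  have h' := congrArg Complex.re h
  have e0 : Complex.re (∫ t : ℝ, kernelZero θ t • ((0 : ℝ) + t * Complex.I : ℂ)) = 0 := by
    have := integral_re i0
    simp only [RCLike.re_eq_complex_re] at this
    rw [← this]
    simp
  have e1 : Complex.re (∫ t : ℝ, kernelOne θ t • ((1 : ℝ) + t * Complex.I : ℂ)) =
      ∫ t, kernelOne θ t := by
    have := integral_re i1
    simp only [RCLike.re_eq_complex_re] at this
    rw [← this]
    simp
  rw [Complex.add_re, e0, e1, zero_add] at h'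
  refine h'.trans ?_
  rw [Complex.real_smul, Complex.re_ofReal_mul, Complex.ofReal_re, mul_comm]

lemma integrable_kernelZero : Integrable (kernelZero θ) := by
  refine (integrable_kernelZero_mul_exp hθ₀ hθ₁).mono'
    (continuous_kernelZero hθ₀ hθ₁).aestronglyMeasurable (ae_of_all _ fun t => ?_)
  rw [Real.norm_of_nonneg (kernelZero_pos hθ₀ hθ₁ t).le]
  exact le_mul_of_one_le_right (kernelZero_pos hθ₀ hθ₁ t).le (Real.one_le_exp (abs_nonneg _))

lemma integrable_kernelOne : Integrable (kernelOne θ) := by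
  refine (integrable_kernelOne_mul_exp hθ₀ hθ₁).mono'
    (continuous_kernelOne hθ₀ hθ₁).aestronglyMeasurable (ae_of_all _ fun t => ?_)
  rw [Real.norm_of_nonneg (kernelOne_pos hθ₀ hθ₁ t).le]
  exact le_mul_of_one_le_right (kernelOne_pos hθ₀ hθ₁ t).le (Real.one_le_exp (abs_nonneg _))

lemma integral_kernel_pos : 0 < (∫ t, kernelZero θ t) + ∫ t, kernelOne θ t := by
  have h1 : 0 < ∫ t, kernelOne θ t :=
    integral_pos_of_integrable_nonneg_nonzero (x := 0) (continuous_kernelOne hθ₀ hθ₁)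
      (integrable_kernelOne hθ₀ hθ₁) (fun t => (kernelOne_pos hθ₀ hθ₁ t).le)
      (kernelOne_pos hθ₀ hθ₁ 0).ne'
  have h0 : 0 ≤ ∫ t, kernelZero θ t := integral_nonneg fun t => (kernelZero_pos hθ₀ hθ₁ t).le
  linarith

end

end ComplexInterp

/-! ### The spaces X(ℓ^∞) -/

section

variable {Ω : Type*} [MeasurableSpace Ω] {μ : Measure Ω}

lemma ae_prod_count_iff [SFinite μ] {p : Ω × ℤ → Prop} :
    (∀ᵐ z ∂(μ.prod Measure.count), p z) ↔ ∀ᵐ x ∂μ, ∀ j : ℤ, p (x, j) := by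
  refine ⟨fun h => ?_, fun h => ?_⟩
  · filter_upwards [Measure.ae_ae_of_ae_prod h] with x hx
    exact Measure.ae_count_iff.1 hx
  · filter_upwards [Measure.quasiMeasurePreserving_fst.ae h] with z hz using hz z.2

variable {f : (Ω × ℤ) →ₘ[μ.prod Measure.count] ℂ}

/-- The supremum is formed in [0,∞], where it is measurable, and then made real. The bound `G` only
ensures finiteness and need not be measurable. -/
lemma exists_isSupAbs {G : Ω → ℝ} (h : ∀ᵐ x ∂μ, ∀ j : ℤ, ‖f (x, j)‖ ≤ G x) :
    ∃ F : Ω →ₘ[μ] ℂ, IsSupAbs f F ∧ ∀ᵐ x ∂μ, ‖F x‖ ≤ G x := by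
  have hm : Measurable fun x => (((⨆ j : ℤ, ‖f (x, j)‖ₑ).toReal : ℝ) : ℂ) :=
    Complex.measurable_ofReal.comp (Measurable.iSup fun j =>
      (f.measurable.comp measurable_prodMk_right).enorm).ennreal_toReal
  have key : ∀ᵐ x ∂μ, IsLUB (range fun j : ℤ => ‖f (x, j)‖) (⨆ j : ℤ, ‖f (x, j)‖ₑ).toReal ∧
      (⨆ j : ℤ, ‖f (x, j)‖ₑ).toReal ≤ G x := by
    filter_upwards [h] with x hx
    have hle : ∀ b : ℝ, (∀ j : ℤ, ‖f (x, j)‖ ≤ b) → ⨆ j : ℤ, ‖f (x, j)‖ₑ ≤ ENNReal.ofReal b :=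
      fun b hb => iSup_le fun j => by
        rw [← ofReal_norm]; exact ENNReal.ofReal_le_ofReal (hb j)
    have hle' : ∀ b : ℝ, (∀ j : ℤ, ‖f (x, j)‖ ≤ b) → (⨆ j : ℤ, ‖f (x, j)‖ₑ).toReal ≤ b :=
      fun b hb => ENNReal.toReal_le_of_le_ofReal ((norm_nonneg _).trans (hb 0)) (hle b hb)
    refine ⟨⟨?_, fun b hb => hle' b fun j => hb ⟨j, rfl⟩⟩, hle' _ hx⟩
    rintro _ ⟨j, rfl⟩
    have h1 := ENNReal.toReal_mono ((hle _ hx).trans_lt ENNReal.ofReal_lt_top).ne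
      (le_iSup (fun j : ℤ => ‖f (x, j)‖ₑ) j)
    rwa [toReal_enorm] at h1
  refine ⟨classOf μ _ hm, ?_, ?_⟩
  · filter_upwards [key, coeFn_classOf _ hm] with x h1 h2
    exact ⟨_, h1.1, h2⟩
  · filter_upwards [key, coeFn_classOf _ hm] with x h1 h2
    rw [h2, Complex.norm_real, Real.norm_of_nonneg ENNReal.toReal_nonneg]
    exact h1.2

lemma IsSupAbs.unique {F F' : Ω →ₘ[μ] ℂ} (h : IsSupAbs f F) (h' : IsSupAbs f F') : F = F' := by
  refine AEEqFun.ext ?_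
  filter_upwards [h, h'] with x ⟨r, hr, e⟩ ⟨r', hr', e'⟩
  rw [e, e', hr.unique hr']

lemma IsSupAbs.norm_le {F : Ω →ₘ[μ] ℂ} (h : IsSupAbs f F) :
    ∀ᵐ x ∂μ, ∀ j : ℤ, ‖f (x, j)‖ ≤ ‖F x‖ := by
  filter_upwards [h] with x ⟨r, hr, e⟩ j
  have := hr.1 ⟨j, rfl⟩
  rw [e, Complex.norm_real]
  exact this.trans (Real.le_norm_self r)

lemma IsSupAbs.linftyNorm_eq {F : Ω →ₘ[μ] ℂ} (h : IsSupAbs f F) (N : (Ω →ₘ[μ] ℂ) → ℝ≥0∞) :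
    linftyNorm N f = N F :=
  le_antisymm (iInf₂_le F h) (le_iInf₂ fun F' h' => by rw [h.unique h'])

lemma exists_isSupAbs_of_linftyNorm_lt_top {N : (Ω →ₘ[μ] ℂ) → ℝ≥0∞} (h : linftyNorm N f < ∞) :
    ∃ F, IsSupAbs f F ∧ linftyNorm N f = N F := by
  obtain ⟨F, hF⟩ := iInf_lt_iff.1 h
  obtain ⟨hF, -⟩ := iInf_lt_iff.1 hF
  exact ⟨F, hF, hF.linftyNorm_eq N⟩

lemma linftyNorm_le_const_mul {N M : (Ω →ₘ[μ] ℂ) → ℝ≥0∞} {C : ℝ≥0} (hNM : ∀ f, N f ≤ C * M f)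
    {f : (Ω × ℤ) →ₘ[μ.prod Measure.count] ℂ} (hf : linftyNorm M f < ∞) :
    linftyNorm N f ≤ C * linftyNorm M f := by
  obtain ⟨F, hF, e⟩ := exists_isSupAbs_of_linftyNorm_lt_top hf
  rw [e, hF.linftyNorm_eq]
  exact hNM F

lemma linftyNorm_mono {N M : (Ω →ₘ[μ] ℂ) → ℝ≥0∞} (hNM : ∀ f, N f ≤ M f)
    (f : (Ω × ℤ) →ₘ[μ.prod Measure.count] ℂ) : linftyNorm N f ≤ linftyNorm M f :=
  iInf₂_mono fun F _ => hNM F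

namespace IsLatticeNorm

variable {N : (Ω →ₘ[μ] ℂ) → ℝ≥0∞} (hN : IsLatticeNorm N)
include hN

lemma linftyNorm_le {G : Ω →ₘ[μ] ℂ} (h : ∀ᵐ x ∂μ, ∀ j : ℤ, ‖f (x, j)‖ ≤ ‖G x‖) :
    linftyNorm N f ≤ N G := by
  obtain ⟨F, hF, hFG⟩ := exists_isSupAbs h
  rw [hF.linftyNorm_eq]
  exact hN.mono hFG

/-- Countable subadditivity is inherited because sup_j ∑_k |u_k(x,j)| ≤ ∑_k sup_j |u_k(x,j)|. Thus
X(ℓ^∞) is a lattice on Ω × ℤ of the same kind as X, and the general results apply to it. -/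
lemma linftyNorm_isLatticeNorm [SFinite μ] : IsLatticeNorm (linftyNorm (μ := μ) N) where
  eq_zero f hf := by
    obtain ⟨F, hF, e⟩ := exists_isSupAbs_of_linftyNorm_lt_top (hf ▸ ENNReal.zero_lt_top)
    have h0 := hN.eq_zero F (e ▸ hf)
    subst h0
    refine AEEqFun.ext ?_
    have : ∀ᵐ z ∂(μ.prod Measure.count), ‖f z‖ ≤ 0 := ae_prod_count_iff.2 (by
      filter_upwards [hF.norm_le, AEEqFun.coeFn_zero (μ := μ) (β := ℂ)] with x h1 h2 j
      have := h1 j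
      rwa [h2, Pi.zero_apply, norm_zero] at this)
    filter_upwards [this, AEEqFun.coeFn_zero (μ := μ.prod Measure.count) (β := ℂ)] with z h1 h2
    rw [h2, Pi.zero_apply, ← norm_le_zero_iff]
    exact h1
  smul c f := by
    have key : ∀ (c : ℂ) (f : (Ω × ℤ) →ₘ[μ.prod Measure.count] ℂ), c ≠ 0 →
        linftyNorm N (c • f) ≤ ‖c‖ₑ * linftyNorm N f := by
      intro c f hc
      by_cases hf : linftyNorm N f < ∞
      · obtain ⟨F, hF, e⟩ := exists_isSupAbs_of_linftyNorm_lt_top hf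
        rw [e, ← hN.smul]
        refine hN.linftyNorm_le ?_
        filter_upwards [hF.norm_le, AEEqFun.coeFn_smul c F,
          ae_prod_count_iff.1 (AEEqFun.coeFn_smul c f)] with x h1 h2 h3 j
        rw [h3 j, h2, Pi.smul_apply, Pi.smul_apply, norm_smul, norm_smul]
        exact mul_le_mul_of_nonneg_left (h1 j) (norm_nonneg _)
      · rw [not_lt_top_iff.1 hf, ENNReal.mul_top (by simpa using hc)]
        exact le_top
    by_cases hc : c = 0
    · subst hc
      rw [enorm_zero, zero_mul]
      refine le_antisymm ?_ zero_le
      rw [← hN.map_zero]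
      refine hN.linftyNorm_le ?_
      filter_upwards [ae_prod_count_iff.1 (AEEqFun.coeFn_smul (0 : ℂ) f)] with x h1 j
      rw [h1 j, Pi.smul_apply, zero_smul, norm_zero]
      exact norm_nonneg _
    · refine le_antisymm (key c f hc) ?_
      have h1 := key c⁻¹ (c • f) (inv_ne_zero hc)
      rw [smul_smul, inv_mul_cancel₀ hc, one_smul] at h1
      calc ‖c‖ₑ * linftyNorm N f ≤ ‖c‖ₑ * (‖c⁻¹‖ₑ * linftyNorm N (c • f)) := by gcongr
        _ = linftyNorm N (c • f) := by
          rw [← mul_assoc, ← enorm_mul, mul_inv_cancel₀ hc]; simp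
  le_tsum u g hg := by
    by_cases hu : ∑' k, linftyNorm N (u k) < ∞
    swap
    · rw [not_lt_top_iff.1 hu]; exact le_top
    have hk : ∀ k, linftyNorm N (u k) < ∞ := fun k => (ENNReal.le_tsum k).trans_lt hu
    choose F hF hFN using fun k => exists_isSupAbs_of_linftyNorm_lt_top (hk k)
    simp_rw [hFN] at hu ⊢
    have hdom : ∀ᵐ x ∂μ, ∀ j : ℤ, ‖g (x, j)‖ₑ ≤ ∑' k, ‖F k x‖ₑ := by
      filter_upwards [ae_prod_count_iff.1 hg, ae_all_iff.2 fun k => (hF k).norm_le] with x h1 h2 j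
      refine (h1 j).trans (ENNReal.tsum_le_tsum fun k => ?_)
      exact enorm_le_enorm_iff_norm.2 (h2 k j)
    obtain ⟨G, hG, hGle⟩ := exists_isSupAbs (f := g) (G := fun x => (∑' k, ‖F k x‖ₑ).toReal) (by
      filter_upwards [hdom, hN.ae_tsum_lt_top hu] with x h1 h2 j
      rw [← toReal_enorm]
      exact ENNReal.toReal_mono h2.ne (h1 j))
    rw [hG.linftyNorm_eq]
    refine hN.le_tsum _ _ ?_
    filter_upwards [hGle, hN.ae_tsum_lt_top hu] with x h1 h2
    rw [← ofReal_norm]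
    exact ENNReal.ofReal_le_of_le_toReal h1

end IsLatticeNorm

end

/-! ### The sum of two spaces -/

namespace ComplexInterp

section

variable {V : Type*} [AddCommGroup V] [Module ℂ V] {N₀ N₁ : V → ℝ≥0∞}

omit [Module ℂ V] in
lemma sumNorm_add_le (N₀ N₁ : V → ℝ≥0∞) (b c : V) : sumNorm N₀ N₁ (b + c) ≤ N₀ b + N₁ c := by
  have := iInf_le (fun d : V => N₀ d + N₁ (b + c - d)) b
  rwa [add_sub_cancel_left] at this

variable (h₀ : IsBanachNorm N₀) (h₁ : IsBanachNorm N₁)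
include h₀ h₁

omit h₀ in
lemma sumNorm_le_left (a : V) : sumNorm N₀ N₁ a ≤ N₀ a := by
  have := sumNorm_add_le N₀ N₁ a 0
  rwa [add_zero, h₁.map_zero, add_zero] at this

omit h₁ in
lemma sumNorm_le_right (a : V) : sumNorm N₀ N₁ a ≤ N₁ a := by
  have := sumNorm_add_le N₀ N₁ 0 a
  rwa [zero_add, h₀.map_zero, zero_add] at this

/-- The norm of a sum of two Banach spaces is complete, if it separates points. -/
lemma isBanachNorm_sumNorm_of_eq_zero (h : ∀ a, sumNorm N₀ N₁ a = 0 → a = 0) :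
    IsBanachNorm (sumNorm N₀ N₁) where
  eq_zero := h
  add_le a b := by
    refine ENNReal.le_iInf_add_iInf fun c d => ?_
    calc sumNorm N₀ N₁ (a + b) = sumNorm N₀ N₁ ((c + d) + ((a - c) + (b - d))) := by
          congr 1; abel
      _ ≤ N₀ (c + d) + N₁ ((a - c) + (b - d)) := sumNorm_add_le _ _ _ _
      _ ≤ (N₀ c + N₀ d) + (N₁ (a - c) + N₁ (b - d)) := add_le_add (h₀.add_le _ _) (h₁.add_le _ _)
      _ = _ := by abel
  smul c a := by
    have key : ∀ (c : ℂ) (a : V), c ≠ 0 → sumNorm N₀ N₁ (c • a) ≤ ‖c‖ₑ * sumNorm N₀ N₁ a := by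
      intro c a hc
      rw [sumNorm, sumNorm, ENNReal.mul_iInf_of_ne (by simpa using hc) (by simp)]
      refine le_iInf fun b => (iInf_le _ (c • b)).trans_eq ?_
      rw [← smul_sub, h₀.smul, h₁.smul, mul_add]
    by_cases hc : c = 0
    · rw [hc, zero_smul, enorm_zero, zero_mul]
      exact le_antisymm ((sumNorm_le_left h₁ 0).trans_eq h₀.map_zero) zero_le
    · refine le_antisymm (key c a hc) ?_
      have h1 := key c⁻¹ (c • a) (inv_ne_zero hc)
      rw [smul_smul, inv_mul_cancel₀ hc, one_smul] at h1
      calc ‖c‖ₑ * sumNorm N₀ N₁ a ≤ ‖c‖ₑ * (‖c⁻¹‖ₑ * sumNorm N₀ N₁ (c • a)) := by gcongr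
        _ = sumNorm N₀ N₁ (c • a) := by
          rw [← mul_assoc, ← enorm_mul, mul_inv_cancel₀ hc]; simp
  exists_tendsto_sum u hu := by
    -- Each term is split with an error `ε k`, the errors being summable; the two series of parts
    -- then converge separately.
    obtain ⟨ε, hε, hεs⟩ := ENNReal.exists_pos_sum_of_countable' (ε := 1) one_ne_zero ℕ
    have hex : ∀ k, ∃ b, N₀ b + N₁ (u k - b) < sumNorm N₀ N₁ (u k) + ε k := fun k =>
      iInf_lt_iff.1 (ENNReal.lt_add_right ((ENNReal.le_tsum k).trans_lt hu).ne (hε k).ne')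
    choose b hb using hex
    have hfin : ∑' k, (N₀ (b k) + N₁ (u k - b k)) < ∞ := by
      refine (ENNReal.tsum_le_tsum fun k => (hb k).le).trans_lt ?_
      rw [ENNReal.tsum_add]
      exact ENNReal.add_lt_top.2 ⟨hu, hεs.trans ENNReal.one_lt_top⟩
    rw [ENNReal.tsum_add, ENNReal.add_lt_top] at hfin
    obtain ⟨β, hβ⟩ := h₀.exists_tendsto_sum _ hfin.1
    obtain ⟨γ, hγ⟩ := h₁.exists_tendsto_sum _ hfin.2
    refine ⟨β + γ, ?_⟩
    have hlim := hβ.add hγ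
    rw [add_zero] at hlim
    refine tendsto_of_tendsto_of_tendsto_of_le_of_le tendsto_const_nhds hlim
      (fun n => zero_le) fun n => ?_
    refine le_trans (le_of_eq ?_) (sumNorm_add_le N₀ N₁ _ _)
    congr 1
    rw [Finset.sum_sub_distrib]
    abel

end

section

variable {Ω : Type*} [MeasurableSpace Ω] {μ : Measure Ω} {N₀ N₁ : (Ω →ₘ[μ] ℂ) → ℝ≥0∞}
  (h₀ : IsLatticeNorm N₀) (h₁ : IsLatticeNorm N₁)
include h₀ h₁

/-- Only the separation of points needs the lattice structure. If a has sum norm zero, it has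
decompositions b_k + (a - b_k) whose norms are summable; then b_k and a - b_k both tend to zero
almost everywhere, and a = 0. -/
lemma isBanachNorm_sumNorm : IsBanachNorm (sumNorm N₀ N₁) := by
  refine isBanachNorm_sumNorm_of_eq_zero h₀.isBanachNorm h₁.isBanachNorm fun a ha => ?_
  obtain ⟨ε, hε, hεs⟩ := ENNReal.exists_pos_sum_of_countable' (ε := 1) one_ne_zero ℕ
  have hex : ∀ k, ∃ b, N₀ b + N₁ (a - b) < ε k := fun k => iInf_lt_iff.1 (ha.trans_lt (hε k))
  choose b hb using hex
  have hfin : ∑' k, (N₀ (b k) + N₁ (a - b k)) < ∞ :=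
    (ENNReal.tsum_le_tsum fun k => (hb k).le).trans_lt (hεs.trans ENNReal.one_lt_top)
  rw [ENNReal.tsum_add, ENNReal.add_lt_top] at hfin
  refine AEEqFun.ext ?_
  filter_upwards [h₀.ae_tsum_lt_top hfin.1, h₁.ae_tsum_lt_top hfin.2,
    ae_all_iff.2 fun k => AEEqFun.coeFn_sub a (b k), AEEqFun.coeFn_zero (μ := μ) (β := ℂ)]
    with x h2 h3 h4 h5
  have hlim := (ENNReal.tendsto_atTop_zero_of_tsum_ne_top h2.ne).add
    (ENNReal.tendsto_atTop_zero_of_tsum_ne_top h3.ne)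
  rw [add_zero] at hlim
  have hle : ‖a x‖ₑ ≤ 0 := ge_of_tendsto' hlim fun k => by
    rw [h4, Pi.sub_apply]
    calc ‖a x‖ₑ = ‖b k x + (a x - b k x)‖ₑ := by rw [add_sub_cancel]
      _ ≤ _ := enorm_add_le _ _
  rw [h5, Pi.zero_apply]
  simpa using hle

/-- A function dominated by `|G₀| + |G₁|` is a sum of functions dominated by `G₀` and `G₁`. -/
lemma sumNorm_le_of_norm_le_add {φ G₀ G₁ : Ω →ₘ[μ] ℂ}
    (h : ∀ᵐ x ∂μ, ‖φ x‖ ≤ ‖G₀ x‖ + ‖G₁ x‖) : sumNorm N₀ N₁ φ ≤ N₀ G₀ + N₁ G₁ := by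
  have hm : Measurable fun x => φ x * ((‖G₀ x‖ / (‖G₀ x‖ + ‖G₁ x‖) : ℝ) : ℂ) :=
    φ.measurable.mul (Complex.measurable_ofReal.comp
      (G₀.measurable.norm.div (G₀.measurable.norm.add G₁.measurable.norm)))
  refine (iInf_le _ (classOf μ _ hm)).trans (add_le_add (h₀.mono ?_) (h₁.mono ?_))
  · filter_upwards [coeFn_classOf _ hm, h] with x h1 h2
    rw [h1, norm_mul, Complex.norm_real, Real.norm_of_nonneg (by positivity)]
    calc _ ≤ (‖G₀ x‖ + ‖G₁ x‖) * (‖G₀ x‖ / (‖G₀ x‖ + ‖G₁ x‖)) := by gcongr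
      _ = ‖G₀ x‖ * ((‖G₀ x‖ + ‖G₁ x‖) / (‖G₀ x‖ + ‖G₁ x‖)) := by ring
      _ ≤ ‖G₀ x‖ * 1 := by gcongr; exact div_self_le_one _
      _ = _ := mul_one _
  · filter_upwards [coeFn_classOf _ hm, h, AEEqFun.coeFn_sub φ (classOf μ _ hm)] with x h1 h2 h3
    rw [h3, Pi.sub_apply, h1]
    rcases (add_nonneg (norm_nonneg (G₀ x)) (norm_nonneg (G₁ x))).eq_or_lt with h0 | h0
    · rw [← h0, norm_le_zero_iff] at h2
      simp [h2]
    · have e : φ x - φ x * ((‖G₀ x‖ / (‖G₀ x‖ + ‖G₁ x‖) : ℝ) : ℂ) =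
          φ x * ((‖G₁ x‖ / (‖G₀ x‖ + ‖G₁ x‖) : ℝ) : ℂ) := by
        have e' : ‖G₁ x‖ / (‖G₀ x‖ + ‖G₁ x‖) = 1 - ‖G₀ x‖ / (‖G₀ x‖ + ‖G₁ x‖) := by
          field_simp; ring
        rw [e']
        push_cast
        ring
      rw [e, norm_mul, Complex.norm_real, Real.norm_of_nonneg (by positivity)]
      calc _ ≤ (‖G₀ x‖ + ‖G₁ x‖) * (‖G₁ x‖ / (‖G₀ x‖ + ‖G₁ x‖)) := by gcongr
        _ = _ := mul_div_cancel₀ _ h0.ne'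

end

end ComplexInterp

/-! ### The Banach space of elements of finite norm, as a type -/

namespace IsBanachNorm

variable {V : Type*} [AddCommGroup V] [Module ℂ V] {N : V → ℝ≥0∞}

/-- The subspace on which the norm is finite. -/
def submodule (hN : IsBanachNorm N) : Submodule ℂ V where
  carrier := {a | N a < ∞}
  add_mem' ha hb := (hN.add_le _ _).trans_lt (ENNReal.add_lt_top.2 ⟨ha, hb⟩)
  zero_mem' := by rw [mem_ofPred_eq, hN.map_zero]; exact ENNReal.zero_lt_top
  smul_mem' c a ha := by
    rw [mem_ofPred_eq, hN.smul]
    exact ENNReal.mul_lt_top enorm_lt_top ha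

/-- The Banach space with norm `N`. -/
def Space (hN : IsBanachNorm N) : Type _ := hN.submodule

variable {hN : IsBanachNorm N}

instance : AddCommGroup hN.Space := inferInstanceAs (AddCommGroup hN.submodule)
instance : Module ℂ hN.Space := inferInstanceAs (Module ℂ hN.submodule)

/-- The inclusion of the Banach space in the ambient space. -/
def val (hN : IsBanachNorm N) : hN.Space →ₗ[ℂ] V := hN.submodule.subtype

/-- An element of finite norm, as an element of the Banach space. -/
def toSpace (hN : IsBanachNorm N) (a : V) (ha : N a < ∞) : hN.Space := (⟨a, ha⟩ : hN.submodule)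

@[simp] lemma val_toSpace (a : V) (ha : N a < ∞) : hN.val (hN.toSpace a ha) = a := rfl

lemma val_injective (hN : IsBanachNorm N) : Function.Injective hN.val :=
  Subtype.val_injective

lemma val_lt_top (a : hN.Space) : N (hN.val a) < ∞ := Subtype.property (p := fun a => N a < ∞) a

instance : Norm hN.Space := ⟨fun a => (N (hN.val a)).toReal⟩

lemma norm_def (a : hN.Space) : ‖a‖ = (N (hN.val a)).toReal := rfl

lemma core (hN : IsBanachNorm N) : NormedSpace.Core ℂ hN.Space where
  norm_nonneg _ := ENNReal.toReal_nonneg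
  norm_smul c a := by
    rw [norm_def, norm_def, map_smul, hN.smul, ENNReal.toReal_mul, toReal_enorm]
  norm_triangle a b := by
    rw [norm_def, norm_def, norm_def, map_add,
      ← ENNReal.toReal_add (val_lt_top a).ne (val_lt_top b).ne]
    exact ENNReal.toReal_mono (ENNReal.add_lt_top.2 ⟨val_lt_top a, val_lt_top b⟩).ne
      (hN.add_le _ _)
  norm_eq_zero_iff a := by
    rw [norm_def, ENNReal.toReal_eq_zero_iff, or_iff_left (val_lt_top a).ne]
    refine ⟨fun h => hN.val_injective ?_, fun h => ?_⟩
    · rw [hN.eq_zero _ h, _root_.map_zero]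
    · rw [h, _root_.map_zero, hN.map_zero]

instance : NormedAddCommGroup hN.Space := NormedAddCommGroup.ofCore hN.core
instance : NormedSpace ℂ hN.Space := NormedSpace.ofCore hN.core

lemma enorm_def (a : hN.Space) : ‖a‖ₑ = N (hN.val a) := by
  rw [← ofReal_norm, norm_def, ENNReal.ofReal_toReal (val_lt_top a).ne]

instance : CompleteSpace hN.Space := by
  refine NormedAddCommGroup.completeSpace_of_summable_imp_tendsto fun u hu => ?_
  have hfin : ∑' k, N (hN.val (u k)) < ∞ := by
    simp_rw [← enorm_def]
    have := hu.tsum_ofReal_lt_top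
    simpa [ofReal_norm] using this
  obtain ⟨a, ha⟩ := hN.exists_tendsto_sum _ hfin
  obtain ⟨n, hn⟩ := (ha.eventually (gt_mem_nhds ENNReal.zero_lt_top)).exists
  -- The limit is given only in the ambient space; it has finite norm because it differs from a
  -- partial sum by an element of finite norm.
  have hlt : N a < ∞ := by
    have h1 : a = ∑ k ∈ Finset.range n, hN.val (u k) -
        (∑ k ∈ Finset.range n, hN.val (u k) - a) := by abel
    rw [h1]
    refine (hN.sub_le _ _).trans_lt (ENNReal.add_lt_top.2 ⟨?_, hn⟩)
    rw [← map_sum]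
    exact val_lt_top _
  refine ⟨hN.toSpace a hlt, ?_⟩
  rw [tendsto_iff_edist_tendsto_0]
  simp_rw [edist_eq_enorm_sub, enorm_def, map_sub, map_sum, val_toSpace]
  exact ha

lemma tendsto_iff {α : Type*} {l : Filter α} {u : α → hN.Space} {a : hN.Space} :
    Tendsto u l (𝓝 a) ↔ Tendsto (fun x => N (hN.val (u x) - hN.val a)) l (𝓝 0) := by
  rw [tendsto_iff_edist_tendsto_0]
  simp_rw [edist_eq_enorm_sub, enorm_def, map_sub]

/-- A continuous linear inclusion of Banach spaces, from an inequality between the norms. -/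
def inclusion {N' : V → ℝ≥0∞} (hN : IsBanachNorm N) (hN' : IsBanachNorm N')
    (h : ∀ a, N' a ≤ N a) : hN.Space →L[ℂ] hN'.Space :=
  LinearMap.mkContinuous
    { toFun := fun a => hN'.toSpace (hN.val a) ((h _).trans_lt (val_lt_top a))
      map_add' := fun a b => hN'.val_injective (by simp)
      map_smul' := fun c a => hN'.val_injective (by simp) } 1 fun a => by
    rw [one_mul, norm_def, norm_def]
    exact ENNReal.toReal_mono (val_lt_top a).ne (h _)

@[simp] lemma val_inclusion {N' : V → ℝ≥0∞} (hN' : IsBanachNorm N') (h : ∀ a, N' a ≤ N a)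
    (a : hN.Space) : hN'.val (hN.inclusion hN' h a) = hN.val a := rfl

end IsBanachNorm

/-! ### Moduli of Bochner integrals in a lattice -/

section

open IsBanachNorm

variable {Ω : Type*} [MeasurableSpace Ω] {μ : Measure Ω} {N : (Ω →ₘ[μ] ℂ) → ℝ≥0∞}

/-- The pairs `(a, h)` with `|a| ≤ Re h`. -/
def dominatedPairs (hN : IsBanachNorm N) : Set (hN.Space × hN.Space) :=
  {p | ∀ᵐ x ∂μ, ‖hN.val p.1 x‖ ≤ (hN.val p.2 x).re}

lemma convex_dominatedPairs (hN : IsBanachNorm N) : Convex ℝ (dominatedPairs hN) := by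
  intro p hp q hq a b ha hb _
  have e : ∀ y z : hN.Space, hN.val (a • y + b • z) = (a : ℂ) • hN.val y + (b : ℂ) • hN.val z := by
    intro y z
    rw [map_add, ← Complex.coe_smul, ← Complex.coe_smul, map_smul, map_smul]
  have he : ∀ y z : hN.Space, ∀ᵐ x ∂μ, hN.val (a • y + b • z) x =
      (a : ℂ) * hN.val y x + (b : ℂ) * hN.val z x := by
    intro y z
    rw [e]
    filter_upwards [AEEqFun.coeFn_add ((a : ℂ) • hN.val y) ((b : ℂ) • hN.val z),
      AEEqFun.coeFn_smul (a : ℂ) (hN.val y), AEEqFun.coeFn_smul (b : ℂ) (hN.val z)] with x h1 h2 h3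
    exact h1.trans (congrArg₂ (· + ·) h2 h3)
  have hp' : ∀ᵐ x ∂μ, ‖hN.val p.1 x‖ ≤ (hN.val p.2 x).re := hp
  have hq' : ∀ᵐ x ∂μ, ‖hN.val q.1 x‖ ≤ (hN.val q.2 x).re := hq
  change ∀ᵐ x ∂μ, ‖hN.val (a • p.1 + b • q.1) x‖ ≤ (hN.val (a • p.2 + b • q.2) x).re
  filter_upwards [hp', hq', he p.1 q.1, he p.2 q.2] with x h1 h2 h3 h4
  rw [h3, h4, Complex.add_re, Complex.re_ofReal_mul, Complex.re_ofReal_mul]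
  refine (norm_add_le _ _).trans ?_
  rw [norm_mul, norm_mul, Complex.norm_real, Complex.norm_real, Real.norm_of_nonneg ha,
    Real.norm_of_nonneg hb]
  gcongr

/-- For any dominated pair (a', h'), the positive part of |a| - Re h is at most |a - a'| + |h - h'|;
if (a, h) is a limit of such pairs, this positive part has norm zero. -/
lemma isClosed_dominatedPairs (hN : IsLatticeNorm N) (hB : IsBanachNorm N) :
    IsClosed (dominatedPairs hB) := by
  refine isClosed_of_closure_subset fun p hp => ?_
  have hm : Measurable fun x => ((max (‖hB.val p.1 x‖ - (hB.val p.2 x).re) 0 : ℝ) : ℂ) :=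
    Complex.measurable_ofReal.comp (Measurable.max ((hB.val p.1).measurable.norm.sub
      (Complex.measurable_re.comp (hB.val p.2).measurable)) measurable_const)
  have h0 : N (classOf μ _ hm) = 0 := by
    refine le_antisymm (ENNReal.le_of_forall_pos_le_add fun ε hε _ => ?_) zero_le
    rw [zero_add]
    obtain ⟨q, hq, hpq⟩ := EMetric.mem_closure_iff.1 hp (ε / 2 : ℝ≥0)
      (by exact_mod_cast half_pos hε)
    rw [Prod.edist_eq, max_lt_iff, edist_eq_enorm_sub, edist_eq_enorm_sub, enorm_def,
      enorm_def, map_sub, map_sub] at hpq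
    have hq' : ∀ᵐ x ∂μ, ‖hB.val q.1 x‖ ≤ (hB.val q.2 x).re := hq
    refine (hN.le_add (f := hB.val p.1 - hB.val q.1) (h := hB.val p.2 - hB.val q.2) ?_).trans
      ((add_le_add hpq.1.le hpq.2.le).trans_eq (by
        rw [← ENNReal.coe_add, add_halves]))
    filter_upwards [coeFn_classOf _ hm, hq', AEEqFun.coeFn_sub (hB.val p.1) (hB.val q.1),
      AEEqFun.coeFn_sub (hB.val p.2) (hB.val q.2)] with x h1 h2 h3 h4
    rw [h1, h3, h4, Complex.norm_real, Real.norm_of_nonneg (le_max_right _ _), Pi.sub_apply,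
      Pi.sub_apply]
    refine max_le ?_ (by positivity)
    have i1 := norm_sub_norm_le (hB.val p.1 x) (hB.val q.1 x)
    have i2 := (Complex.abs_re_le_norm (hB.val p.2 x - hB.val q.2 x))
    rw [Complex.sub_re] at i2
    have i3 := neg_abs_le ((hB.val p.2 x).re - (hB.val q.2 x).re)
    linarith
  have h1 := hN.eq_zero _ h0
  change ∀ᵐ x ∂μ, ‖hB.val p.1 x‖ ≤ (hB.val p.2 x).re
  filter_upwards [coeFn_classOf _ hm, AEEqFun.coeFn_zero (μ := μ) (β := ℂ)] with x h2 h3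
  rw [h1, h3, Pi.zero_apply, eq_comm, Complex.ofReal_eq_zero] at h2
  have := le_max_left (‖hB.val p.1 x‖ - (hB.val p.2 x).re) 0
  linarith

/-- The triangle inequality for weighted Bochner integrals in a Banach lattice. -/
lemma norm_integral_le_integral (hN : IsLatticeNorm N) {hB : IsBanachNorm N} {k : ℝ → ℝ} (hk : Integrable k)
    (hkm : Measurable k) (hk0 : ∀ t, 0 ≤ k t) (hkpos : 0 < ∫ t, k t)
    {α β : ℝ → hB.Space}
    (hα : Integrable fun t => k t • α t) (hβ : Integrable fun t => k t • β t)
    (h : ∀ t, ∀ᵐ x ∂μ, ‖hB.val (α t) x‖ ≤ (hB.val (β t) x).re) :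
    ∀ᵐ x ∂μ, ‖hB.val (∫ t, k t • α t) x‖ ≤
      (hB.val (∫ t, k t • β t) x).re := by
  let κ : ℝ → ℝ≥0 := fun t => ⟨k t, hk0 t⟩
  have hκ : Measurable κ := hkm.subtype_mk
  let ν : Measure ℝ := volume.withDensity fun t => κ t
  have hκ' : ∀ t, (κ t : ℝ≥0∞) = ENNReal.ofReal (k t) := fun t => by
    rw [ENNReal.ofReal, Real.toNNReal_of_nonneg (hk0 t)]; rfl
  have hν : ν univ = ENNReal.ofReal (∫ t, k t) := by
    rw [withDensity_apply _ MeasurableSet.univ, Measure.restrict_univ,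
      ofReal_integral_eq_lintegral_ofReal hk (ae_of_all _ hk0)]
    simp_rw [hκ']
  have : IsFiniteMeasure ν := ⟨by rw [hν]; exact ENNReal.ofReal_lt_top⟩
  have : NeZero ν := ⟨fun h0 => by
    rw [h0, Measure.coe_zero, Pi.zero_apply, eq_comm, ENNReal.ofReal_eq_zero] at hν
    linarith⟩
  have ha : Integrable α ν := (integrable_withDensity_iff_integrable_smul hκ).2 hα
  have hb : Integrable β ν := (integrable_withDensity_iff_integrable_smul hκ).2 hβ
  -- A closed convex set contains the averages of its elements. Applied to the finite measure k dt,
  -- this gives the pointwise inequality without evaluating a Bochner integral at points of Ω.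
  have hmem := (convex_dominatedPairs hB).average_mem (isClosed_dominatedPairs hN hB) (μ := ν)
    (f := fun t => (α t, β t)) (ae_of_all _ h) (ha.prodMk hb)
  have hr : 0 ≤ ν.real univ := measureReal_nonneg
  have hpair : ∫ t, (α t, β t) ∂ν = (∫ t, k t • α t, ∫ t, k t • β t) := by
    rw [integral_pair ha hb, integral_withDensity_eq_integral_smul hκ,
      integral_withDensity_eq_integral_smul hκ]
    rfl
  rw [← measure_smul_average] at hpair
  set P := ⨍ t, (α t, β t) ∂ν
  have hP : ∀ᵐ x ∂μ, ‖hB.val P.1 x‖ ≤ (hB.val P.2 x).re := hmem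
  have e1 : ∫ t, k t • α t = (ν.real univ : ℂ) • P.1 := by
    rw [Complex.coe_smul]; exact (congrArg Prod.fst hpair).symm
  have e2 : ∫ t, k t • β t = (ν.real univ : ℂ) • P.2 := by
    rw [Complex.coe_smul]; exact (congrArg Prod.snd hpair).symm
  rw [e1, e2, map_smul, map_smul]
  filter_upwards [hP, AEEqFun.coeFn_smul (ν.real univ : ℂ) (hB.val P.1),
    AEEqFun.coeFn_smul (ν.real univ : ℂ) (hB.val P.2)] with x h1 h2 h3
  have h2' : ((ν.real univ : ℂ) • hB.val P.1 : Ω →ₘ[μ] ℂ) x = (ν.real univ : ℂ) * hB.val P.1 x := h2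
  have h3' : ((ν.real univ : ℂ) • hB.val P.2 : Ω →ₘ[μ] ℂ) x = (ν.real univ : ℂ) * hB.val P.2 x := h3
  refine (congrArg norm h2').trans_le (le_of_le_of_eq ?_ (congrArg Complex.re h3').symm)
  rw [norm_mul, Complex.norm_real, Real.norm_of_nonneg hr, Complex.re_ofReal_mul]
  gcongr

end

/-! ### The pointwise geometric mean bound for functions in 𝓕 -/

namespace ComplexInterp

open IsBanachNorm

section

variable {V : Type*} [AddCommGroup V] [Module ℂ V] {N : V → ℝ≥0∞} {f : ℂ → V} {x : ℝ}

/-- The restriction of `f` to a line, with values in the Banach space. -/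
def IsC0OnLine.restrict (h : IsC0OnLine N f x) (hN : IsBanachNorm N) (t : ℝ) : hN.Space :=
  hN.toSpace (f (x + t * Complex.I)) (h.mem t)

lemma IsC0OnLine.continuous_restrict (h : IsC0OnLine N f x) (hN : IsBanachNorm N) :
    Continuous (h.restrict hN) :=
  continuous_iff_continuousAt.2 fun t => tendsto_iff.2 (h.continuous t)

/-- Decay bounds the norm by 1 off a compact set of t, and continuity bounds it on that set. -/
lemma IsC0OnLine.iSup_lt_top (h : IsC0OnLine N f x) (hN : IsBanachNorm N) :
    ⨆ t : ℝ, N (f (x + t * Complex.I)) < ∞ := by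
  obtain ⟨K, hK, hKc⟩ := mem_cocompact.1 (h.decay.eventually (gt_mem_nhds zero_lt_one))
  obtain ⟨C, hC⟩ := hK.exists_bound_of_continuousOn (h.continuous_restrict hN).continuousOn
  refine lt_of_le_of_lt (iSup_le fun t => ?_) (max_lt ENNReal.one_lt_top
    (ENNReal.ofReal_lt_top (r := C)))
  by_cases ht : t ∈ K
  · refine le_max_of_le_right ?_
    have := hC t ht
    have e : N (f (x + t * Complex.I)) = ENNReal.ofReal ‖h.restrict hN t‖ := by
      rw [ofReal_norm, enorm_def]; rfl
    rw [e]
    exact ENNReal.ofReal_le_ofReal this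
  · exact le_max_of_le_left (hKc ht : N (f (x + t * Complex.I)) < 1).le

variable {N₀ N₁ : V → ℝ≥0∞}

lemma MemF.sumNorm_lt_top (hf : MemF N₀ N₁ f) {z : ℂ} (hz : z ∈ strip) :
    sumNorm N₀ N₁ (f z) < ∞ := by
  obtain ⟨M, hM⟩ := hf.bounded
  exact (hM z hz).trans_lt ENNReal.coe_lt_top

open Classical in
/-- The function `f` on the strip, with values in the Banach space `X₀ + X₁`. -/
def liftSum (hE : IsBanachNorm (sumNorm N₀ N₁)) (f : ℂ → V) (z : ℂ) : hE.Space :=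
  if h : sumNorm N₀ N₁ (f z) < ∞ then hE.toSpace (f z) h else 0

variable (hE : IsBanachNorm (sumNorm N₀ N₁))

lemma MemF.val_liftSum (hf : MemF N₀ N₁ f) {z : ℂ} (hz : z ∈ strip) :
    hE.val (liftSum hE f z) = f z := by
  rw [liftSum, dif_pos (hf.sumNorm_lt_top hz), val_toSpace]

lemma MemF.continuousOn_liftSum (hf : MemF N₀ N₁ f) : ContinuousOn (liftSum hE f) strip := by
  intro z hz
  refine tendsto_iff.2 ((hf.continuous z hz).congr' ?_)
  filter_upwards [self_mem_nhdsWithin] with w hw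
  rw [hf.val_liftSum hE hz, hf.val_liftSum hE hw]

lemma MemF.norm_liftSum_le (hf : MemF N₀ N₁ f) : ∃ M : ℝ, ∀ z ∈ strip, ‖liftSum hE f z‖ ≤ M := by
  obtain ⟨M, hM⟩ := hf.bounded
  refine ⟨M, fun z hz => ?_⟩
  rw [norm_def, hf.val_liftSum hE hz]
  exact ENNReal.toReal_le_coe_of_le_coe (hM z hz)

lemma MemF.differentiableOn_liftSum (hf : MemF N₀ N₁ f) :
    DifferentiableOn ℂ (liftSum hE f) (interior strip) := by
  intro z hz
  obtain ⟨d, hd⟩ := hf.analytic z hz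
  have hs : ∀ᶠ w in 𝓝[≠] z, w ∈ strip :=
    mem_nhdsWithin_of_mem_nhds (mem_interior_iff_mem_nhds.1 hz)
  have hzs : z ∈ strip := interior_subset hz
  have hval : ∀ w ∈ strip, (w - z)⁻¹ • (f w - f z) =
      hE.val ((w - z)⁻¹ • (liftSum hE f w - liftSum hE f z)) := fun w hw => by
    rw [map_smul, map_sub, hf.val_liftSum hE hw, hf.val_liftSum hE hzs]
  -- The derivative is given only in the ambient space; closeness to a single difference quotient
  -- puts it in X_0 + X_1.
  have hdlt : sumNorm N₀ N₁ d < ∞ := by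
    obtain ⟨w, hw, hws⟩ :=
      ((hd.eventually (gt_mem_nhds ENNReal.zero_lt_top)).and hs).exists
    have e : d = (w - z)⁻¹ • (f w - f z) - ((w - z)⁻¹ • (f w - f z) - d) := by abel
    rw [e]
    refine (hE.sub_le _ _).trans_lt (ENNReal.add_lt_top.2 ⟨?_, hw⟩)
    rw [hval w hws]
    exact val_lt_top _
  refine (HasDerivAt.differentiableAt (f' := hE.toSpace d hdlt)
    (hasDerivAt_iff_tendsto_slope.2 (tendsto_iff.2 (hd.congr' ?_)))).differentiableWithinAt
  filter_upwards [hs] with w hw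
  rw [slope_def_module, val_toSpace, hval w hw]

end

section

variable {Ω : Type*} [MeasurableSpace Ω] {μ : Measure Ω} {N : (Ω →ₘ[μ] ℂ) → ℝ≥0∞}

/-- H is the integral of k|φ|. It is chosen before the multiplier c, so one H serves all multipliers
of constant modulus; this is what later permits optimization over s in c(z) = s^{θ-z}. -/
lemma exists_norm_integral_le (hN : IsLatticeNorm N) {hB : IsBanachNorm N} {k : ℝ → ℝ}
    (hk : Integrable k) (hkc : Continuous k) (hk0 : ∀ t, 0 ≤ k t) (hkpos : 0 < ∫ t, k t)
    {φ : ℝ → hB.Space} (hφ : Continuous φ) (hφb : ⨆ t, ‖φ t‖ₑ < ∞) :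
    ∃ H : Ω →ₘ[μ] ℂ, N H ≤ ENNReal.ofReal (∫ t, k t) * ⨆ t, ‖φ t‖ₑ ∧
      ∀ (c : ℝ → ℂ) (r : ℝ), Continuous c → (∀ t, ‖c t‖ = r) →
        Integrable (fun t => k t • c t • φ t) ∧
        ∀ᵐ x ∂μ, ‖hB.val (∫ t, k t • c t • φ t) x‖ ≤ r * ‖H x‖ := by
  have hm : ∀ t, Measurable fun x => ((‖hB.val (φ t) x‖ : ℝ) : ℂ) := fun t =>
    Complex.measurable_ofReal.comp (hB.val (φ t)).measurable.norm
  have habs : ∀ t, N (classOf μ _ (hm t)) = N (hB.val (φ t)) := fun t => hN.congr_norm (by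
    filter_upwards [coeFn_classOf _ (hm t)] with x hx
    rw [hx]; simp)
  let ψ : ℝ → hB.Space := fun t =>
    hB.toSpace (classOf μ _ (hm t)) ((habs t).trans_lt (val_lt_top _))
  have hψe : ∀ t, ‖ψ t‖ₑ = ‖φ t‖ₑ := fun t => by rw [enorm_def, enorm_def]; exact habs t
  have hψc : Continuous ψ := by
    refine continuous_iff_continuousAt.2 fun t => tendsto_iff.2 ?_
    have h1 := tendsto_iff.1 (hφ.tendsto t)
    refine tendsto_of_tendsto_of_tendsto_of_le_of_le tendsto_const_nhds h1
      (fun s => zero_le) fun s => hN.mono ?_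
    filter_upwards [AEEqFun.coeFn_sub (hB.val (ψ s)) (hB.val (ψ t)),
      AEEqFun.coeFn_sub (hB.val (φ s)) (hB.val (φ t)), coeFn_classOf _ (hm s),
      coeFn_classOf _ (hm t)] with x h1 h2 h3 h4
    have h3' : hB.val (ψ s) x = (‖hB.val (φ s) x‖ : ℝ) := h3
    have h4' : hB.val (ψ t) x = (‖hB.val (φ t) x‖ : ℝ) := h4
    rw [h1, h2, Pi.sub_apply, Pi.sub_apply, h3', h4', ← Complex.ofReal_sub, Complex.norm_real]
    exact abs_norm_sub_norm_le _ _
  have hbd : ∀ t, ‖φ t‖ ≤ (⨆ t, ‖φ t‖ₑ).toReal := fun t => by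
    rw [← toReal_enorm]
    exact ENNReal.toReal_mono hφb.ne (le_iSup (fun t => ‖φ t‖ₑ) t)
  have hint : ∀ (η : ℝ → hB.Space) (b : ℝ), Continuous η → (∀ t, ‖η t‖ ≤ b) →
      Integrable fun t => k t • η t := by
    intro η b hη hb
    refine (hk.mul_const b).mono' (hkc.smul hη).aestronglyMeasurable (ae_of_all _ fun t => ?_)
    rw [norm_smul, Real.norm_of_nonneg (hk0 t)]
    exact mul_le_mul_of_nonneg_left (hb t) (hk0 t)
  have hψb : ∀ t, ‖ψ t‖ ≤ (⨆ t, ‖φ t‖ₑ).toReal := fun t => by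
    rw [← toReal_enorm, hψe, toReal_enorm]; exact hbd t
  refine ⟨hB.val (∫ t, k t • ψ t), ?_, fun c r hc hcr => ?_⟩
  · rw [← enorm_def (hN := hB)]
    refine (enorm_integral_le_lintegral_enorm _).trans ?_
    rw [ofReal_integral_eq_lintegral_ofReal hk (ae_of_all _ hk0),
      ← lintegral_mul_const _ hkc.measurable.ennreal_ofReal]
    refine lintegral_mono fun t => ?_
    rw [enorm_smul, hψe, Real.enorm_of_nonneg (hk0 t)]
    gcongr
    exact le_iSup (fun t => ‖φ t‖ₑ) t
  · have hr : 0 ≤ r := hcr 0 ▸ norm_nonneg _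
    have hi : Integrable fun t => k t • c t • φ t :=
      hint _ (r * (⨆ t, ‖φ t‖ₑ).toReal) (hc.smul hφ) fun t => by
        rw [norm_smul, hcr]; exact mul_le_mul_of_nonneg_left (hbd t) hr
    refine ⟨hi, ?_⟩
    have hi2 : Integrable fun t => k t • (r : ℂ) • ψ t :=
      hint _ (r * (⨆ t, ‖φ t‖ₑ).toReal) (by fun_prop) fun t => by
        rw [norm_smul, Complex.norm_real, Real.norm_of_nonneg hr]
        exact mul_le_mul_of_nonneg_left (hψb t) hr
    have key := norm_integral_le_integral hN hk hkc.measurable hk0 hkpos hi hi2 fun t => by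
      rw [map_smul, map_smul]
      filter_upwards [AEEqFun.coeFn_smul (c t) (hB.val (φ t)),
        AEEqFun.coeFn_smul (r : ℂ) (hB.val (ψ t)), coeFn_classOf _ (hm t)] with x h1 h2 h3
      have h3' : hB.val (ψ t) x = (‖hB.val (φ t) x‖ : ℝ) := h3
      have h1' : (c t • hB.val (φ t) : Ω →ₘ[μ] ℂ) x = c t * hB.val (φ t) x := h1
      have h2' : ((r : ℂ) • hB.val (ψ t) : Ω →ₘ[μ] ℂ) x = r * hB.val (ψ t) x := h2
      refine le_of_eq ((congrArg norm h1').trans (Eq.trans ?_ (congrArg Complex.re h2').symm))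
      rw [h3', norm_mul, hcr, Complex.re_ofReal_mul, Complex.ofReal_re]
    have e : ∫ t, k t • (r : ℂ) • ψ t = (r : ℂ) • ∫ t, k t • ψ t := by
      rw [← integral_smul]
      congr 1
      ext t
      rw [smul_comm]
    rw [e, map_smul] at key
    filter_upwards [key, AEEqFun.coeFn_smul (r : ℂ) (hB.val (∫ t, k t • ψ t))] with x h1 h2
    have h2' : ((r : ℂ) • hB.val (∫ t, k t • ψ t) : Ω →ₘ[μ] ℂ) x =
      r * hB.val (∫ t, k t • ψ t) x := h2
    refine h1.trans ((congrArg Complex.re h2').trans_le ?_)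
    rw [Complex.re_ofReal_mul]
    exact mul_le_mul_of_nonneg_left (Complex.re_le_norm _) hr

/-- At s = b/a the right-hand side equals a^{1-θ} b^θ, its minimum over s > 0. Only rational s are
assumed, since in the application every s brings its own null set; continuity in s covers the
others. Replacing a, b by a + ε, b + ε makes the optimal s positive. -/
lemma le_rpow_mul_rpow_of_forall_rat {θ y a b : ℝ} (hθ₀ : 0 < θ) (hθ₁ : θ < 1)
    (ha : 0 ≤ a) (hb : 0 ≤ b)
    (h : ∀ s : ℚ, 0 < s → y ≤ (1 - θ) * ((s : ℝ) ^ θ * a) + θ * ((s : ℝ) ^ (θ - 1) * b)) :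
    y ≤ a ^ (1 - θ) * b ^ θ := by
  have h1 : 0 < 1 - θ := sub_pos.2 hθ₁
  have hreal : ∀ s : ℝ, 0 < s → y ≤ (1 - θ) * (s ^ θ * a) + θ * (s ^ (θ - 1) * b) := by
    intro s hs
    by_contra hlt
    have hc : ContinuousAt (fun s : ℝ => (1 - θ) * (s ^ θ * a) + θ * (s ^ (θ - 1) * b)) s :=
      ((((Real.continuousAt_rpow_const _ _ (Or.inl hs.ne')).mul_const _).const_mul _).add
        (((Real.continuousAt_rpow_const _ _ (Or.inl hs.ne')).mul_const _).const_mul _))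
    have hev := (hc.eventually (gt_mem_nhds (not_le.1 hlt))).and (lt_mem_nhds hs)
    obtain ⟨q, hq, hq0⟩ := Rat.denseRange_cast.mem_nhds hev
    exact absurd (h q (by exact_mod_cast hq0)) (not_le.2 hq)
  have hlim : Tendsto (fun ε : ℝ => (a + ε) ^ (1 - θ) * (b + ε) ^ θ) (𝓝[>] 0)
      (𝓝 (a ^ (1 - θ) * b ^ θ)) := by
    have hc : Continuous fun ε : ℝ => (a + ε) ^ (1 - θ) * (b + ε) ^ θ :=
      ((Real.continuous_rpow_const h1.le).comp (by fun_prop : Continuous fun ε => a + ε)).mul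
        ((Real.continuous_rpow_const hθ₀.le).comp (by fun_prop : Continuous fun ε => b + ε))
    have := (hc.tendsto 0).mono_left (nhdsWithin_le_nhds (s := Ioi 0))
    simpa using this
  refine ge_of_tendsto hlim ?_
  filter_upwards [self_mem_nhdsWithin] with ε hε
  have hε' : (0 : ℝ) < ε := hε
  have hA : 0 < a + ε := by linarith
  have hB : 0 < b + ε := by linarith
  refine (hreal ((b + ε) / (a + ε)) (by positivity)).trans ?_
  have e1 : ((b + ε) / (a + ε)) ^ θ * (a + ε) = (a + ε) ^ (1 - θ) * (b + ε) ^ θ := by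
    rw [Real.div_rpow hB.le hA.le, Real.rpow_sub hA, Real.rpow_one]
    field_simp
  have e2 : ((b + ε) / (a + ε)) ^ (θ - 1) * (b + ε) = (a + ε) ^ (1 - θ) * (b + ε) ^ θ := by
    rw [Real.div_rpow hB.le hA.le, Real.rpow_sub hA, Real.rpow_sub hA, Real.rpow_sub hB,
      Real.rpow_one, Real.rpow_one]
    field_simp
  calc _ ≤ (1 - θ) * (((b + ε) / (a + ε)) ^ θ * (a + ε)) +
        θ * (((b + ε) / (a + ε)) ^ (θ - 1) * (b + ε)) := by gcongr <;> linarith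
    _ = _ := by rw [e1, e2]; ring

variable {N₀ N₁ : (Ω →ₘ[μ] ℂ) → ℝ≥0∞} {f : ℂ → Ω →ₘ[μ] ℂ}

lemma MemF.exists_kernel_bound (hN₀ : IsLatticeNorm N₀) (hN₁ : IsLatticeNorm N₁)
    (hf : MemF N₀ N₁ f) {θ : ℝ} (hθ₀ : 0 < θ) (hθ₁ : θ < 1) :
    ∃ H₀ H₁ : Ω →ₘ[μ] ℂ,
      N₀ H₀ ≤ ENNReal.ofReal (∫ t, kernelZero θ t) *
        ⨆ t : ℝ, N₀ (f ((0 : ℝ) + t * Complex.I)) ∧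
      N₁ H₁ ≤ ENNReal.ofReal (∫ t, kernelOne θ t) *
        ⨆ t : ℝ, N₁ (f ((1 : ℝ) + t * Complex.I)) ∧
      ∀ s : ℝ, 0 < s → ∀ᵐ x ∂μ, ((∫ t, kernelZero θ t) + ∫ t, kernelOne θ t) * ‖f θ x‖ ≤
        s ^ θ * ‖H₀ x‖ + s ^ (θ - 1) * ‖H₁ x‖ := by
  have hE := isBanachNorm_sumNorm hN₀ hN₁
  have hB₀ := hN₀.isBanachNorm
  have hB₁ := hN₁.isBanachNorm
  have hm := integral_kernelOne hθ₀ hθ₁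
  have hmpos := integral_kernel_pos hθ₀ hθ₁
  have hpos1 : 0 < ∫ t, kernelOne θ t := by rw [hm]; positivity
  have hpos0 : 0 < ∫ t, kernelZero θ t := by nlinarith
  have hφ₀ : ∀ t, ‖hf.line_zero.restrict hB₀ t‖ₑ = N₀ (f ((0 : ℝ) + t * Complex.I)) := fun t => by
    rw [enorm_def]; rfl
  have hφ₁ : ∀ t, ‖hf.line_one.restrict hB₁ t‖ₑ = N₁ (f ((1 : ℝ) + t * Complex.I)) := fun t => by
    rw [enorm_def]; rfl
  obtain ⟨H₀, hH₀, hd₀⟩ := exists_norm_integral_le hN₀ (integrable_kernelZero hθ₀ hθ₁)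
    (continuous_kernelZero hθ₀ hθ₁) (fun t => (kernelZero_pos hθ₀ hθ₁ t).le) hpos0
    (hf.line_zero.continuous_restrict hB₀) (by
      simp_rw [hφ₀]; exact hf.line_zero.iSup_lt_top hB₀)
  obtain ⟨H₁, hH₁, hd₁⟩ := exists_norm_integral_le hN₁ (integrable_kernelOne hθ₀ hθ₁)
    (continuous_kernelOne hθ₀ hθ₁) (fun t => (kernelOne_pos hθ₀ hθ₁ t).le) hpos1
    (hf.line_one.continuous_restrict hB₁) (by
      simp_rw [hφ₁]; exact hf.line_one.iSup_lt_top hB₁)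
  simp_rw [hφ₀] at hH₀
  simp_rw [hφ₁] at hH₁
  refine ⟨H₀, H₁, hH₀, hH₁, fun s hs => ?_⟩
  -- This is s^{θ-z}: it equals 1 at θ and has constant modulus s^θ on the line Re z = 0 and s^{θ-1}
  -- on the line Re z = 1.
  let c : ℂ → ℂ := fun z => Complex.exp ((θ - z) * Real.log s)
  have hcc : Continuous c := by fun_prop
  have hcd : Differentiable ℂ c := by fun_prop
  have hcn : ∀ z, ‖c z‖ = Real.exp ((θ - z.re) * Real.log s) := fun z => by
    rw [Complex.norm_exp, Complex.re_mul_ofReal, Complex.sub_re, Complex.ofReal_re]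
  obtain ⟨M, hM⟩ := hf.norm_liftSum_le hE
  have hM0 : 0 ≤ M := (norm_nonneg _).trans (hM 0 (by simp [strip]))
  have hgb : ∀ z ∈ strip, ‖c z • liftSum hE f z‖ ≤
      (Real.exp |Real.log s| * M) * Real.exp |z.im| := fun z hz => by
    rw [norm_smul, hcn]
    have h1 : (θ - z.re) * Real.log s ≤ |Real.log s| := by
      refine (le_abs_self _).trans ?_
      rw [abs_mul]
      refine mul_le_of_le_one_left (abs_nonneg _) (abs_le.2 ?_)
      constructor <;> linarith [hz.1, hz.2]
    calc _ ≤ Real.exp |Real.log s| * M := by gcongr; exact hM z hz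
      _ ≤ _ := le_mul_of_one_le_right (by positivity) (Real.one_le_exp (abs_nonneg _))
  have hP := integral_kernel_smul_add hθ₀ hθ₁ (f := fun z => c z • liftSum hE f z)
    (hcc.continuousOn.smul (hf.continuousOn_liftSum hE))
    (DifferentiableOn.smul hcd.differentiableOn (hf.differentiableOn_liftSum hE)) hgb
  have hcont : ∀ x : ℝ, Continuous fun t : ℝ => c (x + t * Complex.I) := fun x => by fun_prop
  obtain ⟨hi₀, hae₀⟩ := hd₀ (fun t => c ((0 : ℝ) + t * Complex.I)) (s ^ θ) (hcont 0) (fun t => by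
    rw [hcn, Real.rpow_def_of_pos hs]; simp [mul_comm])
  obtain ⟨hi₁, hae₁⟩ := hd₁ (fun t => c ((1 : ℝ) + t * Complex.I)) (s ^ (θ - 1)) (hcont 1)
    (fun t => by rw [hcn, Real.rpow_def_of_pos hs]; simp [mul_comm])
  -- The Poisson formula holds in X_0 + X_1, whereas the bounds come from integrals taken in X_0 and
  -- X_1; the continuous inclusions commute with the integrals and identify the two.
  let ι₀ := hB₀.inclusion hE (sumNorm_le_left hB₁)
  let ι₁ := hB₁.inclusion hE (sumNorm_le_right hB₀)
  have e₀ : ∫ t : ℝ, kernelZero θ t •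
      (c ((0 : ℝ) + t * Complex.I) • liftSum hE f ((0 : ℝ) + t * Complex.I)) =
      ι₀ (∫ t : ℝ, kernelZero θ t • c ((0 : ℝ) + t * Complex.I) • hf.line_zero.restrict hB₀ t) := by
    rw [← ContinuousLinearMap.integral_comp_comm _ hi₀]
    congr 1
    ext t
    rw [← Complex.coe_smul, ← Complex.coe_smul, map_smul, map_smul]
    congr 2
    refine hE.val_injective ?_
    rw [hf.val_liftSum hE (zero_add_mul_I_mem_strip t)]
    rfl
  have e₁ : ∫ t : ℝ, kernelOne θ t •
      (c ((1 : ℝ) + t * Complex.I) • liftSum hE f ((1 : ℝ) + t * Complex.I)) =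
      ι₁ (∫ t : ℝ, kernelOne θ t • c ((1 : ℝ) + t * Complex.I) • hf.line_one.restrict hB₁ t) := by
    rw [← ContinuousLinearMap.integral_comp_comm _ hi₁]
    congr 1
    ext t
    rw [← Complex.coe_smul, ← Complex.coe_smul, map_smul, map_smul]
    congr 2
    refine hE.val_injective ?_
    rw [hf.val_liftSum hE (one_add_mul_I_mem_strip t)]
    rfl
  rw [e₀, e₁] at hP
  have hcθ : c θ = 1 := by simp [c]
  have hP' := congrArg hE.val hP
  rw [hcθ, one_smul, ← Complex.coe_smul, map_smul, map_add, val_inclusion, val_inclusion,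
    hf.val_liftSum hE (interior_subset (ofReal_mem_interior_strip hθ₀ hθ₁))] at hP'
  set m := (∫ t, kernelZero θ t) + ∫ t, kernelOne θ t
  set I₀ := hB₀.val (∫ t : ℝ, kernelZero θ t • c ((0 : ℝ) + t * Complex.I) •
    hf.line_zero.restrict hB₀ t)
  set I₁ := hB₁.val (∫ t : ℝ, kernelOne θ t • c ((1 : ℝ) + t * Complex.I) •
    hf.line_one.restrict hB₁ t)
  filter_upwards [hae₀, hae₁, AEEqFun.coeFn_add I₀ I₁, AEEqFun.coeFn_smul (m : ℂ) (f θ)]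
    with x h1 h2 h3 h4
  have h5 : (m : ℂ) * f θ x = I₀ x + I₁ x := by
    have h4' : ((m : ℂ) • f θ : Ω →ₘ[μ] ℂ) x = m * f θ x := h4
    rw [← h4']
    refine (congrArg (fun g : Ω →ₘ[μ] ℂ => g x) hP').symm.trans h3
  have h6 := congrArg norm h5
  rw [norm_mul, Complex.norm_real, Real.norm_of_nonneg hmpos.le] at h6
  rw [h6]
  exact (norm_add_le _ _).trans (add_le_add h1 h2)

/-- The value at `θ` of a function of `𝓕_{X₀, X₁}` is dominated by a geometric mean of functions
whose norms do not exceed those of the boundary values. -/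
theorem MemF.exists_norm_le (hN₀ : IsLatticeNorm N₀) (hN₁ : IsLatticeNorm N₁)
    (hf : MemF N₀ N₁ f) {θ : ℝ} (hθ₀ : 0 < θ) (hθ₁ : θ < 1) :
    ∃ h₀ h₁ : Ω →ₘ[μ] ℂ, N₀ h₀ ≤ ⨆ t : ℝ, N₀ (f ((0 : ℝ) + t * Complex.I)) ∧
      N₁ h₁ ≤ ⨆ t : ℝ, N₁ (f ((1 : ℝ) + t * Complex.I)) ∧
      ∀ᵐ x ∂μ, ‖f θ x‖ ≤ ‖h₀ x‖ ^ (1 - θ) * ‖h₁ x‖ ^ θ := by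
  obtain ⟨H₀, H₁, hH₀, hH₁, hb⟩ := hf.exists_kernel_bound hN₀ hN₁ hθ₀ hθ₁
  have hm := integral_kernelOne hθ₀ hθ₁
  have hmpos := integral_kernel_pos hθ₀ hθ₁
  set m₀ := ∫ t, kernelZero θ t
  set m₁ := ∫ t, kernelOne θ t
  have hpos1 : 0 < m₁ := by rw [hm]; positivity
  -- The masses are (1-θ) and θ times their sum, which produces the weights of the geometric mean
  -- once each H_j is divided by its own mass.
  have hm0 : m₀ = (1 - θ) * (m₀ + m₁) := by linarith
  have hpos0 : 0 < m₀ := by rw [hm0]; exact mul_pos (sub_pos.2 hθ₁) hmpos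
  have hscale : ∀ {N : (Ω →ₘ[μ] ℂ) → ℝ≥0∞} (_ : IsLatticeNorm N) {H : Ω →ₘ[μ] ℂ} {a : ℝ≥0∞}
      {r : ℝ}, 0 < r → N H ≤ ENNReal.ofReal r * a → N (((r⁻¹ : ℝ) : ℂ) • H) ≤ a := by
    intro N hN H a r hr h
    have hr' : ‖((r⁻¹ : ℝ) : ℂ)‖ₑ = ENNReal.ofReal r⁻¹ := by
      rw [← ofReal_norm, Complex.norm_real, Real.norm_of_nonneg (by positivity)]
    rw [hN.smul, hr']
    calc _ ≤ ENNReal.ofReal r⁻¹ * (ENNReal.ofReal r * a) := by gcongr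
      _ = a := by
        rw [← mul_assoc, ← ENNReal.ofReal_mul (by positivity), inv_mul_cancel₀ hr.ne',
          ENNReal.ofReal_one, one_mul]
  refine ⟨((m₀⁻¹ : ℝ) : ℂ) • H₀, ((m₁⁻¹ : ℝ) : ℂ) • H₁, hscale hN₀ hpos0 hH₀,
    hscale hN₁ hpos1 hH₁, ?_⟩
  have hall : ∀ᵐ x ∂μ, ∀ s : ℚ, 0 < s →
      (m₀ + m₁) * ‖f θ x‖ ≤ (s : ℝ) ^ θ * ‖H₀ x‖ + (s : ℝ) ^ (θ - 1) * ‖H₁ x‖ := by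
    refine ae_all_iff.2 fun s => ?_
    by_cases hs : 0 < s
    · filter_upwards [hb s (by exact_mod_cast hs)] with x hx _ using hx
    · exact ae_of_all _ fun x h => absurd h hs
  filter_upwards [hall, AEEqFun.coeFn_smul ((m₀⁻¹ : ℝ) : ℂ) H₀,
    AEEqFun.coeFn_smul ((m₁⁻¹ : ℝ) : ℂ) H₁] with x h1 h2 h3
  have n0 : ‖(((m₀⁻¹ : ℝ) : ℂ) • H₀ : Ω →ₘ[μ] ℂ) x‖ = m₀⁻¹ * ‖H₀ x‖ := by
    rw [h2, Pi.smul_apply, norm_smul, Complex.norm_real, Real.norm_of_nonneg (by positivity)]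
  have n1 : ‖(((m₁⁻¹ : ℝ) : ℂ) • H₁ : Ω →ₘ[μ] ℂ) x‖ = m₁⁻¹ * ‖H₁ x‖ := by
    rw [h3, Pi.smul_apply, norm_smul, Complex.norm_real, Real.norm_of_nonneg (by positivity)]
  rw [n0, n1]
  refine le_rpow_mul_rpow_of_forall_rat hθ₀ hθ₁ (by positivity) (by positivity) fun s hs => ?_
  have h4 := h1 s hs
  have e0 : (1 - θ) * m₀⁻¹ = (m₀ + m₁)⁻¹ := by
    have : 1 - θ ≠ 0 := (sub_pos.2 hθ₁).ne'
    field_simp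
    linarith
  have e1 : θ * m₁⁻¹ = (m₀ + m₁)⁻¹ := by
    field_simp
    linarith
  have e2 : (1 - θ) * ((s : ℝ) ^ θ * (m₀⁻¹ * ‖H₀ x‖)) +
      θ * ((s : ℝ) ^ (θ - 1) * (m₁⁻¹ * ‖H₁ x‖)) =
      (m₀ + m₁)⁻¹ * ((s : ℝ) ^ θ * ‖H₀ x‖ + (s : ℝ) ^ (θ - 1) * ‖H₁ x‖) := by
    rw [mul_add, ← e0]
    nth_rewrite 2 [e0]
    rw [← e1]
    ring
  rw [e2, le_inv_mul_iff₀ hmpos]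
  exact h4

end

/-! ### Scalar estimates for e^{zl} and the Gaussian factor -/

section scalar

lemma norm_exp_mul_ofReal (z : ℂ) (l : ℝ) : ‖Complex.exp (z * l)‖ = Real.exp (z.re * l) := by
  rw [Complex.norm_exp, Complex.re_mul_ofReal]

lemma exp_mul_le_one_add_exp {y : ℝ} (h0 : 0 ≤ y) (h1 : y ≤ 1) (l : ℝ) :
    Real.exp (y * l) ≤ 1 + Real.exp l := by
  rcases le_total l 0 with hl | hl
  · have : Real.exp (y * l) ≤ 1 := Real.exp_le_one_iff.2 (mul_nonpos_of_nonneg_of_nonpos h0 hl)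
    linarith [Real.exp_pos l]
  · have : Real.exp (y * l) ≤ Real.exp l := Real.exp_le_exp.2 (by nlinarith)
    linarith

/-- The product is e^{(x+r)l} or e^{(x-r)l} according to the sign of l, with exponent coefficient in
[0,1] either way. The factor e^{r|l|} is the gain available at interior points; it absorbs powers of
|l|. -/
lemma exp_mul_add_mul_abs_le {x r : ℝ} (h0 : 0 ≤ x - r) (h1 : x + r ≤ 1) (hr : 0 ≤ r) (l : ℝ) :
    Real.exp (x * l) * Real.exp (r * |l|) ≤ 1 + Real.exp l := by
  rw [← Real.exp_add]
  rcases abs_cases l with ⟨h, _⟩ | ⟨h, _⟩ <;> rw [h]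
  · rw [← add_mul]
    exact exp_mul_le_one_add_exp (by linarith) h1 l
  · rw [mul_neg, ← sub_eq_add_neg, ← sub_mul]
    exact exp_mul_le_one_add_exp h0 (by linarith) l

/-- The indicator function of `n < |l|`. -/
def tailInd (n : ℕ) (l : ℝ) : ℂ := {l : ℝ | (n : ℝ) < |l|}.indicator 1 l

lemma measurable_tailInd (n : ℕ) : Measurable (tailInd n) :=
  measurable_one.indicator (measurableSet_lt measurable_const measurable_norm)

/-- For |l| ≤ n the difference is e^{zl}(e^{(w-z)l} - 1), small uniformly in l as w → z; for |l| > n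
only the trivial bound 2b is left, and the tail indicator records it. -/
lemma norm_exp_sub_exp_le {b : ℝ} {w z : ℂ} {l : ℝ} (hw : ‖Complex.exp (w * l)‖ ≤ b)
    (hz : ‖Complex.exp (z * l)‖ ≤ b) (n : ℕ) :
    ‖Complex.exp (w * l) - Complex.exp (z * l)‖ ≤
      b * ((Real.exp (n * ‖w - z‖) - 1) + 2 * ‖tailInd n l‖) := by
  have hb : 0 ≤ b := (norm_nonneg _).trans hz
  have he : 0 ≤ Real.exp (n * ‖w - z‖) - 1 := sub_nonneg.2 (Real.one_le_exp (by positivity))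
  by_cases hl : (n : ℝ) < |l|
  · have : tailInd n l = 1 := indicator_of_mem (by exact hl) _
    rw [this, norm_one]
    have := norm_sub_le (Complex.exp (w * l)) (Complex.exp (z * l))
    nlinarith
  · have : tailInd n l = 0 := indicator_of_notMem (by exact hl) _
    rw [this, norm_zero, mul_zero, add_zero]
    have e : Complex.exp (w * l) - Complex.exp (z * l) =
        Complex.exp (z * l) * (Complex.exp ((w - z) * l) - 1) := by
      rw [mul_sub, ← Complex.exp_add, mul_one]
      congr 2
      ring
    rw [e, norm_mul]
    have h1 : ‖Complex.exp ((w - z) * l) - 1‖ ≤ Real.exp ‖(w - z) * l‖ - 1 := by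
      have := Complex.norm_exp_sub_sum_le_exp_norm_sub_sum ((w - z) * l) 1
      simpa using this
    have h2 : ‖(w - z) * (l : ℂ)‖ ≤ n * ‖w - z‖ := by
      rw [norm_mul, Complex.norm_real, mul_comm]
      exact mul_le_mul_of_nonneg_right (not_lt.1 hl) (norm_nonneg _)
    have h3 := Real.exp_le_exp.2 h2
    gcongr
    linarith

lemma exists_norm_mul_exp_le {z : ℂ} (hz : z ∈ interior strip) :
    ∃ C : ℝ, 0 ≤ C ∧ ∀ l : ℝ, ‖(l : ℂ) * Complex.exp (z * l)‖ ≤ C * (1 + Real.exp l) := by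
  rw [interior_strip] at hz
  obtain ⟨h0, h1⟩ := hz
  set r := min z.re (1 - z.re)
  have hr : 0 < r := lt_min h0 (by linarith)
  refine ⟨r⁻¹, by positivity, fun l => ?_⟩
  rw [norm_mul, norm_exp_mul_ofReal, Complex.norm_real, Real.norm_eq_abs]
  have h2 : |l| ≤ r⁻¹ * Real.exp (r * |l|) := by
    rw [le_inv_mul_iff₀ hr]
    linarith [Real.add_one_le_exp (r * |l|)]
  have h3 := exp_mul_add_mul_abs_le (x := z.re) (r := r) (by linarith [min_le_left z.re (1 - z.re)])
    (by linarith [min_le_right z.re (1 - z.re)]) hr.le l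
  calc |l| * Real.exp (z.re * l) ≤ (r⁻¹ * Real.exp (r * |l|)) * Real.exp (z.re * l) := by gcongr
    _ = r⁻¹ * (Real.exp (z.re * l) * Real.exp (r * |l|)) := by ring
    _ ≤ _ := by gcongr

lemma exists_norm_slope_exp_sub_le {z : ℂ} (hz : z ∈ interior strip) :
    ∃ C r : ℝ, 0 ≤ C ∧ 0 < r ∧ ∀ w : ℂ, w ≠ z → ‖w - z‖ ≤ r → ∀ l : ℝ,
      ‖(w - z)⁻¹ * (Complex.exp (w * l) - Complex.exp (z * l)) - l * Complex.exp (z * l)‖ ≤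
        (C * ‖w - z‖) * (1 + Real.exp l) := by
  rw [interior_strip] at hz
  obtain ⟨h0, h1⟩ := hz
  -- Half the distance to the boundary lines, because two factors e^{r|l|} have to be absorbed: one
  -- from the second order Taylor remainder, one that bounds |l|².
  set r := min z.re (1 - z.re) / 2
  have hr : 0 < r := half_pos (lt_min h0 (by linarith))
  refine ⟨2 * (r ^ 2)⁻¹, r, by positivity, hr, fun w hwz hw l => ?_⟩
  have hne : w - z ≠ 0 := sub_ne_zero.2 hwz
  set u : ℂ := (w - z) * l with hu
  have hub : ‖u‖ ≤ r * |l| := by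
    rw [hu, norm_mul, Complex.norm_real, Real.norm_eq_abs]
    gcongr
  have e : (w - z)⁻¹ * (Complex.exp (w * l) - Complex.exp (z * l)) - l * Complex.exp (z * l) =
      (w - z)⁻¹ * (Complex.exp (z * l) * (Complex.exp u - 1 - u)) := by
    have e1 : Complex.exp (w * l) = Complex.exp (z * l) * Complex.exp u := by
      rw [← Complex.exp_add, hu]; congr 1; ring
    rw [e1, hu]
    field_simp
  have hexp : ‖Complex.exp u - 1 - u‖ ≤ ‖u‖ ^ 2 * Real.exp ‖u‖ := by
    have := Complex.norm_exp_sub_sum_le_norm_mul_exp u 2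
    simpa [Finset.sum_range_succ, sub_sub] using this
  have hsq : |l| ^ 2 ≤ 2 * (r ^ 2)⁻¹ * Real.exp (r * |l|) := by
    have := Real.quadratic_le_exp_of_nonneg (x := r * |l|) (by positivity)
    rw [mul_assoc, ← div_le_iff₀' two_pos, le_inv_mul_iff₀ (by positivity)]
    nlinarith [abs_nonneg l]
  have h3 := exp_mul_add_mul_abs_le (x := z.re) (r := 2 * r)
    (by have := min_le_left z.re (1 - z.re); simp only [r]; linarith)
    (by have := min_le_right z.re (1 - z.re); simp only [r]; linarith) (by positivity) l
  have hn : ‖w - z‖ ≠ 0 := norm_ne_zero_iff.2 hne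
  rw [e, norm_mul, norm_mul, norm_inv, norm_exp_mul_ofReal]
  calc ‖w - z‖⁻¹ * (Real.exp (z.re * l) * ‖Complex.exp u - 1 - u‖)
      ≤ ‖w - z‖⁻¹ * (Real.exp (z.re * l) * (‖u‖ ^ 2 * Real.exp (r * |l|))) := by
        gcongr
        exact hexp.trans (by gcongr)
    _ = ‖w - z‖ * (Real.exp (z.re * l) * (|l| ^ 2 * Real.exp (r * |l|))) := by
        rw [hu, norm_mul, Complex.norm_real, Real.norm_eq_abs]
        field_simp
    _ ≤ ‖w - z‖ * (Real.exp (z.re * l) *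
        ((2 * (r ^ 2)⁻¹ * Real.exp (r * |l|)) * Real.exp (r * |l|))) := by gcongr
    _ = (2 * (r ^ 2)⁻¹ * ‖w - z‖) * (Real.exp (z.re * l) * Real.exp (2 * r * |l|)) := by
        rw [show 2 * r * |l| = r * |l| + r * |l| by ring, Real.exp_add]; ring
    _ ≤ _ := by gcongr

/-- The Gaussian factor that makes functions on the strip vanish at infinity. -/
def gaussFactor (δ θ : ℝ) (z : ℂ) : ℂ := Complex.exp (δ * (z ^ 2 - θ ^ 2))

lemma differentiable_gaussFactor (δ θ : ℝ) : Differentiable ℂ (gaussFactor δ θ) := by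
  unfold gaussFactor; fun_prop

lemma norm_gaussFactor_le {δ : ℝ} (hδ : 0 < δ) (θ : ℝ) (z : ℂ) :
    ‖gaussFactor δ θ z‖ ≤ Real.exp (δ * z.re ^ 2) * Real.exp (-(δ * z.im ^ 2)) := by
  rw [gaussFactor, Complex.norm_exp, ← Real.exp_add, Complex.re_ofReal_mul]
  refine Real.exp_le_exp.2 ?_
  have e : (z ^ 2 - (θ : ℂ) ^ 2).re = z.re ^ 2 - z.im ^ 2 - θ ^ 2 := by
    simp [sq]
  rw [e]
  nlinarith [mul_nonneg hδ.le (sq_nonneg θ)]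

end scalar

/-! ### Continuity and differentiability with respect to extended norms -/

section

variable {V : Type*} [AddCommGroup V] [Module ℂ V] {N : V → ℝ≥0∞} {k : ℂ → V} {q : ℂ → ℂ} {z : ℂ}

lemma tendsto_norm_smul_sub (hN : IsBanachNorm N) {l : Filter ℂ}
    (hq : Tendsto q l (𝓝 (q z))) (hk : Tendsto (fun w => N (k w - k z)) l (𝓝 0))
    (hz : N (k z) < ∞) : Tendsto (fun w => N (q w • k w - q z • k z)) l (𝓝 0) := by
  have hlim : Tendsto (fun w => ‖q w‖ₑ * N (k w - k z) + ‖q w - q z‖ₑ * N (k z)) l (𝓝 0) := by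
    have h1 := ENNReal.Tendsto.mul hq.enorm (Or.inr ENNReal.zero_ne_top) hk (Or.inr enorm_ne_top)
    have h2 : Tendsto (fun w => ‖q w - q z‖ₑ) l (𝓝 0) := by
      have := (hq.sub_const (q z)).enorm
      rwa [sub_self, enorm_zero] at this
    have h3 := ENNReal.Tendsto.mul_const h2 (Or.inr hz.ne)
    have := h1.add h3
    rwa [mul_zero, zero_mul, add_zero] at this
  refine tendsto_of_tendsto_of_tendsto_of_le_of_le tendsto_const_nhds hlim
    (fun _ => zero_le) fun w => ?_
  have e : q w • k w - q z • k z = q w • (k w - k z) + (q w - q z) • k z := by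
    rw [smul_sub, sub_smul]; abel
  change N (q w • k w - q z • k z) ≤ _
  rw [e]
  refine (hN.add_le _ _).trans_eq ?_
  rw [hN.smul, hN.smul]

lemma tendsto_norm_slope_smul_sub (hN : IsBanachNorm N) {q' : ℂ} {d : V}
    (hq : HasDerivAt q q' z)
    (hk : Tendsto (fun w => N ((w - z)⁻¹ • (k w - k z) - d)) (𝓝[≠] z) (𝓝 0))
    (hz : N (k z) < ∞) (hd : N d < ∞) :
    Tendsto (fun w => N ((w - z)⁻¹ • (q w • k w - q z • k z) - (q' • k z + q z • d)))
      (𝓝[≠] z) (𝓝 0) := by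
  have hqc : Tendsto q (𝓝[≠] z) (𝓝 (q z)) := hq.continuousAt.tendsto.mono_left nhdsWithin_le_nhds
  have hqs : Tendsto (fun w => ‖(w - z)⁻¹ * (q w - q z) - q'‖ₑ) (𝓝[≠] z) (𝓝 0) := by
    have := ((hasDerivAt_iff_tendsto_slope.1 hq).sub_const q').enorm
    rw [sub_self, enorm_zero] at this
    refine this.congr fun w => ?_
    rw [slope_def_module, smul_eq_mul]
  have hlim : Tendsto (fun w => ‖q w‖ₑ * N ((w - z)⁻¹ • (k w - k z) - d) + (‖q w - q z‖ₑ * N d +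
      ‖(w - z)⁻¹ * (q w - q z) - q'‖ₑ * N (k z))) (𝓝[≠] z) (𝓝 0) := by
    have h1 := ENNReal.Tendsto.mul hqc.enorm (Or.inr ENNReal.zero_ne_top) hk (Or.inr enorm_ne_top)
    have h2 : Tendsto (fun w => ‖q w - q z‖ₑ) (𝓝[≠] z) (𝓝 0) := by
      have := (hqc.sub_const (q z)).enorm
      rwa [sub_self, enorm_zero] at this
    have h3 := ENNReal.Tendsto.mul_const h2 (Or.inr hd.ne)
    have h4 := ENNReal.Tendsto.mul_const hqs (Or.inr hz.ne)
    have := h1.add (h3.add h4)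
    rwa [mul_zero, zero_mul, zero_mul, add_zero, add_zero] at this
  refine tendsto_of_tendsto_of_tendsto_of_le_of_le tendsto_const_nhds hlim
    (fun _ => zero_le) fun w => ?_
  have e : (w - z)⁻¹ • (q w • k w - q z • k z) - (q' • k z + q z • d) =
      q w • ((w - z)⁻¹ • (k w - k z) - d) + ((q w - q z) • d +
        ((w - z)⁻¹ * (q w - q z) - q') • k z) := by
    module
  change N ((w - z)⁻¹ • (q w • k w - q z • k z) - (q' • k z + q z • d)) ≤ _
  rw [e]
  refine (hN.add_le _ _).trans ?_
  rw [hN.smul]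
  gcongr
  refine (hN.add_le _ _).trans_eq ?_
  rw [hN.smul, hN.smul]

-- First n is fixed so that the tail term is below ε/2; for this n the exponential term tends to
-- zero as w → z.
omit [Module ℂ V] in
lemma tendsto_zero_of_le_exp {S : Set ℂ} {M : ℝ≥0∞} {τ : ℕ → ℝ≥0∞} (hM : M < ∞)
    (hτ : Tendsto τ atTop (𝓝 0))
    (h : ∀ w ∈ S, ∀ n : ℕ,
      N (k w - k z) ≤ ENNReal.ofReal (Real.exp (n * ‖w - z‖) - 1) * M + 2 * τ n) :
    Tendsto (fun w => N (k w - k z)) (𝓝[S] z) (𝓝 0) := by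
  refine ENNReal.tendsto_nhds_zero.2 fun ε hε => ?_
  have h2 : Tendsto (fun n => 2 * τ n) atTop (𝓝 0) := by
    have := ENNReal.Tendsto.const_mul (a := 2) hτ (Or.inr (by simp))
    rwa [mul_zero] at this
  obtain ⟨n, hn⟩ := ((ENNReal.tendsto_nhds_zero.1 h2) (ε / 2) (ENNReal.half_pos hε.ne')).exists
  have h1 : Tendsto (fun w : ℂ => ENNReal.ofReal (Real.exp (n * ‖w - z‖) - 1) * M) (𝓝[S] z)
      (𝓝 0) := by
    have hc : Continuous fun w : ℂ => ENNReal.ofReal (Real.exp (n * ‖w - z‖) - 1) :=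
      ENNReal.continuous_ofReal.comp (by fun_prop)
    have := (hc.tendsto z).mono_left (nhdsWithin_le_nhds (s := S))
    simp only [sub_self, norm_zero, mul_zero, Real.exp_zero, ENNReal.ofReal_zero] at this
    have h3 := ENNReal.Tendsto.mul_const this (Or.inr hM.ne)
    rwa [zero_mul] at h3
  filter_upwards [(ENNReal.tendsto_nhds_zero.1 h1) (ε / 2) (ENNReal.half_pos hε.ne'),
    self_mem_nhdsWithin] with w hw hwS
  exact (h w hwS n).trans ((add_le_add hw hn).trans_eq (ENNReal.add_halves ε))

end

/-! ### The analytic families φ e^{zL} -/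

variable {Ω : Type*} [MeasurableSpace Ω] {μ : Measure Ω} {φ : Ω → ℂ} {L : Ω → ℝ}

/-- The class of the function `φ · w(L)`. -/
def weighted (μ : Measure Ω) (hφ : Measurable φ) (hL : Measurable L) {w : ℝ → ℂ}
    (hw : Measurable w) : Ω →ₘ[μ] ℂ :=
  classOf μ (fun x => φ x * w (L x)) (hφ.mul (hw.comp hL))

lemma coeFn_weighted (hφ : Measurable φ) (hL : Measurable L) {w : ℝ → ℂ} (hw : Measurable w) :
    weighted μ hφ hL hw =ᵐ[μ] fun x => φ x * w (L x) :=
  coeFn_classOf _ _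

lemma measurable_exp_mul_ofReal (z : ℂ) : Measurable fun l : ℝ => Complex.exp (z * l) := by
  fun_prop

section bounds

variable (hφ : Measurable φ) (hL : Measurable L) {N N₀ N₁ : (Ω →ₘ[μ] ℂ) → ℝ≥0∞}

/-- The analytic family `φ · e^{z L}`. -/
def expFamily (μ : Measure Ω) (z : ℂ) : Ω →ₘ[μ] ℂ :=
  weighted μ hφ hL (measurable_exp_mul_ofReal z)

/-- The part of `φ · e^{z L}` where `n < |L|`. -/
def expTail (μ : Measure Ω) (z : ℂ) (n : ℕ) : Ω →ₘ[μ] ℂ :=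
  weighted μ hφ hL ((measurable_exp_mul_ofReal z).mul (measurable_tailInd n))

lemma nrm_le_expFamily_add (hN : IsLatticeNorm N) {g : Ω →ₘ[μ] ℂ} {j : ℂ} {c : ℝ} (hc : 0 ≤ c)
    (n : ℕ) (h : ∀ᵐ x ∂μ, ‖g x‖ ≤ ‖φ x‖ *
      (Real.exp (j.re * L x) * (c + 2 * ‖tailInd n (L x)‖))) :
    N g ≤ ENNReal.ofReal c * N (expFamily hφ hL μ j) + 2 * N (expTail hφ hL μ j n) := by
  have ec : ENNReal.ofReal c = ‖(c : ℂ)‖ₑ := by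
    rw [← ofReal_norm, Complex.norm_real, Real.norm_of_nonneg hc]
  have e2 : (2 : ℝ≥0∞) = ‖(2 : ℂ)‖ₑ := by
    rw [← ofReal_norm, Complex.norm_two]; simp
  rw [ec, e2, ← hN.smul, ← hN.smul]
  refine hN.le_add ?_
  filter_upwards [h, AEEqFun.coeFn_smul (c : ℂ) (expFamily hφ hL μ j),
    AEEqFun.coeFn_smul (2 : ℂ) (expTail hφ hL μ j n),
    coeFn_weighted hφ hL (measurable_exp_mul_ofReal j),
    coeFn_weighted hφ hL ((measurable_exp_mul_ofReal j).mul (measurable_tailInd n))]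
    with x h1 h2 h3 h4 h5
  have h4' : expFamily hφ hL μ j x = φ x * Complex.exp (j * L x) := h4
  have h5' : expTail hφ hL μ j n x = φ x * (Complex.exp (j * L x) * tailInd n (L x)) := h5
  rw [h2, h3, Pi.smul_apply, Pi.smul_apply, h4', h5', norm_smul, norm_smul, norm_mul, norm_mul,
    norm_mul, norm_exp_mul_ofReal, Complex.norm_real, Real.norm_of_nonneg hc, Complex.norm_two]
  refine h1.trans_eq ?_
  ring

/-- The two terms of 1 + e^L are handled separately: the one with |φ| is measured in X_0, the one
with |φ|e^L in X_1. -/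
lemma sumNorm_le_expFamily_add (hN₀ : IsLatticeNorm N₀) (hN₁ : IsLatticeNorm N₁)
    {g : Ω →ₘ[μ] ℂ} {c : ℝ} (hc : 0 ≤ c) (n : ℕ)
    (h : ∀ᵐ x ∂μ, ‖g x‖ ≤ ‖φ x‖ * ((1 + Real.exp (L x)) * (c + 2 * ‖tailInd n (L x)‖))) :
    sumNorm N₀ N₁ g ≤
      ENNReal.ofReal c * (N₀ (expFamily hφ hL μ 0) + N₁ (expFamily hφ hL μ 1)) +
        2 * (N₀ (expTail hφ hL μ 0 n) + N₁ (expTail hφ hL μ 1 n)) := by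
  have hm : ∀ j : ℂ, Measurable fun l : ℝ => Complex.exp (j * l) *
      ((c + 2 * ‖tailInd n l‖ : ℝ) : ℂ) := fun j =>
    (measurable_exp_mul_ofReal j).mul (Complex.measurable_ofReal.comp
      (((measurable_tailInd n).norm.const_mul 2).const_add c))
  have hnorm : ∀ j : ℂ, ∀ᵐ x ∂μ, ‖weighted μ hφ hL (hm j) x‖ =
      ‖φ x‖ * (Real.exp (j.re * L x) * (c + 2 * ‖tailInd n (L x)‖)) := fun j => by
    filter_upwards [coeFn_weighted hφ hL (hm j)] with x hx
    rw [hx, norm_mul, norm_mul, norm_exp_mul_ofReal, Complex.norm_real,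
      Real.norm_of_nonneg (by positivity)]
  refine (sumNorm_le_of_norm_le_add hN₀ hN₁ (G₀ := weighted μ hφ hL (hm 0))
    (G₁ := weighted μ hφ hL (hm 1)) ?_).trans ((add_le_add
      (nrm_le_expFamily_add hφ hL hN₀ hc n ((hnorm 0).mono fun x hx => hx.le))
      (nrm_le_expFamily_add hφ hL hN₁ hc n ((hnorm 1).mono fun x hx => hx.le))).trans_eq ?_)
  · filter_upwards [h, hnorm 0, hnorm 1] with x h1 h2 h3
    rw [h2, h3]
    refine h1.trans_eq ?_
    simp only [Complex.zero_re, zero_mul, Real.exp_zero, Complex.one_re, one_mul]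
    ring
  · ring

lemma coeFn_expFamily_sub (w z : ℂ) :
    ∀ᵐ x ∂μ, (expFamily hφ hL μ w - expFamily hφ hL μ z : Ω →ₘ[μ] ℂ) x =
      φ x * (Complex.exp (w * L x) - Complex.exp (z * L x)) := by
  filter_upwards [AEEqFun.coeFn_sub (expFamily hφ hL μ w) (expFamily hφ hL μ z),
    coeFn_weighted hφ hL (measurable_exp_mul_ofReal w),
    coeFn_weighted hφ hL (measurable_exp_mul_ofReal z)] with x h1 h2 h3
  rw [h1, Pi.sub_apply, expFamily, expFamily, h2, h3, mul_sub]

lemma nrm_expFamily_sub_le (hN : IsLatticeNorm N) {w z j : ℂ} (hw : w.re = j.re)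
    (hz : z.re = j.re) (n : ℕ) :
    N (expFamily hφ hL μ w - expFamily hφ hL μ z) ≤
      ENNReal.ofReal (Real.exp (n * ‖w - z‖) - 1) * N (expFamily hφ hL μ j) +
        2 * N (expTail hφ hL μ j n) := by
  refine nrm_le_expFamily_add hφ hL hN (sub_nonneg.2 (Real.one_le_exp (by positivity))) n ?_
  filter_upwards [coeFn_expFamily_sub hφ hL w z] with x hx
  rw [hx, norm_mul]
  gcongr
  exact norm_exp_sub_exp_le (by rw [norm_exp_mul_ofReal, hw]) (by rw [norm_exp_mul_ofReal, hz]) n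

lemma sumNorm_expFamily_sub_le (hN₀ : IsLatticeNorm N₀) (hN₁ : IsLatticeNorm N₁) {w z : ℂ}
    (hw : w ∈ strip) (hz : z ∈ strip) (n : ℕ) :
    sumNorm N₀ N₁ (expFamily hφ hL μ w - expFamily hφ hL μ z) ≤
      ENNReal.ofReal (Real.exp (n * ‖w - z‖) - 1) *
        (N₀ (expFamily hφ hL μ 0) + N₁ (expFamily hφ hL μ 1)) +
        2 * (N₀ (expTail hφ hL μ 0 n) + N₁ (expTail hφ hL μ 1 n)) := by
  refine sumNorm_le_expFamily_add hφ hL hN₀ hN₁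
    (sub_nonneg.2 (Real.one_le_exp (by positivity))) n ?_
  filter_upwards [coeFn_expFamily_sub hφ hL w z] with x hx
  rw [hx, norm_mul]
  gcongr
  exact norm_exp_sub_exp_le (by rw [norm_exp_mul_ofReal]; exact exp_mul_le_one_add_exp hw.1 hw.2 _)
    (by rw [norm_exp_mul_ofReal]; exact exp_mul_le_one_add_exp hz.1 hz.2 _) n

lemma sumNorm_le_const_mul (hN₀ : IsLatticeNorm N₀) (hN₁ : IsLatticeNorm N₁)
    {g : Ω →ₘ[μ] ℂ} {c : ℝ} (hc : 0 ≤ c)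
    (h : ∀ᵐ x ∂μ, ‖g x‖ ≤ ‖φ x‖ * (c * (1 + Real.exp (L x)))) :
    sumNorm N₀ N₁ g ≤
      ENNReal.ofReal c * (N₀ (expFamily hφ hL μ 0) + N₁ (expFamily hφ hL μ 1)) := by
  have ec : ENNReal.ofReal c = ‖(c : ℂ)‖ₑ := by
    rw [← ofReal_norm, Complex.norm_real, Real.norm_of_nonneg hc]
  rw [mul_add, ec, ← hN₀.smul, ← hN₁.smul]
  refine sumNorm_le_of_norm_le_add hN₀ hN₁ ?_
  filter_upwards [h, AEEqFun.coeFn_smul (c : ℂ) (expFamily hφ hL μ 0),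
    AEEqFun.coeFn_smul (c : ℂ) (expFamily hφ hL μ 1),
    coeFn_weighted hφ hL (measurable_exp_mul_ofReal 0),
    coeFn_weighted hφ hL (measurable_exp_mul_ofReal 1)] with x h1 h2 h3 h4 h5
  rw [h2, h3, Pi.smul_apply, Pi.smul_apply, expFamily, expFamily, h4, h5, norm_smul, norm_smul,
    norm_mul, norm_mul, norm_exp_mul_ofReal, norm_exp_mul_ofReal, Complex.norm_real,
    Real.norm_of_nonneg hc, Complex.zero_re, zero_mul, Real.exp_zero, Complex.one_re, one_mul]
  refine h1.trans_eq ?_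
  ring

lemma sumNorm_expFamily_le (hN₀ : IsLatticeNorm N₀) (hN₁ : IsLatticeNorm N₁) {z : ℂ}
    (hz : z ∈ strip) :
    sumNorm N₀ N₁ (expFamily hφ hL μ z) ≤
      N₀ (expFamily hφ hL μ 0) + N₁ (expFamily hφ hL μ 1) := by
  refine (sumNorm_le_const_mul hφ hL hN₀ hN₁ zero_le_one ?_).trans_eq (by simp)
  filter_upwards [coeFn_weighted hφ hL (measurable_exp_mul_ofReal z)] with x hx
  rw [expFamily, hx, norm_mul, norm_exp_mul_ofReal, one_mul]
  gcongr
  exact exp_mul_le_one_add_exp hz.1 hz.2 _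

lemma nrm_expFamily_congr_re (hN : IsLatticeNorm N) {z j : ℂ} (hz : z.re = j.re) :
    N (expFamily hφ hL μ z) = N (expFamily hφ hL μ j) := by
  refine hN.congr_norm ?_
  filter_upwards [coeFn_weighted hφ hL (measurable_exp_mul_ofReal z),
    coeFn_weighted hφ hL (measurable_exp_mul_ofReal j)] with x h1 h2
  rw [expFamily, expFamily, h1, h2, norm_mul, norm_mul, norm_exp_mul_ofReal, norm_exp_mul_ofReal,
    hz]

/-- In the interior no tail condition is needed: the derivative φ L e^{zL} and the error of the
difference quotients are bounded by multiples of |φ|(1 + e^L), the latter with a factor proportional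
to |w - z|. -/
lemma exists_tendsto_slope_expFamily (hN₀ : IsLatticeNorm N₀) (hN₁ : IsLatticeNorm N₁)
    (h₀ : N₀ (expFamily hφ hL μ 0) < ∞) (h₁ : N₁ (expFamily hφ hL μ 1) < ∞)
    {z : ℂ} (hz : z ∈ interior strip) :
    ∃ d : Ω →ₘ[μ] ℂ, sumNorm N₀ N₁ d < ∞ ∧
      Tendsto (fun w => sumNorm N₀ N₁
        ((w - z)⁻¹ • (expFamily hφ hL μ w - expFamily hφ hL μ z) - d)) (𝓝[≠] z) (𝓝 0) := by
  have hM : N₀ (expFamily hφ hL μ 0) + N₁ (expFamily hφ hL μ 1) < ∞ := ENNReal.add_lt_top.2 ⟨h₀, h₁⟩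
  have hdm : Measurable fun l : ℝ => (l : ℂ) * Complex.exp (z * l) :=
    Complex.measurable_ofReal.mul (measurable_exp_mul_ofReal z)
  refine ⟨weighted μ hφ hL hdm, ?_, ?_⟩
  · obtain ⟨C, hC, hb⟩ := exists_norm_mul_exp_le hz
    refine (sumNorm_le_const_mul hφ hL hN₀ hN₁ hC ?_).trans_lt
      (ENNReal.mul_lt_top ENNReal.ofReal_lt_top hM)
    filter_upwards [coeFn_weighted hφ hL hdm] with x hx
    rw [hx, norm_mul]
    gcongr
    exact hb _
  · obtain ⟨C, r, hC, hr, hb⟩ := exists_norm_slope_exp_sub_le hz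
    have hlim : Tendsto (fun w : ℂ => ENNReal.ofReal (C * ‖w - z‖) *
        (N₀ (expFamily hφ hL μ 0) + N₁ (expFamily hφ hL μ 1))) (𝓝[≠] z) (𝓝 0) := by
      have hc : Continuous fun w : ℂ => ENNReal.ofReal (C * ‖w - z‖) :=
        ENNReal.continuous_ofReal.comp (by fun_prop)
      have := (hc.tendsto z).mono_left (nhdsWithin_le_nhds (s := {z}ᶜ))
      rw [sub_self, norm_zero, mul_zero, ENNReal.ofReal_zero] at this
      have h3 := ENNReal.Tendsto.mul_const this (Or.inr hM.ne)
      rwa [zero_mul] at h3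
    refine tendsto_of_tendsto_of_tendsto_of_le_of_le' tendsto_const_nhds hlim
      (Eventually.of_forall fun _ => zero_le) ?_
    filter_upwards [self_mem_nhdsWithin, mem_nhdsWithin_of_mem_nhds
      (Metric.closedBall_mem_nhds z hr)] with w hw hwr
    rw [mem_closedBall_iff_norm] at hwr
    refine sumNorm_le_const_mul hφ hL hN₀ hN₁ (by positivity) ?_
    filter_upwards [coeFn_expFamily_sub hφ hL w z, coeFn_weighted hφ hL hdm,
      AEEqFun.coeFn_smul (w - z)⁻¹ (expFamily hφ hL μ w - expFamily hφ hL μ z),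
      AEEqFun.coeFn_sub ((w - z)⁻¹ • (expFamily hφ hL μ w - expFamily hφ hL μ z))
        (weighted μ hφ hL hdm)] with x g1 g2 g3 g4
    have e : ((w - z)⁻¹ • (expFamily hφ hL μ w - expFamily hφ hL μ z) - weighted μ hφ hL hdm :
        Ω →ₘ[μ] ℂ) x = φ x * ((w - z)⁻¹ * (Complex.exp (w * L x) - Complex.exp (z * L x)) -
          L x * Complex.exp (z * L x)) := by
      refine g4.trans ?_
      rw [Pi.sub_apply, g3, Pi.smul_apply, g1, g2, smul_eq_mul]
      ring
    refine (congrArg norm e).trans_le ?_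
    rw [norm_mul]
    gcongr
    exact hb w hw hwr _

end bounds

variable {N N₀ N₁ : (Ω →ₘ[μ] ℂ) → ℝ≥0∞}

/-- On a vertical line |φ e^{zL}| does not vary, so decay must come from the Gaussian factor, and
continuity from the vanishing tails. -/
lemma isC0OnLine_gauss_smul_expFamily (hφ : Measurable φ) (hL : Measurable L)
    (hN : IsLatticeNorm N) {δ : ℝ} (hδ : 0 < δ) (θ : ℝ) (j : ℝ)
    (h : N (expFamily hφ hL μ j) < ∞)
    (ht : Tendsto (fun n => N (expTail hφ hL μ j n)) atTop (𝓝 0)) :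
    IsC0OnLine N (fun z => gaussFactor δ θ z • expFamily hφ hL μ z) j := by
  have hB := hN.isBanachNorm
  have hre : ∀ t : ℝ, ((j : ℂ) + t * Complex.I).re = (j : ℂ).re := fun t => by simp
  have hlt : ∀ t : ℝ, N (expFamily hφ hL μ (j + t * Complex.I)) = N (expFamily hφ hL μ j) :=
    fun t => nrm_expFamily_congr_re hφ hL hN (hre t)
  have hsm : ∀ t : ℝ, N (gaussFactor δ θ (j + t * Complex.I) • expFamily hφ hL μ
      (j + t * Complex.I)) ≤ ENNReal.ofReal (Real.exp (δ * j ^ 2) * Real.exp (-(δ * t ^ 2))) *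
        N (expFamily hφ hL μ j) := fun t => by
    refine (hB.smul _ _).trans_le ?_
    rw [hlt]
    gcongr
    rw [← ofReal_norm]
    refine ENNReal.ofReal_le_ofReal ((norm_gaussFactor_le hδ θ _).trans_eq ?_)
    simp
  refine ⟨fun t => (hsm t).trans_lt (ENNReal.mul_lt_top ENNReal.ofReal_lt_top h), fun t => ?_, ?_⟩
  · have hk : Tendsto (fun w => N (expFamily hφ hL μ w - expFamily hφ hL μ (j + t * Complex.I)))
        (𝓝[{w | w.re = (j : ℂ).re}] (j + t * Complex.I)) (𝓝 0) :=
      tendsto_zero_of_le_exp h ht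
        fun w hw n => nrm_expFamily_sub_le hφ hL hN hw (hre t) n
    have hline : Tendsto (fun s : ℝ => (j : ℂ) + s * Complex.I) (𝓝 t)
        (𝓝[{w | w.re = (j : ℂ).re}] (j + t * Complex.I)) := by
      refine tendsto_nhdsWithin_iff.2 ⟨?_, Eventually.of_forall hre⟩
      exact (by fun_prop : Continuous fun s : ℝ => (j : ℂ) + s * Complex.I).tendsto t
    have := tendsto_norm_smul_sub hB (q := gaussFactor δ θ)
      (((differentiable_gaussFactor δ θ).continuous.tendsto _).mono_left nhdsWithin_le_nhds) hk
      (by rw [hlt]; exact h)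
    exact this.comp hline
  · have hsq : Tendsto (fun t : ℝ => δ * t ^ 2) (cocompact ℝ) atTop := by
      refine Tendsto.const_mul_atTop hδ ?_
      have := (tendsto_pow_atTop (α := ℝ) two_ne_zero).comp (tendsto_norm_cocompact_atTop (E := ℝ))
      refine this.congr fun t => ?_
      simp
    have h1 : Tendsto (fun t : ℝ => ENNReal.ofReal
        (Real.exp (δ * j ^ 2) * Real.exp (-(δ * t ^ 2)))) (cocompact ℝ) (𝓝 0) := by
      have := (Real.tendsto_exp_neg_atTop_nhds_zero.comp hsq).const_mul (Real.exp (δ * j ^ 2))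
      rw [mul_zero] at this
      have h2 := (ENNReal.continuous_ofReal.tendsto 0).comp this
      rwa [ENNReal.ofReal_zero] at h2
    have h2 := ENNReal.Tendsto.mul_const h1 (Or.inr h.ne)
    rw [zero_mul] at h2
    exact tendsto_of_tendsto_of_tendsto_of_le_of_le tendsto_const_nhds h2 (fun _ => zero_le) hsm

/-- Boundedness and analyticity follow from finiteness of the two endpoint norms; the tail
hypotheses serve the continuity up to the boundary, both in X_0 + X_1 and along the two lines. -/
theorem memF_gauss_smul_expFamily (hφ : Measurable φ) (hL : Measurable L)
    (hN₀ : IsLatticeNorm N₀) (hN₁ : IsLatticeNorm N₁) {δ : ℝ} (hδ : 0 < δ) (θ : ℝ)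
    (h₀ : N₀ (expFamily hφ hL μ 0) < ∞) (h₁ : N₁ (expFamily hφ hL μ 1) < ∞)
    (ht₀ : Tendsto (fun n => N₀ (expTail hφ hL μ 0 n)) atTop (𝓝 0))
    (ht₁ : Tendsto (fun n => N₁ (expTail hφ hL μ 1 n)) atTop (𝓝 0)) :
    MemF N₀ N₁ (fun z => gaussFactor δ θ z • expFamily hφ hL μ z) := by
  have hE := isBanachNorm_sumNorm hN₀ hN₁
  have hM : N₀ (expFamily hφ hL μ 0) + N₁ (expFamily hφ hL μ 1) < ∞ := ENNReal.add_lt_top.2 ⟨h₀, h₁⟩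
  have hlt : ∀ z ∈ strip, sumNorm N₀ N₁ (expFamily hφ hL μ z) < ∞ := fun z hz =>
    (sumNorm_expFamily_le hφ hL hN₀ hN₁ hz).trans_lt hM
  refine ⟨?_, fun z hz => ?_, fun z hz => ?_, ?_, ?_⟩
  · have hC : ENNReal.ofReal (Real.exp δ) *
        (N₀ (expFamily hφ hL μ 0) + N₁ (expFamily hφ hL μ 1)) < ∞ :=
      ENNReal.mul_lt_top ENNReal.ofReal_lt_top hM
    refine ⟨_, fun z hz => le_of_le_of_eq ?_ (ENNReal.coe_toNNReal hC.ne).symm⟩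
    refine (hE.smul _ _).trans_le (mul_le_mul' ?_ (sumNorm_expFamily_le hφ hL hN₀ hN₁ hz))
    rw [← ofReal_norm]
    refine ENNReal.ofReal_le_ofReal ((norm_gaussFactor_le hδ θ z).trans ?_)
    rw [← Real.exp_add]
    refine Real.exp_le_exp.2 ?_
    have : z.re ^ 2 ≤ 1 := by nlinarith [hz.1, hz.2]
    nlinarith [mul_nonneg hδ.le (sq_nonneg z.im)]
  · refine tendsto_norm_smul_sub hE (q := gaussFactor δ θ)
      (((differentiable_gaussFactor δ θ).continuous.tendsto _).mono_left nhdsWithin_le_nhds) ?_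
      (hlt z hz)
    have hτ := ht₀.add ht₁
    rw [add_zero] at hτ
    exact tendsto_zero_of_le_exp hM hτ
      fun w hw n => sumNorm_expFamily_sub_le hφ hL hN₀ hN₁ hw hz n
  · obtain ⟨d, hd, hlim⟩ := exists_tendsto_slope_expFamily hφ hL hN₀ hN₁ h₀ h₁ hz
    exact ⟨_, tendsto_norm_slope_smul_sub hE (differentiable_gaussFactor δ θ z).hasDerivAt hlim
      (hlt z (interior_subset hz)) hd⟩
  · exact isC0OnLine_gauss_smul_expFamily hφ hL hN₀ hδ θ 0 (by simpa using h₀) (by simpa using ht₀)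
  · exact isC0OnLine_gauss_smul_expFamily hφ hL hN₁ hδ θ 1 (by simpa using h₁) (by simpa using ht₁)

theorem normF_gauss_smul_expFamily_le (hφ : Measurable φ) (hL : Measurable L)
    (hN₀ : IsLatticeNorm N₀) (hN₁ : IsLatticeNorm N₁) {δ : ℝ} (hδ : 0 < δ) (θ : ℝ)
    {c : ℝ≥0∞} (h₀ : N₀ (expFamily hφ hL μ 0) ≤ c) (h₁ : N₁ (expFamily hφ hL μ 1) ≤ c) :
    normF N₀ N₁ (fun z => gaussFactor δ θ z • expFamily hφ hL μ z) ≤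
      ENNReal.ofReal (Real.exp δ) * c := by
  have key : ∀ {N : (Ω →ₘ[μ] ℂ) → ℝ≥0∞} (_ : IsLatticeNorm N) (j : ℝ) (t : ℝ), |j| ≤ 1 →
      N (expFamily hφ hL μ j) ≤ c → N (gaussFactor δ θ (j + t * Complex.I) •
        expFamily hφ hL μ (j + t * Complex.I)) ≤ ENNReal.ofReal (Real.exp δ) * c := by
    intro N hN j t hj h
    refine (hN.isBanachNorm.smul _ _).trans_le (mul_le_mul' ?_ ?_)
    · rw [← ofReal_norm]
      refine ENNReal.ofReal_le_ofReal ((norm_gaussFactor_le hδ θ _).trans ?_)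
      rw [← Real.exp_add]
      refine Real.exp_le_exp.2 ?_
      have e : ((j : ℂ) + t * Complex.I).re = j := by simp
      rw [e]
      have : j ^ 2 ≤ 1 := by rw [← sq_abs]; nlinarith [abs_nonneg j]
      nlinarith [mul_nonneg hδ.le (sq_nonneg ((j : ℂ) + t * Complex.I).im)]
    · rw [nrm_expFamily_congr_re hφ hL hN (j := j) (by simp)]
      exact h
  exact iSup_le fun t => max_le (key hN₀ 0 t (by simp) (by simpa using h₀))
    (key hN₁ 1 t (by simp) (by simpa using h₁))

end ComplexInterp

/-! ### Order continuity and the perturbation of the two factors -/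

open ComplexInterp

section

variable {Ω : Type*} [MeasurableSpace Ω] {μ : Measure Ω} {N : (Ω →ₘ[μ] ℂ) → ℝ≥0∞}

/-- The functions |φ| 1_{|L| > n} are nonincreasing in n and eventually zero at every point, because
L is finite. -/
lemma OrderContinuousNorm.tendsto_expTail (hoc : OrderContinuousNorm N) (hN : IsLatticeNorm N)
    {φ : Ω → ℂ} {L : Ω → ℝ} (hφ : Measurable φ) (hL : Measurable L)
    (h : N (expFamily hφ hL μ 0) < ∞) :
    Tendsto (fun n => N (expTail hφ hL μ 0 n)) atTop (𝓝 0) := by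
  have hm : ∀ n, Measurable fun x => ((‖φ x‖ : ℝ) : ℂ) * tailInd n (L x) := fun n =>
    (Complex.measurable_ofReal.comp hφ.norm).mul ((measurable_tailInd n).comp hL)
  have hcongr : ∀ n, N (expTail hφ hL μ 0 n) = N (classOf μ _ (hm n)) := fun n => hN.congr_norm (by
    filter_upwards [coeFn_classOf _ (hm n),
      coeFn_weighted hφ hL ((measurable_exp_mul_ofReal 0).mul (measurable_tailInd n))] with x h1 h2
    rw [expTail, h1, h2]
    simp)
  have hval : ∀ n x, ((‖φ x‖ : ℝ) : ℂ) * tailInd n (L x) =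
      ((if (n : ℝ) < |L x| then ‖φ x‖ else 0 : ℝ) : ℂ) := fun n x => by
    by_cases hx : (n : ℝ) < |L x|
    · rw [if_pos hx, tailInd, indicator_of_mem (by exact hx), Pi.one_apply, mul_one]
    · rw [if_neg hx, tailInd, indicator_of_notMem (by exact hx), mul_zero, Complex.ofReal_zero]
  simp_rw [hcongr]
  refine hoc _ (fun n => lt_of_le_of_lt (hN.mono ?_) h) ?_
  · filter_upwards [coeFn_classOf _ (hm n),
      coeFn_weighted hφ hL (measurable_exp_mul_ofReal 0)] with x h1 h2
    rw [h1, expFamily, h2, hval, Complex.norm_real]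
    split_ifs <;> simp
  · filter_upwards [ae_all_iff.2 fun n => coeFn_classOf (μ := μ) _ (hm n)] with x hx
    simp_rw [hx, hval]
    refine ⟨fun n => Complex.ofReal_im _, fun n m hnm => ?_, ?_⟩
    · simp only [Complex.ofReal_re]
      have : (n : ℝ) ≤ m := by exact_mod_cast hnm
      split_ifs with h1 h2 h2
      · exact le_rfl
      · exact absurd (this.trans_lt h1) h2
      · exact norm_nonneg _
      · exact le_rfl
    · refine tendsto_const_nhds.congr' ?_
      obtain ⟨n, hn⟩ := exists_nat_ge |L x|
      filter_upwards [eventually_ge_atTop n] with m hm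
      have : (n : ℝ) ≤ m := by exact_mod_cast hm
      rw [if_neg (not_lt.2 (hn.trans this)), Complex.ofReal_zero]

/-- A slowly growing function: `1` plus the number of `k < r` with `n k < r`. -/
def slowGrowth (n : ℕ → ℕ) (r : ℝ) : ℝ :=
  1 + ∑ k ∈ Finset.range ⌈r⌉₊, if (n k : ℝ) < r then 1 else 0

lemma one_le_slowGrowth (n : ℕ → ℕ) (r : ℝ) : 1 ≤ slowGrowth n r :=
  le_add_of_nonneg_right (Finset.sum_nonneg fun k _ => by split_ifs <;> norm_num)

lemma monotone_slowGrowth (n : ℕ → ℕ) : Monotone (slowGrowth n) := by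
  intro r s hrs
  unfold slowGrowth
  gcongr 1 + ?_
  refine (Finset.sum_le_sum fun k _ => ?_).trans (Finset.sum_le_sum_of_subset_of_nonneg
    (Finset.range_mono (Nat.ceil_mono hrs)) fun k _ _ => by split_ifs <;> norm_num)
  split_ifs with h1 h2 h2
  · exact le_rfl
  · exact absurd (h1.trans_le hrs) h2
  · exact zero_le_one
  · exact le_rfl

lemma exists_le_slowGrowth (n : ℕ → ℕ) (K : ℕ) :
    ∃ R : ℝ, 0 ≤ R ∧ ∀ r, R < r → (K : ℝ) ≤ slowGrowth n r := by
  -- The sum exceeds each of the first K thresholds; the extra K makes the truncation at ⌈r⌉ keep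
  -- all of these K terms.
  refine ⟨((∑ k ∈ Finset.range K, n k + K : ℕ) : ℝ), Nat.cast_nonneg _, fun r hr => ?_⟩
  have hK : K ≤ ⌈r⌉₊ := by
    have : ((∑ k ∈ Finset.range K, n k + K : ℕ) : ℝ) < ⌈r⌉₊ := hr.trans_le (Nat.le_ceil r)
    have := Nat.cast_lt.1 this
    omega
  have h1 : ∑ k ∈ Finset.range K, (1 : ℝ) ≤
      ∑ k ∈ Finset.range ⌈r⌉₊, if (n k : ℝ) < r then 1 else 0 := by
    refine (Finset.sum_le_sum fun k hk => ?_).trans (Finset.sum_le_sum_of_subset_of_nonneg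
      (Finset.range_mono hK) fun k _ _ => by split_ifs <;> norm_num)
    have h2 : n k ≤ ∑ k ∈ Finset.range K, n k + K :=
      (Finset.single_le_sum (f := n) (fun _ _ => Nat.zero_le _) hk).trans (Nat.le_add_right _ _)
    have h3 : (n k : ℝ) < r := lt_of_le_of_lt (by exact_mod_cast h2) hr
    rw [if_pos h3]
  simp only [Finset.sum_const, Finset.card_range, nsmul_eq_mul, mul_one] at h1
  unfold slowGrowth
  linarith

/-- Factors `g₀`, `g₁` of a geometric mean can be replaced by nearby ones for which the analytic
family joining them is continuous up to the boundary of the strip. -/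
theorem exists_expFamily_of_orderContinuous {N₀ N₁ : (Ω →ₘ[μ] ℂ) → ℝ≥0∞}
    (hN₀ : IsLatticeNorm N₀) (hN₁ : IsLatticeNorm N₁) (hoc : OrderContinuousNorm N₀) {θ : ℝ}
    (hθ₀ : 0 < θ) (hθ₁ : θ < 1) {g₀ g₁ : Ω →ₘ[μ] ℂ} (h₀ : N₀ g₀ < ∞) (h₁ : N₁ g₁ < ∞)
    {ε : ℝ≥0∞} (hε : ε ≠ 0) (hε' : ε ≠ ∞) :
    ∃ (φ : Ω → ℂ) (L : Ω → ℝ) (hφ : Measurable φ) (hL : Measurable L),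
      (∀ x, ‖φ x‖ * Real.exp (θ * L x) = ‖g₀ x‖ ^ (1 - θ) * ‖g₁ x‖ ^ θ) ∧
      N₀ (expFamily hφ hL μ 0) ≤ N₀ g₀ + ε ∧ N₁ (expFamily hφ hL μ 1) ≤ N₁ g₁ ∧
      Tendsto (fun n => N₀ (expTail hφ hL μ 0 n)) atTop (𝓝 0) ∧
      Tendsto (fun n => N₁ (expTail hφ hL μ 1 n)) atTop (𝓝 0) := by
  -- Off this set the geometric mean vanishes, so discarding the complement loses nothing and makes
  -- log(|g_1|/|g_0|) meaningful.
  let S : Set Ω := {x | g₀ x ≠ 0 ∧ g₁ x ≠ 0}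
  have hS : MeasurableSet S :=
    (g₀.measurable (measurableSet_singleton 0).compl).inter
      (g₁.measurable (measurableSet_singleton 0).compl)
  let l : Ω → ℝ := fun x => Real.log (‖g₁ x‖ / ‖g₀ x‖)
  have hl : Measurable l := (g₁.measurable.norm.div g₀.measurable.norm).log
  let ψ : Ω → ℂ := S.indicator fun x => ((‖g₀ x‖ : ℝ) : ℂ)
  have hψ : Measurable ψ := (Complex.measurable_ofReal.comp g₀.measurable.norm).indicator hS
  have hψle : ∀ x, ‖ψ x‖ ≤ ‖g₀ x‖ := fun x => by
    refine (norm_indicator_le_norm_self _ _).trans ?_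
    simp
  have hψlt : N₀ (expFamily hψ hl μ 0) < ∞ := by
    refine lt_of_le_of_lt (hN₀.mono ?_) h₀
    filter_upwards [coeFn_weighted hψ hl (measurable_exp_mul_ofReal 0)] with x hx
    rw [expFamily, hx]
    simpa using hψle x
  have htail := hoc.tendsto_expTail hN₀ hψ hl hψlt
  obtain ⟨e, he, hes⟩ := ENNReal.exists_pos_sum_of_countable' hε ℕ
  -- The thresholds of W: beyond n_k the tail of g_0 has norm at most e_k. Since W adds at most one
  -- tail for each k, multiplication by W raises the norm of g_0 by at most ∑ e_k.
  have hex : ∀ k, ∃ n, N₀ (expTail hψ hl μ 0 n) ≤ e k := fun k =>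
    ((ENNReal.tendsto_nhds_zero.1 htail) (e k) (he k)).exists
  choose n hn using hex
  let W : Ω → ℝ := fun x => slowGrowth n |l x|
  have hW : Measurable W := (monotone_slowGrowth n).measurable.comp hl.norm
  have hW1 : ∀ x, 1 ≤ W x := fun x => one_le_slowGrowth _ _
  have hW0 : ∀ x, 0 < W x := fun x => zero_lt_one.trans_le (hW1 x)
  -- On S, e^L = (|g_1|/|g_0|) W^{-1/θ}. With |φ| = |g_0| W, the powers of W cancel in |φ|e^{θL},
  -- while |φ|e^L = |g_1| W^{1-1/θ}.
  let L : Ω → ℝ := fun x => l x - θ⁻¹ * Real.log (W x)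
  have hL : Measurable L := hl.sub (hW.log.const_mul _)
  let φ : Ω → ℂ := fun x => ψ x * (W x : ℂ)
  have hφ : Measurable φ := hψ.mul (Complex.measurable_ofReal.comp hW)
  have hexp : ∀ y x, Real.exp (y * L x) = Real.exp (y * l x) * W x ^ (-(y * θ⁻¹)) := fun y x => by
    rw [Real.rpow_def_of_pos (hW0 x), ← Real.exp_add]
    congr 1
    simp only [L]
    ring
  have hφn : ∀ x, ‖φ x‖ = ‖ψ x‖ * W x := fun x => by
    rw [norm_mul, Complex.norm_real, Real.norm_of_nonneg (hW0 x).le]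
  have hexpl : ∀ x ∈ S, Real.exp (l x) = ‖g₁ x‖ / ‖g₀ x‖ := fun x hx =>
    Real.exp_log (div_pos (norm_pos_iff.2 hx.2) (norm_pos_iff.2 hx.1))
  have hψS : ∀ x ∈ S, ‖ψ x‖ = ‖g₀ x‖ := fun x hx => by
    simp only [ψ]; rw [indicator_of_mem hx]; simp
  have hψS' : ∀ x ∉ S, ψ x = 0 := fun x hx => indicator_of_notMem hx _
  have hφ1 : ∀ x, ‖φ x‖ * Real.exp (L x) ≤ ‖g₁ x‖ * W x ^ (-(θ⁻¹ - 1)) := fun x => by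
    by_cases hx : x ∈ S
    · have h1 := hexp 1 x
      rw [one_mul, one_mul, hexpl x hx, one_mul] at h1
      rw [h1, hφn, hψS x hx]
      have : 0 < ‖g₀ x‖ := norm_pos_iff.2 hx.1
      have e1 : W x ^ (-(θ⁻¹ - 1)) = W x * W x ^ (-θ⁻¹) := by
        rw [neg_sub, sub_eq_add_neg, Real.rpow_add (hW0 x), Real.rpow_one]
      rw [e1]
      refine le_of_eq ?_
      field_simp
    · rw [hφn, hψS' x hx, norm_zero, zero_mul, zero_mul]
      have := hW0 x
      positivity
  have hθinv : 0 < θ⁻¹ - 1 := sub_pos.2 ((one_lt_inv₀ hθ₀).2 hθ₁)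
  have hG₀ : N₀ (expFamily hφ hL μ 0) ≤ N₀ g₀ + ε := by
    let u : ℕ → Ω →ₘ[μ] ℂ := fun k => Nat.casesOn k g₀ fun k => expTail hψ hl μ 0 (n k)
    have hu : ∀ F : (Ω →ₘ[μ] ℂ) → ℝ≥0∞,
        ∑' k, F (u k) = F g₀ + ∑' k, F (expTail hψ hl μ 0 (n k)) := fun F =>
      tsum_eq_zero_add' ENNReal.summable
    refine (hN₀.le_tsum u _ ?_).trans ((hu N₀).trans_le ?_)
    · filter_upwards [coeFn_weighted hφ hL (measurable_exp_mul_ofReal 0),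
        ae_all_iff.2 fun k => coeFn_weighted (μ := μ) hψ hl
          ((measurable_exp_mul_ofReal 0).mul (measurable_tailInd (n k)))] with x h1 h2
      rw [hu fun g => ‖g x‖ₑ]
      have e1 : expFamily hφ hL μ 0 x = ψ x +
          ∑ k ∈ Finset.range ⌈|l x|⌉₊, expTail hψ hl μ 0 (n k) x := by
        simp_rw [expTail, h2]
        rw [expFamily, h1, ← Finset.mul_sum]
        simp only [φ, W, slowGrowth, zero_mul, Complex.exp_zero, mul_one, Pi.mul_apply, one_mul,
          Complex.ofReal_add, Complex.ofReal_one, Complex.ofReal_sum, mul_add]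
        congr 2
        refine Finset.sum_congr rfl fun k _ => ?_
        by_cases hx : (n k : ℝ) < |l x|
        · rw [if_pos hx, tailInd, indicator_of_mem (by exact hx)]; simp
        · rw [if_neg hx, tailInd, indicator_of_notMem (by exact hx)]; simp
      rw [e1]
      refine (enorm_add_le _ _).trans (add_le_add ?_ ?_)
      · exact enorm_le_enorm_iff_norm.2 (hψle x)
      · exact (enorm_sum_le _ _).trans (ENNReal.sum_le_tsum _)
    · gcongr
      exact (ENNReal.tsum_le_tsum hn).trans hes.le
  refine ⟨φ, L, hφ, hL, fun x => ?_, hG₀, ?_, ?_, ?_⟩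
  · by_cases hx : x ∈ S
    · have p0 : 0 < ‖g₀ x‖ := norm_pos_iff.2 hx.1
      have p1 : 0 < ‖g₁ x‖ := norm_pos_iff.2 hx.2
      rw [hexp, hφn, hψS x hx, mul_comm θ (l x), Real.exp_mul, hexpl x hx,
        mul_inv_cancel₀ hθ₀.ne', Real.rpow_neg_one, Real.div_rpow p1.le p0.le,
        Real.rpow_sub p0, Real.rpow_one]
      have := hW0 x
      field_simp
    · rw [hφn, hψS' x hx, norm_zero, zero_mul, zero_mul, eq_comm]
      have : g₀ x = 0 ∨ g₁ x = 0 := by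
        by_contra hh
        exact hx (not_or.1 hh)
      rcases this with h | h
      · rw [h, norm_zero, Real.zero_rpow (sub_pos.2 hθ₁).ne', zero_mul]
      · rw [h, norm_zero, Real.zero_rpow hθ₀.ne', mul_zero]
  · refine hN₁.mono ?_
    filter_upwards [coeFn_weighted hφ hL (measurable_exp_mul_ofReal 1)] with x hx
    rw [expFamily, hx, norm_mul, norm_exp_mul_ofReal, Complex.one_re, one_mul]
    refine (hφ1 x).trans (mul_le_of_le_one_right (norm_nonneg _) ?_)
    exact Real.rpow_le_one_of_one_le_of_nonpos (hW1 x) (by linarith)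
  -- Order continuity is used a second time, now for the modified factor and the modified exponent
  -- L.
  · exact hoc.tendsto_expTail hN₀ hφ hL
      (hG₀.trans_lt (ENNReal.add_lt_top.2 ⟨h₀, hε'.lt_top⟩))
  -- For the second factor no order continuity is available. Where |l| ≤ R the weight W is bounded,
  -- hence so is L; thus |L| large forces |l| > R and W ≥ K, and the tail is at most K^{-(1/θ-1)}
  -- |g_1|.
  · refine ENNReal.tendsto_nhds_zero.2 fun η hη => ?_
    have hlim : Tendsto (fun K : ℕ => ENNReal.ofReal ((K : ℝ) ^ (-(θ⁻¹ - 1))) * N₁ g₁) atTop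
        (𝓝 0) := by
      have h2 := (tendsto_rpow_neg_atTop hθinv).comp tendsto_natCast_atTop_atTop
      have h3 := (ENNReal.continuous_ofReal.tendsto 0).comp h2
      rw [ENNReal.ofReal_zero] at h3
      have h4 := ENNReal.Tendsto.mul_const h3 (Or.inr h₁.ne)
      rwa [zero_mul] at h4
    obtain ⟨K, hK, hK0⟩ := (((ENNReal.tendsto_nhds_zero.1 hlim) η hη).and
      (eventually_gt_atTop 0)).exists
    obtain ⟨R, hR, hRK⟩ := exists_le_slowGrowth n K
    obtain ⟨m, hm⟩ := exists_nat_ge (R + θ⁻¹ * Real.log (slowGrowth n R))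
    filter_upwards [eventually_ge_atTop m] with p hp
    refine le_trans ?_ hK
    have ec : ENNReal.ofReal ((K : ℝ) ^ (-(θ⁻¹ - 1))) = ‖(((K : ℝ) ^ (-(θ⁻¹ - 1)) : ℝ) : ℂ)‖ₑ := by
      rw [← ofReal_norm, Complex.norm_real, Real.norm_of_nonneg (by positivity)]
    rw [ec, ← hN₁.smul]
    refine hN₁.mono ?_
    filter_upwards [coeFn_weighted hφ hL ((measurable_exp_mul_ofReal 1).mul (measurable_tailInd p)),
      AEEqFun.coeFn_smul (((K : ℝ) ^ (-(θ⁻¹ - 1)) : ℝ) : ℂ) g₁] with x h2 h3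
    rw [expTail, h2, h3, Pi.smul_apply, norm_smul, Complex.norm_real,
      Real.norm_of_nonneg (by positivity), Pi.mul_apply, norm_mul (φ x), norm_mul (Complex.exp _),
      norm_exp_mul_ofReal,
      Complex.one_re, one_mul, ← mul_assoc]
    by_cases hx : (p : ℝ) < |L x|
    · have hlx : R < |l x| := by
        by_contra hle
        rw [not_lt] at hle
        have hWle : W x ≤ slowGrowth n R := monotone_slowGrowth n hle
        have hlog : Real.log (W x) ≤ Real.log (slowGrowth n R) := Real.log_le_log (hW0 x) hWle
        have hlog0 : 0 ≤ Real.log (W x) := Real.log_nonneg (hW1 x)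
        have h4 : |L x| ≤ |l x| + θ⁻¹ * Real.log (W x) := by
          refine (abs_sub _ _).trans_eq ?_
          rw [abs_of_nonneg (by positivity : 0 ≤ θ⁻¹ * Real.log (W x))]
        have h5 : θ⁻¹ * Real.log (W x) ≤ θ⁻¹ * Real.log (slowGrowth n R) := by gcongr
        have h6 : (m : ℝ) ≤ p := by exact_mod_cast hp
        linarith
      have hKW : (K : ℝ) ≤ W x := hRK _ hlx
      rw [tailInd, indicator_of_mem (by exact hx), Pi.one_apply, norm_one, mul_one, mul_comm _ ‖g₁ x‖]
      refine (hφ1 x).trans ?_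
      gcongr ‖g₁ x‖ * ?_
      exact Real.rpow_le_rpow_of_nonpos (by exact_mod_cast hK0) hKW (by linarith)
    · rw [tailInd, indicator_of_notMem (by exact hx), norm_zero, mul_zero]
      positivity

variable [SFinite μ] {f : (Ω × ℤ) →ₘ[μ.prod Measure.count] ℂ}

theorem exists_memF_linftyNorm {N₀ N₁ : (Ω →ₘ[μ] ℂ) → ℝ≥0∞}
    (hN₀ : IsLatticeNorm N₀) (hN₁ : IsLatticeNorm N₁) (hoc : OrderContinuousNorm N₀) {θ : ℝ}
    (hθ₀ : 0 < θ) (hθ₁ : θ < 1) {g₀ g₁ : Ω →ₘ[μ] ℂ} {c : ℝ≥0∞} (hc : c < ∞)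
    (h₀ : N₀ g₀ ≤ c) (h₁ : N₁ g₁ ≤ c)
    (hf : ∀ᵐ x ∂μ, ∀ j : ℤ, ‖f (x, j)‖ ≤ ‖g₀ x‖ ^ (1 - θ) * ‖g₁ x‖ ^ θ) {δ : ℝ} (hδ : 0 < δ) :
    ∃ F, MemF (linftyNorm N₀) (linftyNorm N₁) F ∧ F θ = f ∧
      normF (linftyNorm N₀) (linftyNorm N₁) F ≤
        ENNReal.ofReal (Real.exp δ) * (c + ENNReal.ofReal δ) := by
  obtain ⟨φ, L, hφ, hL, hφL, b₀, b₁, t₀, t₁⟩ := exists_expFamily_of_orderContinuous hN₀ hN₁ hoc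
    hθ₀ hθ₁ (h₀.trans_lt hc) (h₁.trans_lt hc) (ε := ENNReal.ofReal δ)
    (ENNReal.ofReal_pos.2 hδ).ne' ENNReal.ofReal_ne_top
  let L' : Ω × ℤ → ℝ := fun z => L z.1
  have hL' : Measurable L' := hL.comp measurable_fst
  -- The family φ' e^{zL'} takes the value f at θ. Because |φ|e^{θL} is the geometric mean bounding
  -- every f_j, |φ'(x,j)| ≤ |φ(x)| for all j, so the norms and tails in X_i(ℓ^∞) are controlled by
  -- those on Ω.
  let φ' : Ω × ℤ → ℂ := fun z => f z * Complex.exp (-(θ * L' z))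
  have hφ' : Measurable φ' := f.measurable.mul (by fun_prop)
  have hφle : ∀ᵐ x ∂μ, ∀ j : ℤ, ‖φ' (x, j)‖ ≤ ‖φ x‖ := by
    filter_upwards [hf] with x hx j
    have e : ‖Complex.exp (-(θ * L' (x, j)))‖ = (Real.exp (θ * L x))⁻¹ := by
      rw [← neg_mul, norm_exp_mul_ofReal, ← Real.exp_neg]; simp [L']
    rw [norm_mul, e, mul_inv_le_iff₀ (Real.exp_pos _), hφL]
    exact hx j
  have key : ∀ {N : (Ω →ₘ[μ] ℂ) → ℝ≥0∞} (_ : IsLatticeNorm N) {w : ℝ → ℂ} (hw : Measurable w),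
      linftyNorm N (weighted (μ.prod Measure.count) hφ' hL' hw) ≤ N (weighted μ hφ hL hw) := by
    intro N hN w hw
    refine hN.linftyNorm_le ?_
    filter_upwards [hφle, ae_prod_count_iff.1 (coeFn_weighted (μ := μ.prod Measure.count) hφ' hL' hw),
      coeFn_weighted (μ := μ) hφ hL hw] with x h1 h2 h3 j
    rw [h2 j, h3, norm_mul (φ' (x, j)), norm_mul (φ x)]
    exact mul_le_mul_of_nonneg_right (h1 j) (norm_nonneg (w (L x)))
  have hcδ : c + ENNReal.ofReal δ < ∞ := ENNReal.add_lt_top.2 ⟨hc, ENNReal.ofReal_lt_top⟩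
  have B₀ : linftyNorm N₀ (expFamily hφ' hL' (μ.prod Measure.count) 0) ≤ c + ENNReal.ofReal δ :=
    (key hN₀ _).trans (b₀.trans (by gcongr))
  have B₁ : linftyNorm N₁ (expFamily hφ' hL' (μ.prod Measure.count) 1) ≤ c + ENNReal.ofReal δ :=
    (key hN₁ _).trans ((b₁.trans h₁).trans le_self_add)
  refine ⟨fun z => gaussFactor δ θ z • expFamily hφ' hL' (μ.prod Measure.count) z,
    memF_gauss_smul_expFamily hφ' hL' hN₀.linftyNorm_isLatticeNorm hN₁.linftyNorm_isLatticeNorm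
      hδ θ (B₀.trans_lt hcδ) (B₁.trans_lt hcδ)
      (tendsto_of_tendsto_of_tendsto_of_le_of_le tendsto_const_nhds t₀ (fun _ => zero_le)
        fun n => key hN₀ _)
      (tendsto_of_tendsto_of_tendsto_of_le_of_le tendsto_const_nhds t₁ (fun _ => zero_le)
        fun n => key hN₁ _), ?_,
    normF_gauss_smul_expFamily_le hφ' hL' hN₀.linftyNorm_isLatticeNorm
      hN₁.linftyNorm_isLatticeNorm hδ θ B₀ B₁⟩
  have hg : gaussFactor δ θ θ = 1 := by simp [gaussFactor]
  simp only [hg]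
  rw [show (1 : ℂ) • expFamily hφ' hL' (μ.prod Measure.count) (θ : ℂ) =
    expFamily hφ' hL' (μ.prod Measure.count) (θ : ℂ) from one_smul ℂ _]
  refine AEEqFun.ext ?_
  filter_upwards [coeFn_weighted (μ := μ.prod Measure.count) hφ' hL'
    (measurable_exp_mul_ofReal (θ : ℂ))] with z hz
  rw [expFamily, hz, mul_assoc, ← Complex.exp_add, neg_add_cancel, Complex.exp_zero, mul_one]

/-- Both losses, the factor e^δ of the Gaussian and the increase δ of the norm of the first factor,
vanish as δ → 0. -/
theorem interpNorm_linftyNorm_le {N₀ N₁ : (Ω →ₘ[μ] ℂ) → ℝ≥0∞}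
    (hN₀ : IsLatticeNorm N₀) (hN₁ : IsLatticeNorm N₁) (hoc : OrderContinuousNorm N₀) {θ : ℝ}
    (hθ₀ : 0 < θ) (hθ₁ : θ < 1) {g₀ g₁ : Ω →ₘ[μ] ℂ} {c : ℝ≥0∞} (hc : c < ∞)
    (h₀ : N₀ g₀ ≤ c) (h₁ : N₁ g₁ ≤ c)
    (hf : ∀ᵐ x ∂μ, ∀ j : ℤ, ‖f (x, j)‖ ≤ ‖g₀ x‖ ^ (1 - θ) * ‖g₁ x‖ ^ θ) :
    interpNorm (linftyNorm N₀) (linftyNorm N₁) θ f ≤ c := by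
  have hlim : Tendsto (fun δ : ℝ => ENNReal.ofReal (Real.exp δ) * (c + ENNReal.ofReal δ)) (𝓝[>] 0)
      (𝓝 c) := by
    have h1 : Tendsto (fun δ : ℝ => ENNReal.ofReal (Real.exp δ)) (𝓝[>] 0) (𝓝 1) := by
      have := ((ENNReal.continuous_ofReal.comp Real.continuous_exp).tendsto 0).mono_left
        (nhdsWithin_le_nhds (s := Ioi 0))
      simpa [Function.comp_def] using this
    have h2 : Tendsto (fun δ : ℝ => c + ENNReal.ofReal δ) (𝓝[>] 0) (𝓝 c) := by
      have := ((ENNReal.continuous_ofReal.tendsto 0).mono_left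
        (nhdsWithin_le_nhds (s := Ioi 0))).const_add c
      simpa using this
    have := ENNReal.Tendsto.mul h1 (Or.inl one_ne_zero) h2 (Or.inr ENNReal.one_ne_top)
    rwa [one_mul] at this
  refine ge_of_tendsto hlim ?_
  filter_upwards [self_mem_nhdsWithin] with δ hδ
  obtain ⟨F, hF, e, hle⟩ := exists_memF_linftyNorm hN₀ hN₁ hoc hθ₀ hθ₁ hc h₀ h₁ hf hδ
  exact (iInf_le_of_le F (iInf₂_le hF e)).trans hle

end

/-! ### Comparison of norms in the interpolation method -/

namespace ComplexInterp

section

variable {V : Type*} [AddCommGroup V] [Module ℂ V] {M₀ M₁ N₀ N₁ : V → ℝ≥0∞} {C : ℝ≥0}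

omit [AddCommGroup V] [Module ℂ V] in
lemma tendsto_zero_of_le_const_mul {M N : V → ℝ≥0∞} (h : ∀ a, M a ≤ C * N a) {α : Type*}
    {l : Filter α} {u : α → V} (hu : Tendsto (fun x => N (u x)) l (𝓝 0)) :
    Tendsto (fun x => M (u x)) l (𝓝 0) := by
  have := ENNReal.Tendsto.const_mul hu (Or.inr (ENNReal.coe_ne_top (r := C)))
  rw [mul_zero] at this
  exact tendsto_of_tendsto_of_tendsto_of_le_of_le tendsto_const_nhds this (fun _ => zero_le)
    fun x => h _

omit [Module ℂ V] in
lemma sumNorm_le_const_mul_sumNorm (hC : C ≠ 0) (h₀ : ∀ a, M₀ a ≤ C * N₀ a)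
    (h₁ : ∀ a, M₁ a ≤ C * N₁ a) (a : V) : sumNorm M₀ M₁ a ≤ C * sumNorm N₀ N₁ a := by
  rw [sumNorm, sumNorm, ENNReal.mul_iInf_of_ne (by exact_mod_cast hC) ENNReal.coe_ne_top]
  refine iInf_mono fun b => ?_
  rw [mul_add]
  exact add_le_add (h₀ _) (h₁ _)

omit [Module ℂ V] in
lemma IsC0OnLine.of_le_const_mul {M N : V → ℝ≥0∞} (h : ∀ a, M a ≤ C * N a) {f : ℂ → V} {x : ℝ}
    (hf : IsC0OnLine N f x) : IsC0OnLine M f x where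
  mem t := (h _).trans_lt (ENNReal.mul_lt_top ENNReal.coe_lt_top (hf.mem t))
  continuous t := tendsto_zero_of_le_const_mul h (hf.continuous t)
  decay := tendsto_zero_of_le_const_mul h hf.decay

/-- Every condition defining 𝓕 is an upper bound or a limit zero, so a one-sided comparison
transports it. It is used in both directions between a norm and its solid hull. -/
lemma MemF.of_le_const_mul (hC : C ≠ 0) (h₀ : ∀ a, M₀ a ≤ C * N₀ a)
    (h₁ : ∀ a, M₁ a ≤ C * N₁ a) {f : ℂ → V} (hf : MemF N₀ N₁ f) : MemF M₀ M₁ f where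
  bounded := by
    obtain ⟨M, hM⟩ := hf.bounded
    refine ⟨C * M, fun z hz => (sumNorm_le_const_mul_sumNorm hC h₀ h₁ _).trans ?_⟩
    rw [ENNReal.coe_mul]
    gcongr
    exact hM z hz
  continuous z hz :=
    tendsto_zero_of_le_const_mul (sumNorm_le_const_mul_sumNorm hC h₀ h₁) (hf.continuous z hz)
  analytic z hz := by
    obtain ⟨d, hd⟩ := hf.analytic z hz
    exact ⟨d, tendsto_zero_of_le_const_mul (sumNorm_le_const_mul_sumNorm hC h₀ h₁) hd⟩
  line_zero := hf.line_zero.of_le_const_mul h₀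
  line_one := hf.line_one.of_le_const_mul h₁

lemma interpNorm_mono (h₀ : ∀ a, M₀ a ≤ N₀ a) (h₁ : ∀ a, M₁ a ≤ N₁ a) (θ : ℝ) (a : V) :
    interpNorm M₀ M₁ θ a ≤ interpNorm N₀ N₁ θ a :=
  le_iInf fun f => le_iInf₂ fun hf hfa => iInf_le_of_le f <|
    (iInf₂_le (hf.of_le_const_mul (C := 1) one_ne_zero (by simpa using h₀) (by simpa using h₁))
      hfa).trans (iSup_mono fun _ => max_le_max (h₀ _) (h₁ _))

end

end ComplexInterp

/-! ### The Calderón product -/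

section

variable {Ω : Type*} [MeasurableSpace Ω] {μ : Measure Ω}

lemma SolidWith.mono {N : (Ω →ₘ[μ] ℂ) → ℝ≥0∞} {C D : ℝ≥0} (h : SolidWith N C) (hCD : C ≤ D) :
    SolidWith N D := fun f g hfg => (h f g hfg).trans (by gcongr)

lemma OrderContinuousNorm.of_le_const_mul {M N : (Ω →ₘ[μ] ℂ) → ℝ≥0∞} {C : ℝ≥0}
    (h : OrderContinuousNorm N) (hle : ∀ f, M f ≤ C * N f) (hge : ∀ f, N f ≤ M f) :
    OrderContinuousNorm M := fun u hu hx =>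
  tendsto_zero_of_le_const_mul hle (h u (fun n => (hge _).trans_lt (hu n)) hx)

lemma SolidWith.linftyNorm_solidHull_le {N : (Ω →ₘ[μ] ℂ) → ℝ≥0∞} {C : ℝ≥0} (h : SolidWith N C)
    (hC : C ≠ 0) (f : (Ω × ℤ) →ₘ[μ.prod Measure.count] ℂ) :
    linftyNorm (solidHull N) f ≤ C * linftyNorm N f := by
  by_cases hf : linftyNorm N f < ∞
  · exact linftyNorm_le_const_mul h.solidHull_le hf
  · rw [not_lt_top_iff.1 hf, ENNReal.mul_top (by exact_mod_cast hC)]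
    exact le_top

lemma ae_absPow (p : ℝ) (f : Ω →ₘ[μ] ℂ) : ∀ᵐ x ∂μ, absPow p f x = ((‖f x‖ ^ p : ℝ) : ℂ) :=
  AEEqFun.coeFn_compMeasurable _ (by fun_prop) f

section calderon

variable {N₀ N₁ : (Ω →ₘ[μ] ℂ) → ℝ≥0∞} {θ : ℝ}
  {f : (Ω × ℤ) →ₘ[μ.prod Measure.count] ℂ}

/-- With F = sup_j |f_j|, the factorization is F = (F/|H_1|^θ)·|H_1|^θ; the power 1/(1-θ) of the
first factor is dominated by H_0. The factors are only dominated by H_0 and H_1, which is why hulls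
appear on the right. -/
lemma linftyNorm_calderonNorm_le (hθ₀ : 0 < θ) (hθ₁ : θ < 1) {H₀ H₁ : Ω →ₘ[μ] ℂ}
    (hf : ∀ᵐ x ∂μ, ∀ j : ℤ, ‖f (x, j)‖ ≤ ‖H₀ x‖ ^ (1 - θ) * ‖H₁ x‖ ^ θ) :
    linftyNorm (calderonNorm N₀ N₁ θ) f ≤ solidHull N₀ H₀ ^ (1 - θ) * solidHull N₁ H₁ ^ θ := by
  have hθ' : 0 < 1 - θ := sub_pos.2 hθ₁
  obtain ⟨F, hF, hFle⟩ := exists_isSupAbs hf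
  rw [hF.linftyNorm_eq]
  have hm₁ : Measurable fun x => ((‖H₁ x‖ ^ θ : ℝ) : ℂ) :=
    Complex.measurable_ofReal.comp (H₁.measurable.norm.pow_const θ)
  have hm₀ : Measurable fun x => F x / ((‖H₁ x‖ ^ θ : ℝ) : ℂ) := F.measurable.div hm₁
  have hpow : ∀ a : ℝ, 0 ≤ a → ‖((a ^ θ : ℝ) : ℂ)‖ = a ^ θ := fun a ha => by
    rw [Complex.norm_real, Real.norm_of_nonneg (by positivity)]
  have heq : F = classOf μ _ hm₀ * classOf μ _ hm₁ := by
    refine AEEqFun.ext ?_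
    filter_upwards [hFle, coeFn_classOf _ hm₀, coeFn_classOf _ hm₁,
      AEEqFun.coeFn_mul (classOf μ _ hm₀) (classOf μ _ hm₁)] with x h1 h2 h3 h4
    rw [h4, Pi.mul_apply, h2, h3]
    -- Where H_1 vanishes so does F, hence the division by zero is harmless.
    by_cases h0 : ((‖H₁ x‖ ^ θ : ℝ) : ℂ) = 0
    · have : ‖H₁ x‖ ^ θ = 0 := by exact_mod_cast h0
      rw [this, mul_zero, norm_le_zero_iff] at h1
      rw [h0, mul_zero, h1]
    · rw [div_mul_cancel₀ _ h0]
  refine (iInf₂_le_of_le (classOf μ _ hm₀) (classOf μ _ hm₁) (iInf_le _ heq)).trans ?_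
  gcongr
  · refine le_solidHull ?_
    filter_upwards [hFle, coeFn_classOf _ hm₀, ae_absPow (1 / (1 - θ)) (classOf μ _ hm₀)]
      with x h1 h2 h3
    rw [h3, h2, Complex.norm_real, Real.norm_of_nonneg (by positivity), norm_div,
      hpow _ (norm_nonneg _)]
    have h4 : ‖F x‖ / ‖H₁ x‖ ^ θ ≤ ‖H₀ x‖ ^ (1 - θ) :=
      div_le_of_le_mul₀ (by positivity) (by positivity) h1
    calc _ ≤ (‖H₀ x‖ ^ (1 - θ)) ^ (1 / (1 - θ)) := by gcongr
      _ = ‖H₀ x‖ := by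
        rw [← Real.rpow_mul (norm_nonneg _), mul_one_div_cancel hθ'.ne', Real.rpow_one]
  · refine le_solidHull ?_
    filter_upwards [coeFn_classOf _ hm₁, ae_absPow (1 / θ) (classOf μ _ hm₁)] with x h1 h2
    rw [h2, h1, Complex.norm_real, Real.norm_of_nonneg (by positivity), hpow _ (norm_nonneg _),
      ← Real.rpow_mul (norm_nonneg _), mul_one_div_cancel hθ₀.ne', Real.rpow_one]

variable [SFinite μ] (hN₀ : IsLatticeNorm N₀) (hN₁ : IsLatticeNorm N₁)
include hN₀ hN₁

lemma interpNorm_linftyNorm_le_rpow_mul_rpow (hoc : OrderContinuousNorm N₀)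
    (hθ₀ : 0 < θ) (hθ₁ : θ < 1) {g₀ g₁ : Ω →ₘ[μ] ℂ}
    (hf : ∀ᵐ x ∂μ, ∀ j : ℤ, ‖f (x, j)‖ ≤ ‖g₀ x‖ ^ (1 - θ) * ‖g₁ x‖ ^ θ)
    (hfin : N₀ g₀ ^ (1 - θ) * N₁ g₁ ^ θ < ∞) :
    f ∈ interpSpace (linftyNorm N₀) (linftyNorm N₁) θ ∧
      interpNorm (linftyNorm N₀) (linftyNorm N₁) θ f ≤ N₀ g₀ ^ (1 - θ) * N₁ g₁ ^ θ := by
  have hθ' : 0 < 1 - θ := sub_pos.2 hθ₁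
  suffices h : ∃ k₀ k₁ : Ω →ₘ[μ] ℂ, N₀ k₀ ≤ N₀ g₀ ^ (1 - θ) * N₁ g₁ ^ θ ∧
      N₁ k₁ ≤ N₀ g₀ ^ (1 - θ) * N₁ g₁ ^ θ ∧
      ∀ᵐ x ∂μ, ∀ j : ℤ, ‖f (x, j)‖ ≤ ‖k₀ x‖ ^ (1 - θ) * ‖k₁ x‖ ^ θ by
    obtain ⟨k₀, k₁, h₀, h₁, hk⟩ := h
    refine ⟨?_, interpNorm_linftyNorm_le hN₀ hN₁ hoc hθ₀ hθ₁ hfin h₀ h₁ hk⟩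
    obtain ⟨F, hF, e, -⟩ :=
      exists_memF_linftyNorm hN₀ hN₁ hoc hθ₀ hθ₁ hfin h₀ h₁ hk zero_lt_one
    exact ⟨F, hF, e⟩
  have hz := AEEqFun.coeFn_zero (μ := μ) (β := ℂ)
  -- A vanishing norm is treated first, because the product is then 0 even if the other norm is
  -- infinite. In that case f = 0, and the zero functions serve as factors.
  by_cases h0 : N₀ g₀ = 0
  · refine ⟨0, 0, by rw [hN₀.map_zero]; exact zero_le, by rw [hN₁.map_zero]; exact zero_le, ?_⟩
    have := hN₀.eq_zero _ h0
    subst this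
    filter_upwards [hf, hz] with x h1 h2 j
    have h3 := h1 j
    rw [h2, Pi.zero_apply, norm_zero, Real.zero_rpow hθ'.ne', zero_mul] at h3
    exact h3.trans (by positivity)
  by_cases h1 : N₁ g₁ = 0
  · refine ⟨0, 0, by rw [hN₀.map_zero]; exact zero_le, by rw [hN₁.map_zero]; exact zero_le, ?_⟩
    have := hN₁.eq_zero _ h1
    subst this
    filter_upwards [hf, hz] with x h1 h2 j
    have h3 := h1 j
    rw [h2, Pi.zero_apply, norm_zero, Real.zero_rpow hθ₀.ne', mul_zero] at h3
    exact h3.trans (by positivity)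
  have t0 : N₀ g₀ ≠ ∞ := fun h => by
    rw [h, ENNReal.top_rpow_of_pos hθ', ENNReal.top_mul (by simp [h1, hθ₀.le, not_lt])] at hfin
    exact lt_irrefl _ hfin
  have t1 : N₁ g₁ ≠ ∞ := fun h => by
    rw [h, ENNReal.top_rpow_of_pos hθ₀, ENNReal.mul_top (by simp [h0, hθ₁.le, not_lt])] at hfin
    exact lt_irrefl _ hfin
  obtain ⟨a, ha⟩ : ∃ a : ℝ≥0, N₀ g₀ = a := ⟨_, (ENNReal.coe_toNNReal t0).symm⟩
  obtain ⟨b, hb⟩ : ∃ b : ℝ≥0, N₁ g₁ = b := ⟨_, (ENNReal.coe_toNNReal t1).symm⟩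
  rw [ha] at h0
  rw [hb] at h1
  have ha0 : (0 : ℝ) < a := by
    have : a ≠ 0 := by exact_mod_cast h0
    positivity
  have hb0 : (0 : ℝ) < b := by
    have : b ≠ 0 := by exact_mod_cast h1
    positivity
  have hc : (a : ℝ≥0∞) ^ (1 - θ) * (b : ℝ≥0∞) ^ θ =
      ENNReal.ofReal ((a : ℝ) ^ (1 - θ) * (b : ℝ) ^ θ) := by
    rw [ENNReal.ofReal_mul (by positivity), ← ENNReal.ofReal_rpow_of_pos ha0,
      ← ENNReal.ofReal_rpow_of_pos hb0, ENNReal.ofReal_coe_nnreal, ENNReal.ofReal_coe_nnreal]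
  have hsm : ∀ {N : (Ω →ₘ[μ] ℂ) → ℝ≥0∞} (_ : IsLatticeNorm N) {g : Ω →ₘ[μ] ℂ} {r : ℝ} {d : ℝ≥0},
      0 < r → N g = d → N ((r : ℂ) • g) = ENNReal.ofReal (r * d) := by
    intro N hN g r d hr hd
    rw [hN.smul, hd, ENNReal.ofReal_mul hr.le, ENNReal.ofReal_coe_nnreal, ← ofReal_norm,
      Complex.norm_real, Real.norm_of_nonneg hr.le]
  rw [ha, hb, hc]
  -- These scalars make both norms equal to a^{1-θ} b^θ and leave the geometric mean unchanged,
  -- since -θ(1-θ) + (1-θ)θ = 0.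
  refine ⟨((((a : ℝ) / b) ^ (-θ) : ℝ) : ℂ) • g₀, ((((a : ℝ) / b) ^ (1 - θ) : ℝ) : ℂ) • g₁, ?_, ?_, ?_⟩
  · rw [hsm hN₀ (by positivity) ha]
    refine ENNReal.ofReal_le_ofReal (le_of_eq ?_)
    rw [Real.div_rpow ha0.le hb0.le, Real.rpow_neg ha0.le, Real.rpow_neg hb0.le,
      Real.rpow_sub ha0, Real.rpow_one]
    field_simp
  · rw [hsm hN₁ (by positivity) hb]
    refine ENNReal.ofReal_le_ofReal (le_of_eq ?_)
    rw [Real.div_rpow ha0.le hb0.le, Real.rpow_sub hb0, Real.rpow_one]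
    field_simp
  · filter_upwards [hf, AEEqFun.coeFn_smul ((((a : ℝ) / b) ^ (-θ) : ℝ) : ℂ) g₀,
      AEEqFun.coeFn_smul ((((a : ℝ) / b) ^ (1 - θ) : ℝ) : ℂ) g₁] with x h2 h3 h4 j
    refine (h2 j).trans_eq ?_
    have hρ : 0 < (a : ℝ) / b := by positivity
    rw [h3, h4, Pi.smul_apply, Pi.smul_apply, norm_smul, norm_smul, Complex.norm_real,
      Complex.norm_real, Real.norm_of_nonneg (by positivity), Real.norm_of_nonneg (by positivity),
      Real.mul_rpow (by positivity) (norm_nonneg _), Real.mul_rpow (by positivity) (norm_nonneg _),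
      ← Real.rpow_mul hρ.le, ← Real.rpow_mul hρ.le, mul_mul_mul_comm, ← Real.rpow_add hρ,
      show -θ * (1 - θ) + (1 - θ) * θ = 0 by ring, Real.rpow_zero, one_mul]

end calderon

/-- The functions |f(x)| 1_{j ≥ n} decrease to zero at every point of Ω × ℤ, yet their supremum over
j is |f| for every n. -/
lemma not_orderContinuousNorm_linftyNorm [SFinite μ] (X : BanachFunctionLattice μ)
    (h : ∃ f, f ≠ 0 ∧ X.nrm f < ∞) : ¬ OrderContinuousNorm (linftyNorm X.nrm) := by
  obtain ⟨f, hf0, hf⟩ := h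
  intro hoc
  obtain ⟨C, hC⟩ := X.solid
  have hm : ∀ n : ℕ, Measurable fun z : Ω × ℤ => ((if (n : ℤ) ≤ z.2 then ‖f z.1‖ else 0 : ℝ) : ℂ) :=
    fun n => Complex.measurable_ofReal.comp (Measurable.ite
      (measurableSet_le measurable_const measurable_snd)
      (f.measurable.comp measurable_fst).norm measurable_const)
  have hval := fun n => coeFn_classOf (μ := μ.prod Measure.count) _ (hm n)
  have hfm : Measurable fun x => ((‖f x‖ : ℝ) : ℂ) := Complex.measurable_ofReal.comp f.measurable.norm
  have habs : ∀ᵐ x ∂μ, ‖classOf μ _ hfm x‖ = ‖f x‖ := by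
    filter_upwards [coeFn_classOf _ hfm] with x hx
    rw [hx]; simp
  have hsup : ∀ n, linftyNorm X.nrm (classOf (μ.prod Measure.count) _ (hm n)) =
      X.nrm (classOf μ _ hfm) := fun n => by
    refine IsSupAbs.linftyNorm_eq ?_ _
    filter_upwards [coeFn_classOf _ hfm, ae_prod_count_iff.1 (hval n)] with x h1 h2
    refine ⟨‖f x‖, ⟨?_, fun b hb => ?_⟩, h1⟩
    · rintro _ ⟨j, rfl⟩
      simp only [h2 j, Complex.norm_real]
      split_ifs <;> simp
    · have := hb ⟨n, rfl⟩
      simpa [h2] using this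
  have hlim := hoc (fun n => classOf (μ.prod Measure.count) _ (hm n)) (fun n => by
    rw [hsup]
    exact (hC f _ (habs.mono fun x hx => hx.le)).trans_lt
      (ENNReal.mul_lt_top ENNReal.coe_lt_top hf)) (by
    filter_upwards [ae_all_iff.2 hval] with z hz
    simp_rw [hz]
    refine ⟨fun n => Complex.ofReal_im _, fun n m hnm => ?_, ?_⟩
    · simp only [Complex.ofReal_re]
      have : (n : ℤ) ≤ m := by exact_mod_cast hnm
      split_ifs with h1 h2 h2
      · exact le_rfl
      · exact absurd (this.trans h1) h2
      · exact norm_nonneg _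
      · exact le_rfl
    · refine tendsto_const_nhds.congr' ?_
      filter_upwards [eventually_gt_atTop z.2.toNat] with n hn
      rw [if_neg (by omega), Complex.ofReal_zero])
  simp_rw [hsup] at hlim
  have h0 := tendsto_nhds_unique tendsto_const_nhds hlim
  rw [X.nrm_eq_zero] at h0
  refine hf0 (AEEqFun.ext ?_)
  filter_upwards [habs, AEEqFun.coeFn_zero (μ := μ) (β := ℂ)] with x h1 h2
  rw [h0, h2, Pi.zero_apply, norm_zero, eq_comm, norm_eq_zero] at h1
  rw [h1, h2, Pi.zero_apply]

/-- With constant zero the function 1 has norm zero, even if its norm was a priori infinite since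
0·∞ = 0; so 1 = 0 almost everywhere. -/
lemma BanachFunctionLattice.measure_eq_zero (X : BanachFunctionLattice μ)
    (h : SolidWith X.nrm 0) : μ = 0 := by
  have h1 : X.nrm 1 = 0 := le_antisymm ((h 1 1 (ae_of_all _ fun _ => le_rfl)).trans (by simp)) zero_le
  have h2 := (X.nrm_eq_zero 1).1 h1
  have h3 : ∀ᵐ x ∂μ, False := by
    filter_upwards [AEEqFun.coeFn_one (μ := μ) (β := ℂ), AEEqFun.coeFn_zero (μ := μ) (β := ℂ)]
      with x h3 h4
    rw [h2, h4] at h3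
    simp at h3
  simpa using h3

/-! ### Return to the original norms -/

section main

variable [SFinite μ] {X₀ X₁ : BanachFunctionLattice μ} {θ : ℝ} {C₀ C₁ : ℝ≥0}
  {f : (Ω × ℤ) →ₘ[μ.prod Measure.count] ℂ}

omit [SFinite μ] in
lemma memF_solidHull {F : ℂ → (Ω × ℤ) →ₘ[μ.prod Measure.count] ℂ}
    (hF : MemF (linftyNorm X₀.nrm) (linftyNorm X₁.nrm) F) :
    MemF (linftyNorm (solidHull X₀.nrm)) (linftyNorm (solidHull X₁.nrm)) F := by
  obtain ⟨D₀, h₀⟩ := X₀.solid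
  obtain ⟨D₁, h₁⟩ := X₁.solid
  -- A common constant for both lattices; the summand 1 keeps it nonzero, as is needed for
  -- multiplication by infinite norms and infima.
  have hD : D₀ + D₁ + 1 ≠ 0 := by positivity
  exact hF.of_le_const_mul hD
    ((h₀.mono (le_add_right le_self_add)).linftyNorm_solidHull_le hD)
    ((h₁.mono (le_add_right le_add_self)).linftyNorm_solidHull_le hD)

/-- The geometric mean bound on Ω × ℤ has factors depending on the index j; replacing them by their
suprema over j keeps their norms and gives a bound by functions on Ω. -/
lemma MemF.linftyNorm_calderonNorm_le (hθ₀ : 0 < θ) (hθ₁ : θ < 1)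
    {F : ℂ → (Ω × ℤ) →ₘ[μ.prod Measure.count] ℂ}
    (hF : MemF (linftyNorm X₀.nrm) (linftyNorm X₁.nrm) F) :
    linftyNorm (calderonNorm X₀.nrm X₁.nrm θ) (F θ) ≤
      (⨆ t : ℝ, linftyNorm (solidHull X₀.nrm) (F ((0 : ℝ) + t * Complex.I))) ^ (1 - θ) *
      (⨆ t : ℝ, linftyNorm (solidHull X₁.nrm) (F ((1 : ℝ) + t * Complex.I))) ^ θ ∧
    (⨆ t : ℝ, linftyNorm (solidHull X₀.nrm) (F ((0 : ℝ) + t * Complex.I))) < ∞ ∧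
    (⨆ t : ℝ, linftyNorm (solidHull X₁.nrm) (F ((1 : ℝ) + t * Complex.I))) < ∞ := by
  have hF' := memF_solidHull hF
  have hA₀ := X₀.isLatticeNorm_solidHull.linftyNorm_isLatticeNorm
  have hA₁ := X₁.isLatticeNorm_solidHull.linftyNorm_isLatticeNorm
  have t₀ := hF'.line_zero.iSup_lt_top hA₀.isBanachNorm
  have t₁ := hF'.line_one.iSup_lt_top hA₁.isBanachNorm
  refine ⟨?_, t₀, t₁⟩
  obtain ⟨h₀, h₁, b₀, b₁, hb⟩ := hF'.exists_norm_le hA₀ hA₁ hθ₀ hθ₁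
  obtain ⟨H₀, hH₀, e₀⟩ := exists_isSupAbs_of_linftyNorm_lt_top (b₀.trans_lt t₀)
  obtain ⟨H₁, hH₁, e₁⟩ := exists_isSupAbs_of_linftyNorm_lt_top (b₁.trans_lt t₁)
  rw [e₀] at b₀
  rw [e₁] at b₁
  have hθ' : 0 < 1 - θ := sub_pos.2 hθ₁
  refine (_root_.linftyNorm_calderonNorm_le hθ₀ hθ₁ (H₀ := H₀) (H₁ := H₁) ?_).trans (by gcongr)
  filter_upwards [ae_prod_count_iff.1 hb, hH₀.norm_le, hH₁.norm_le] with x g1 g2 g3 j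
  refine (g1 j).trans ?_
  gcongr
  · exact g2 j
  · exact g3 j

/-- The construction is carried out for the hulls, to which order continuity passes by equivalence;
since a norm is at most its hull, the resulting function serves for the original norms without loss.
-/
lemma interpNorm_le_of_eq_mul (hX₀ : OrderContinuousNorm X₀.nrm) (hθ₀ : 0 < θ) (hθ₁ : θ < 1)
    {F f₀ f₁ : Ω →ₘ[μ] ℂ} (hF : IsSupAbs f F) (hFf : F = f₀ * f₁)
    (hfin : solidHull X₀.nrm (absPow (1 / (1 - θ)) f₀) ^ (1 - θ) *
      solidHull X₁.nrm (absPow (1 / θ) f₁) ^ θ < ∞) :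
    f ∈ interpSpace (linftyNorm X₀.nrm) (linftyNorm X₁.nrm) θ ∧
      interpNorm (linftyNorm X₀.nrm) (linftyNorm X₁.nrm) θ f ≤
        solidHull X₀.nrm (absPow (1 / (1 - θ)) f₀) ^ (1 - θ) *
          solidHull X₁.nrm (absPow (1 / θ) f₁) ^ θ := by
  have hθ' : 0 < 1 - θ := sub_pos.2 hθ₁
  obtain ⟨D, hD⟩ := X₀.solid
  have hoc := hX₀.of_le_const_mul hD.solidHull_le (self_le_solidHull _)
  have hf : ∀ᵐ x ∂μ, ∀ j : ℤ, ‖f (x, j)‖ ≤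
      ‖absPow (1 / (1 - θ)) f₀ x‖ ^ (1 - θ) * ‖absPow (1 / θ) f₁ x‖ ^ θ := by
    filter_upwards [hF.norm_le, ae_absPow (1 / (1 - θ)) f₀, ae_absPow (1 / θ) f₁,
      AEEqFun.coeFn_mul f₀ f₁] with x h1 h2 h3 h4 j
    refine (h1 j).trans_eq ?_
    rw [h2, h3, hFf, h4, Pi.mul_apply, norm_mul, Complex.norm_real, Complex.norm_real,
      Real.norm_of_nonneg (by positivity), Real.norm_of_nonneg (by positivity),
      ← Real.rpow_mul (norm_nonneg _), ← Real.rpow_mul (norm_nonneg _),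
      one_div_mul_cancel hθ'.ne', one_div_mul_cancel hθ₀.ne', Real.rpow_one, Real.rpow_one]
  obtain ⟨⟨G, hG, e⟩, h2⟩ := interpNorm_linftyNorm_le_rpow_mul_rpow X₀.isLatticeNorm_solidHull
    X₁.isLatticeNorm_solidHull hoc hθ₀ hθ₁ hf hfin
  have m₀ := linftyNorm_mono (μ := μ) (self_le_solidHull X₀.nrm)
  have m₁ := linftyNorm_mono (μ := μ) (self_le_solidHull X₁.nrm)
  exact ⟨⟨G, hG.of_le_const_mul (C := 1) one_ne_zero (by simpa using m₀) (by simpa using m₁), e⟩,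
    (interpNorm_mono m₀ m₁ θ f).trans h2⟩

end main

lemma mul_rpow_mul_mul_rpow {θ : ℝ} (hθ₀ : 0 < θ) (hθ₁ : θ < 1) (C₀ C₁ : ℝ≥0) (a b : ℝ≥0∞) :
    (C₀ * a) ^ (1 - θ) * (C₁ * b) ^ θ =
      ((C₀ ^ (1 - θ) * C₁ ^ θ : ℝ≥0) : ℝ≥0∞) * (a ^ (1 - θ) * b ^ θ) := by
  have hθ' : 0 < 1 - θ := sub_pos.2 hθ₁
  rw [ENNReal.mul_rpow_of_nonneg _ _ hθ'.le, ENNReal.mul_rpow_of_nonneg _ _ hθ₀.le,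
    mul_mul_mul_comm, ENNReal.coe_mul, ENNReal.coe_rpow_of_nonneg _ hθ'.le,
    ENNReal.coe_rpow_of_nonneg _ hθ₀.le]

end

theorem mainTheorem4 {Ω : Type*} [MeasurableSpace Ω] (μ : Measure Ω) [SigmaFinite μ]
    (X₀ X₁ : BanachFunctionLattice μ) (hX₀ : OrderContinuousNorm X₀.nrm)
    (θ : ℝ) (hθ₀ : 0 < θ) (hθ₁ : θ < 1) :
    -- equality of the two spaces
    ComplexInterp.interpSpace (linftyNorm X₀.nrm) (linftyNorm X₁.nrm) θ =
      {f | linftyNorm (calderonNorm X₀.nrm X₁.nrm θ) f < ∞} ∧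
    -- equivalence of their norms, with equality if `C₀ = C₁ = 1`
    (∀ C₀ C₁ : ℝ≥0, SolidWith X₀.nrm C₀ → SolidWith X₁.nrm C₁ →
      ∀ f : (Ω × ℤ) →ₘ[μ.prod Measure.count] ℂ,
        linftyNorm (calderonNorm X₀.nrm X₁.nrm θ) f ≤
          ((C₀ ^ (1 - θ) * C₁ ^ θ : ℝ≥0) : ℝ≥0∞) *
            ComplexInterp.interpNorm (linftyNorm X₀.nrm) (linftyNorm X₁.nrm) θ f ∧
        ComplexInterp.interpNorm (linftyNorm X₀.nrm) (linftyNorm X₁.nrm) θ f ≤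
          ((C₀ ^ (1 - θ) * C₁ ^ θ : ℝ≥0) : ℝ≥0∞) *
            linftyNorm (calderonNorm X₀.nrm X₁.nrm θ) f) ∧
    -- the `ℓ^∞`-valued lattices never have order continuous norm
    ((∃ f, f ≠ 0 ∧ X₀.nrm f < ∞) → ¬ OrderContinuousNorm (linftyNorm X₀.nrm)) ∧
    ((∃ f, f ≠ 0 ∧ X₁.nrm f < ∞) → ¬ OrderContinuousNorm (linftyNorm X₁.nrm)) := by
  have hθ' : 0 < 1 - θ := sub_pos.2 hθ₁
  refine ⟨Subset.antisymm ?_ ?_, ?_, not_orderContinuousNorm_linftyNorm X₀,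
    not_orderContinuousNorm_linftyNorm X₁⟩
  · rintro _ ⟨F, hF, rfl⟩
    obtain ⟨h, t₀, t₁⟩ := MemF.linftyNorm_calderonNorm_le hθ₀ hθ₁ hF
    exact h.trans_lt (ENNReal.mul_lt_top (ENNReal.rpow_lt_top_of_nonneg hθ'.le t₀.ne)
      (ENNReal.rpow_lt_top_of_nonneg hθ₀.le t₁.ne))
  · intro f hf
    have hf' : linftyNorm (calderonNorm X₀.nrm X₁.nrm θ) f < ∞ := hf
    obtain ⟨F, hF, e⟩ := exists_isSupAbs_of_linftyNorm_lt_top hf'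
    rw [e] at hf'
    obtain ⟨f₀, h1⟩ := iInf_lt_iff.1 hf'
    obtain ⟨f₁, h2⟩ := iInf_lt_iff.1 h1
    obtain ⟨hFf, h3⟩ := iInf_lt_iff.1 h2
    obtain ⟨D₀, hD₀⟩ := X₀.solid
    obtain ⟨D₁, hD₁⟩ := X₁.solid
    refine (interpNorm_le_of_eq_mul hX₀ hθ₀ hθ₁ hF hFf (lt_of_le_of_lt (mul_le_mul'
      (ENNReal.rpow_le_rpow (hD₀.solidHull_le _) hθ'.le)
      (ENNReal.rpow_le_rpow (hD₁.solidHull_le _) hθ₀.le)) ?_)).1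
    rw [mul_rpow_mul_mul_rpow hθ₀ hθ₁]
    exact ENNReal.mul_lt_top ENNReal.coe_lt_top h3
  · intro C₀ C₁ hC₀ hC₁ f
    -- A zero constant cannot be divided out, and the claim then says that both norms vanish
    -- identically. This is so because a zero lattice constant forces μ = 0.
    by_cases hC : C₀ ^ (1 - θ) * C₁ ^ θ = 0
    · have hμ : μ = 0 := by
        rcases mul_eq_zero.1 hC with h | h
        · have : C₀ = 0 := (NNReal.rpow_eq_zero hθ'.ne').1 h
          exact X₀.measure_eq_zero (this ▸ hC₀)
        · have : C₁ = 0 := (NNReal.rpow_eq_zero hθ₀.ne').1 h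
          exact X₁.measure_eq_zero (this ▸ hC₁)
      have hae : ∀ p : Ω → Prop, ∀ᵐ x ∂μ, p x := fun p => by rw [hμ]; simp
      have hz : solidHull X₀.nrm 0 ^ (1 - θ) * solidHull X₁.nrm 0 ^ θ = 0 := by
        rw [X₀.isLatticeNorm_solidHull.map_zero, ENNReal.zero_rpow_of_pos hθ', zero_mul]
      refine ⟨?_, ?_⟩
      · refine ((linftyNorm_calderonNorm_le hθ₀ hθ₁ (H₀ := 0) (H₁ := 0) (hae _)).trans_eq hz).trans
          zero_le
      · have hp : ∀ p : ℝ, solidHull X₀.nrm (absPow p 0) = 0 := fun p => by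
          rw [show absPow p (0 : Ω →ₘ[μ] ℂ) = 0 from AEEqFun.ext (hae _),
            X₀.isLatticeNorm_solidHull.map_zero]
        have h1 : solidHull X₀.nrm (absPow (1 / (1 - θ)) 0) ^ (1 - θ) *
            solidHull X₁.nrm (absPow (1 / θ) 0) ^ θ = 0 := by
          rw [hp, ENNReal.zero_rpow_of_pos hθ', zero_mul]
        exact ((interpNorm_le_of_eq_mul hX₀ hθ₀ hθ₁ (F := 0) (f₀ := 0) (f₁ := 0) (hae _)
          (AEEqFun.ext (hae _)) (h1.trans_lt ENNReal.zero_lt_top)).2.trans_eq h1).trans zero_le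
    have hC' : ((C₀ ^ (1 - θ) * C₁ ^ θ : ℝ≥0) : ℝ≥0∞) ≠ 0 := by exact_mod_cast hC
    have hC₀' : C₀ ≠ 0 := fun h => hC (by rw [h, NNReal.zero_rpow hθ'.ne', zero_mul])
    have hC₁' : C₁ ≠ 0 := fun h => hC (by rw [h, NNReal.zero_rpow hθ₀.ne', mul_zero])
    refine ⟨?_, ?_⟩
    · rw [← ENNReal.inv_mul_le_iff hC' ENNReal.coe_ne_top]
      refine le_iInf fun F => le_iInf₂ fun hF hFf => ?_
      rw [ENNReal.inv_mul_le_iff hC' ENNReal.coe_ne_top, ← hFf]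
      set M := normF (linftyNorm X₀.nrm) (linftyNorm X₁.nrm) F with hM
      have hM₀ : ∀ t : ℝ, linftyNorm X₀.nrm (F ((0 : ℝ) + t * Complex.I)) ≤ M := fun t =>
        (le_max_left _ _).trans (le_iSup (fun t : ℝ => max
          (linftyNorm X₀.nrm (F ((0 : ℝ) + t * Complex.I)))
          (linftyNorm X₁.nrm (F ((1 : ℝ) + t * Complex.I)))) t)
      have hM₁ : ∀ t : ℝ, linftyNorm X₁.nrm (F ((1 : ℝ) + t * Complex.I)) ≤ M := fun t =>
        (le_max_right _ _).trans (le_iSup (fun t : ℝ => max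
          (linftyNorm X₀.nrm (F ((0 : ℝ) + t * Complex.I)))
          (linftyNorm X₁.nrm (F ((1 : ℝ) + t * Complex.I)))) t)
      refine (MemF.linftyNorm_calderonNorm_le hθ₀ hθ₁ hF).1.trans ?_
      -- Writing M as M^{1-θ} M^θ distributes the constants C_0 and C_1 over the two boundary
      -- suprema.
      have hpow : M ^ (1 - θ) * M ^ θ = M := by
        rw [← ENNReal.rpow_add_of_nonneg _ _ hθ'.le hθ₀.le, sub_add_cancel, ENNReal.rpow_one]
      rw [← hpow, ← mul_rpow_mul_mul_rpow hθ₀ hθ₁]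
      gcongr
      · exact iSup_le fun t => (hC₀.linftyNorm_solidHull_le hC₀' _).trans (by gcongr; exact hM₀ t)
      · exact iSup_le fun t => (hC₁.linftyNorm_solidHull_le hC₁' _).trans (by gcongr; exact hM₁ t)
    · rw [← ENNReal.inv_mul_le_iff hC' ENNReal.coe_ne_top]
      refine le_iInf₂ fun F hF => le_iInf₂ fun f₀ f₁ => le_iInf fun hFf => ?_
      rw [ENNReal.inv_mul_le_iff hC' ENNReal.coe_ne_top, ← mul_rpow_mul_mul_rpow hθ₀ hθ₁]
      have hle : solidHull X₀.nrm (absPow (1 / (1 - θ)) f₀) ^ (1 - θ) *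
          solidHull X₁.nrm (absPow (1 / θ) f₁) ^ θ ≤
          (C₀ * X₀.nrm (absPow (1 / (1 - θ)) f₀)) ^ (1 - θ) *
            (C₁ * X₁.nrm (absPow (1 / θ) f₁)) ^ θ := by
        gcongr
        · exact hC₀.solidHull_le _
        · exact hC₁.solidHull_le _
      -- If the product of the hulls is infinite, so is the larger product on the right, and there
      -- is nothing to prove for this factorization.
      by_cases hfin : solidHull X₀.nrm (absPow (1 / (1 - θ)) f₀) ^ (1 - θ) *
          solidHull X₁.nrm (absPow (1 / θ) f₁) ^ θ < ∞
      · exact (interpNorm_le_of_eq_mul hX₀ hθ₀ hθ₁ hF hFf hfin).2.trans hle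
      · rw [not_lt_top_iff.1 hfin] at hle
        exact le_top.trans hle

end
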